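/- Let $V:(0,\infty)\to\mathbb C$ be a bounded measurable potential with $\int_0^\infty x|V(x)|\,dx<\infty$, and let $L_V=-d^2/dx^2+V(x)$ be the Schrödinger operator in $L_2(0,\infty)$ with the Dirichlet boundary condition at zero; $L_0$ is the operator with $V\equiv 0$. For $k\in\mathbb R$ let $e(\cdot,k)$ be the Jost solution, i.e. the solution of $-y''+Vy=k^2y$ on $[0,\infty)$ with $e(x,k)\sim e^{ikx}$ as $x\to\infty$; a spectral singularity of $L_V$ is a point $k^2$ with $k\in\mathbb R$ and $e(0,k)=0$. Suppose that $L_V$ has neither eigenvalues nor spectral singularities. Then $iL_0$ and $iL_V$ generate strongly continuous groups $e^{itL_0}$ and $e^{itL_V}$ $(t\in\mathbb R)$ of bounded operators in $L_2(0,\infty)$, the wave operators $$W_\pm=\operatorname*{s-lim}_{t\to\pm\infty}e^{itL_V}e^{-itL_0},\qquad \widetilde W_\pm=\operatorname*{s-lim}_{t\to\pm\infty}e^{itL_0}e^{-itL_V}$$ exist as bounded operators, and: 1. $e^{itL_V}=W_\pm e^{itL_0}\widetilde W_\pm$ for all $t\in\mathbb R$ (for each choice of the sign), and this propagator is uniformly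 bounded, $\sup_{t\in\mathbb R}\|e^{itL_V}\|<\infty$; 2. $L_V$ is a spectral operator in the sense of Dunford: $L_V$ is closed, and there is a bounded, strongly countably additive projection-valued measure $E$ on the Borel sets of $\mathbb C$ with $E(\mathbb C)=I$ and $E(\delta_1\cap\delta_2)=E(\delta_1)E(\delta_2)$, such that, for every Borel set $\delta$, $E(\delta)D(L_V)\subset D(L_V)$ and $L_VE(\delta)f=E(\delta)L_Vf$ for $f\in D(L_V)$, $E(\delta)L_2(0,\infty)\subset D(L_V)$ if $\delta$ is bounded, and the spectrum of the restriction of $L_V$ to $E(\delta)L_2(0,\infty)$ is contained in the closure of $\delta$. -/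

import Mathlib

open MeasureTheory Set Filter Topology
open scoped ENNReal

/-! ### Unbounded operators, propagators and spectral operators -/

section Abstract

variable {X : Type*} [NormedAddCommGroup X] [NormedSpace ℂ X]

/-- `z` is an eigenvalue of the (unbounded) operator `T`. -/
def IsEigenvalue (T : X →ₗ.[ℂ] X) (z : ℂ) : Prop :=
  ∃ f : T.domain, (f : X) ≠ 0 ∧ T f = z • (f : X)

/-- The resolvent set of an unbounded operator: `T - z` has an everywhere defined bounded
two-sided inverse `R`. -/
def resolventSetOf (T : X →ₗ.[ℂ] X) : Set ℂ :=
  {z | ∃ R : X →L[ℂ] X,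
    (∀ x : X, ∃ h : R x ∈ T.domain, T ⟨R x, h⟩ - z • R x = x) ∧
    (∀ x : T.domain, R (T x - z • (x : X)) = x)}

/-- The spectrum of an unbounded operator. -/
def spectrumOf (T : X →ₗ.[ℂ] X) : Set ℂ := (resolventSetOf T)ᶜ

/-- The part of `T` in a subspace `M`: its domain is `{x ∈ M ∩ D(T) : T x ∈ M}`. -/
def partIn (T : X →ₗ.[ℂ] X) (M : Submodule ℂ X) : M →ₗ.[ℂ] M where
  domain :=
    { carrier := {x | ∃ h : (x : X) ∈ T.domain, T ⟨x, h⟩ ∈ M}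
      add_mem' := by
        rintro a b ⟨ha, ha'⟩ ⟨hb, hb'⟩
        refine ⟨T.domain.add_mem ha hb, ?_⟩
        have := T.map_add ⟨a, ha⟩ ⟨b, hb⟩
        have h2 := M.add_mem ha' hb'
        rw [← this] at h2
        exact h2
      zero_mem' := by
        refine ⟨T.domain.zero_mem, ?_⟩
        have h2 := M.zero_mem
        rw [← T.map_zero] at h2
        exact h2
      smul_mem' := by
        rintro c a ⟨ha, ha'⟩
        refine ⟨T.domain.smul_mem c ha, ?_⟩
        have := T.map_smul c ⟨a, ha⟩
        have h2 := M.smul_mem c ha'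
        rw [← this] at h2
        exact h2 }
  toFun :=
    { toFun := fun x => ⟨T ⟨(x : M), x.2.1⟩, x.2.2⟩
      map_add' := fun a b => Subtype.ext (T.map_add ⟨(a : M), a.2.1⟩ ⟨(b : M), b.2.1⟩)
      map_smul' := fun c a => Subtype.ext (T.map_smul c ⟨(a : M), a.2.1⟩) }

/-- `U` is the propagator `t ↦ e^{itT}`: a strongly continuous one-parameter group of bounded
operators whose infinitesimal generator is exactly `iT`. -/
structure IsPropagator (T : X →ₗ.[ℂ] X) (U : ℝ → X →L[ℂ] X) : Prop where
  zero : U 0 = ContinuousLinearMap.id ℂ X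
  add : ∀ s t : ℝ, U (s + t) = (U s).comp (U t)
  continuous : ∀ f : X, Continuous fun t => U t f
  generator : ∀ f g : X,
    Tendsto (fun t : ℝ => (t : ℂ)⁻¹ • (U t f - f)) (𝓝[≠] 0) (𝓝 g) ↔
      ∃ h : f ∈ T.domain, g = Complex.I • T ⟨f, h⟩

/-- A bounded, strongly countably additive spectral measure on the Borel sets of the complex
plane; only the values on Borel sets matter. -/
structure IsSpectralMeasure (E : Set ℂ → X →L[ℂ] X) : Prop where
  univ : E Set.univ = ContinuousLinearMap.id ℂ X
  inter : ∀ A B : Set ℂ, MeasurableSet A → MeasurableSet B → E (A ∩ B) = (E A).comp (E B)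
  bounded : ∃ C : ℝ, ∀ A : Set ℂ, MeasurableSet A → ‖E A‖ ≤ C
  iUnion : ∀ A : ℕ → Set ℂ, (∀ n, MeasurableSet (A n)) → Pairwise (Function.onFun Disjoint A) →
    ∀ x : X, HasSum (fun n => E (A n) x) (E (⋃ n, A n) x)

/-- Spectral operators in the sense of Dunford (not necessarily bounded): closed operators `T`
which admit a resolution of the identity `E`, that is, a spectral measure that commutes with `T`,
maps into the domain of `T` on bounded Borel sets, and satisfies `σ(T | E(δ)X) ⊆ closure δ` for
every Borel set `δ`. -/
def IsDunfordSpectral (T : X →ₗ.[ℂ] X) : Prop :=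
  T.IsClosed ∧ ∃ E : Set ℂ → X →L[ℂ] X, IsSpectralMeasure E ∧
    (∀ δ : Set ℂ, MeasurableSet δ → ∀ x : T.domain,
      ∃ h : E δ x ∈ T.domain, T ⟨E δ x, h⟩ = E δ (T x)) ∧
    (∀ δ : Set ℂ, MeasurableSet δ → Bornology.IsBounded δ → ∀ x : X, E δ x ∈ T.domain) ∧
    (∀ δ : Set ℂ, MeasurableSet δ →
      spectrumOf (partIn T (LinearMap.range (E δ : X →ₗ[ℂ] X))) ⊆ closure δ)

end Abstract

/-! ### The Schrödinger operator on the half-line -/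

/-- The Hilbert space `L₂(0, ∞)`. -/
abbrev HalfLineL2 : Type := Lp ℂ 2 (volume.restrict (Ioi (0 : ℝ)))

/-- On `[0, ∞)` the function `y` is continuously differentiable with derivative `p`, and `p` is
locally absolutely continuous with almost everywhere derivative `q`. -/
structure HasSecondDerivative (y p q : ℝ → ℂ) : Prop where
  hasDeriv : ∀ x : ℝ, 0 ≤ x → HasDerivWithinAt y (p x) (Ici 0) x
  integrable : ∀ x : ℝ, 0 ≤ x → IntervalIntegrable q volume 0 x
  eq_integral : ∀ x : ℝ, 0 ≤ x → p x = p 0 + ∫ s in (0 : ℝ)..x, q s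

theorem HasSecondDerivative.add {y p q y' p' q' : ℝ → ℂ} (h : HasSecondDerivative y p q)
    (h' : HasSecondDerivative y' p' q') : HasSecondDerivative (y + y') (p + p') (q + q') where
  hasDeriv x hx := (h.hasDeriv x hx).add (h'.hasDeriv x hx)
  integrable x hx := (h.integrable x hx).add (h'.integrable x hx)
  eq_integral x hx := by
    simp only [Pi.add_apply]
    rw [intervalIntegral.integral_add (h.integrable x hx) (h'.integrable x hx),
      h.eq_integral x hx, h'.eq_integral x hx]
    ring

theorem HasSecondDerivative.smul {y p q : ℝ → ℂ} (c : ℂ) (h : HasSecondDerivative y p q) :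
    HasSecondDerivative (c • y) (c • p) (c • q) where
  hasDeriv x hx := (h.hasDeriv x hx).const_smul c
  integrable x hx := (h.integrable x hx).smul c
  eq_integral x hx := by
    simp only [Pi.smul_apply]
    rw [intervalIntegral.integral_smul, h.eq_integral x hx, smul_add]

theorem HasSecondDerivative.zero : HasSecondDerivative 0 0 0 where
  hasDeriv x _ := hasDerivWithinAt_const x _ (0 : ℂ)
  integrable x _ := intervalIntegrable_const (c := (0 : ℂ))
  eq_integral x _ := by simp

/-- The graph of `L_V = -d²/dx² + V` with the Dirichlet condition at zero: the pairs `(f, g)` in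
`L₂ × L₂` with `f = y`, `g = -y'' + V y` almost everywhere, where `y` and `y'` are locally
absolutely continuous on `[0, ∞)` and `y 0 = 0`. -/
def schrodingerGraph (V : ℝ → ℂ) : Submodule ℂ (HalfLineL2 × HalfLineL2) where
  carrier := {fg | ∃ y p q : ℝ → ℂ, HasSecondDerivative y p q ∧ y 0 = 0 ∧
    (∀ᵐ x ∂(volume.restrict (Ioi (0 : ℝ))), fg.1 x = y x) ∧
    (∀ᵐ x ∂(volume.restrict (Ioi (0 : ℝ))), fg.2 x = -q x + V x * y x)}
  add_mem' := by
    rintro a b ⟨y, p, q, h, h0, hf, hg⟩ ⟨y', p', q', h', h0', hf', hg'⟩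
    refine ⟨y + y', p + p', q + q', h.add h', by simp [h0, h0'], ?_, ?_⟩
    · filter_upwards [hf, hf', Lp.coeFn_add a.1 b.1] with x h1 h2 h3
      simp only [Prod.fst_add, h3, Pi.add_apply, h1, h2]
    · filter_upwards [hg, hg', Lp.coeFn_add a.2 b.2] with x h1 h2 h3
      simp only [Prod.snd_add, h3, Pi.add_apply, h1, h2]
      ring
  zero_mem' := by
    refine ⟨0, 0, 0, HasSecondDerivative.zero, rfl, ?_, ?_⟩
    · filter_upwards [Lp.coeFn_zero ℂ 2 (volume.restrict (Ioi (0 : ℝ)))] with x hx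
      exact hx
    · filter_upwards [Lp.coeFn_zero ℂ 2 (volume.restrict (Ioi (0 : ℝ)))] with x hx
      refine hx.trans ?_
      simp
  smul_mem' := by
    rintro c a ⟨y, p, q, h, h0, hf, hg⟩
    refine ⟨c • y, c • p, c • q, h.smul c, by simp [h0], ?_, ?_⟩
    · filter_upwards [hf, Lp.coeFn_smul c a.1] with x h1 h3
      simp only [Prod.smul_fst, h3, Pi.smul_apply, h1]
    · filter_upwards [hg, Lp.coeFn_smul c a.2] with x h1 h3
      simp only [Prod.smul_snd, h3, Pi.smul_apply, h1, smul_eq_mul]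
      ring

/-- The operator `L_V = -d²/dx² + V` in `L₂(0, ∞)` with the Dirichlet condition at zero. -/
noncomputable def schrodingerOp (V : ℝ → ℂ) : HalfLineL2 →ₗ.[ℂ] HalfLineL2 :=
  (schrodingerGraph V).toLinearPMap

theorem schrodingerGraph_single_valued (V : ℝ → ℂ) (fg : HalfLineL2 × HalfLineL2)
    (hfg : fg ∈ schrodingerGraph V) (h0 : fg.1 = 0) : fg.2 = 0 := by
  obtain ⟨y, p, q, h, hy0, hf, hg⟩ := hfg
  have hyc : ContinuousOn y (Ici 0) := fun x hx => (h.hasDeriv x hx).continuousWithinAt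
  have hae : y =ᵐ[volume.restrict (Ioi (0 : ℝ))] (fun _ => (0 : ℂ)) := by
    rw [h0] at hf
    filter_upwards [hf, Lp.coeFn_zero ℂ 2 (volume.restrict (Ioi (0 : ℝ)))] with x h1 h2
    rw [← h1, h2]; rfl
  have hy1 : EqOn y (fun _ => (0 : ℂ)) (Ioi 0) :=
    Measure.eqOn_open_of_ae_eq hae isOpen_Ioi (hyc.mono Ioi_subset_Ici_self) continuousOn_const
  have hy : ∀ x ∈ Ici (0 : ℝ), y x = 0 := by
    intro x hx
    rcases eq_or_lt_of_le (show (0 : ℝ) ≤ x from hx) with h1 | h1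
    · rw [← h1, hy0]
    · exact hy1 h1
  have hp : ∀ x : ℝ, 0 ≤ x → p x = 0 := by
    intro x hx
    have h2 : HasDerivWithinAt y 0 (Ici 0) x :=
      (hasDerivWithinAt_const x (Ici 0) (0 : ℂ)).congr hy (hy x hx)
    exact ((uniqueDiffOn_Ici (0 : ℝ)) x hx).eq_deriv _ (h.hasDeriv x hx) h2
  have hint : ∀ x : ℝ, 0 ≤ x → ∫ s in (0 : ℝ)..x, q s = 0 := by
    intro x hx
    have h2 := h.eq_integral x hx
    rw [hp x hx, hp 0 le_rfl, zero_add] at h2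
    exact h2.symm
  have hq : ∀ n : ℕ, ∀ᵐ x, x ∈ Ioo (0 : ℝ) n → q x = 0 := by
    intro n
    have hn : (0 : ℝ) ≤ n := n.cast_nonneg
    filter_upwards [(h.integrable n hn).ae_hasDerivAt_integral] with x hx hxn
    have hx' := hx (by rw [uIcc_of_le hn]; exact Ioo_subset_Icc_self hxn) 0
      (by rw [uIcc_of_le hn]; exact ⟨le_rfl, hn⟩)
    have h3 : HasDerivAt (fun x => ∫ s in (0 : ℝ)..x, q s) 0 x := by
      refine (hasDerivAt_const x (0 : ℂ)).congr_of_eventuallyEq ?_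
      filter_upwards [Ioi_mem_nhds hxn.1] with z hz
      exact hint z (le_of_lt hz)
    exact hx'.unique h3
  have hq' : ∀ᵐ x ∂(volume.restrict (Ioi (0 : ℝ))), q x = 0 := by
    rw [ae_restrict_iff' measurableSet_Ioi]
    filter_upwards [ae_all_iff.2 hq] with x hx hx0
    obtain ⟨n, hn⟩ := exists_nat_gt x
    exact hx n ⟨hx0, hn⟩
  refine Lp.ext ?_
  filter_upwards [hg, hq', hae, Lp.coeFn_zero ℂ 2 (volume.restrict (Ioi (0 : ℝ)))]
    with x h1 h2 h3 h4
  rw [h1, h2, h3, h4]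
  simp

/-- The operator `L_V` has the graph it was defined by. -/
theorem schrodingerOp_graph (V : ℝ → ℂ) : (schrodingerOp V).graph = schrodingerGraph V :=
  Submodule.toLinearPMap_graph_eq _ (schrodingerGraph_single_valued V)

/-- `e` is the Jost solution at `k`: a solution of `-y'' + V y = k² y` on `[0, ∞)` with
`e x ~ e^{ikx}` as `x → ∞`. -/
def IsJostSolution (V : ℝ → ℂ) (k : ℂ) (e : ℝ → ℂ) : Prop :=
  (∃ p q : ℝ → ℂ, HasSecondDerivative e p q ∧
    ∀ᵐ x ∂(volume.restrict (Ioi (0 : ℝ))), -q x + V x * e x = k ^ 2 * e x) ∧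
  Tendsto (fun x : ℝ => e x * Complex.exp (-(Complex.I * k * x))) atTop (𝓝 1)

/-- `z` is a spectral singularity of `L_V`: `z = k²` for a real zero `k` of the Jost function
`e(k) = e(0, k)`. -/
def IsSpectralSingularity (V : ℝ → ℂ) (z : ℂ) : Prop :=
  ∃ k : ℝ, z = (k : ℂ) ^ 2 ∧ ∃ e : ℝ → ℂ, IsJostSolution V k e ∧ e 0 = 0

/-! The proof is Kato's theory of smooth perturbations: `L_V` turns out to be similar to the
self-adjoint `L_0`, with the wave operator as similarity. Write `iV = A C`, where `A` is
multiplication by `√|V|` and `|C f| ≤ |A f|` in norm.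

The analytic input is a bound on `A (L_V - k²)⁻¹ A` that is uniform in `Im k > 0`. The amplitudes
`e^{-ikx} e(x,k)` of the Jost solution and `e^{ikx} φ(x,k)` of the regular solution solve Volterra
equations whose kernels are controlled by `s|V(s)|`; they are bounded by `C` and `C x`, uniformly in
the closed upper half plane (`exists_jost_amplitude`, `exists_regular_amplitude`). A zero of
`e(0,k)` would be an eigenvalue (`Im k > 0`) or a spectral singularity (`k` real), and `e(0,k) → 1`
as `|k| → ∞`, so compactness bounds `|e(0,k)|` below. The Green function is then at most a constant
times `min(x,s) ≤ √x √s` (`green_bound`), and Cauchy-Schwarz together with `∫ x|V| < ∞` gives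
`exists_sandwich_bound`, for `V` as well as for `0`.

Plancherel turns bounds on the Laplace transform of an orbit along vertical lines into bounds on `∫
e^{-2at} ‖A U(t) f‖² dt`. For the unitary group this is `ResolventBound.energyBound_of_isometric`;
the resolvent identity carries it to the perturbed group (`EnergyBound.of_isPerturbation`). A priori
the perturbed group only grows at most exponentially, so its Laplace transform is available only far
to the right. Duhamel's formula gives `‖U(t)‖ ≤ N e^{ωt}` with `N` independent of the admissible
exponent `ω`, and an argument in the style of Datko lowers `ω` by a fixed factor; iteration yields
uniform boundedness (`IsPerturbation.exists_norm_le`).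

With the damping removed, Duhamel's formula and Cauchy-Schwarz make both families of products Cauchy
(`IsPerturbation.exists_tendsto`). One family needs the adjoint group, which is the perturbation
with `V` replaced by its conjugate. The limits are mutually inverse and intertwine the two groups
(`IsC0Group.wave_operators_inverse`), which is the factorization of the propagator. Finally the sine
transform diagonalizes `L_0`, so `L_V` is similar to multiplication by `4π²ξ²`, and the indicator
functions of that multiplier give the resolution of the identity (`isDunfordSpectral_of_similar`).
-/

open scoped BoundedContinuousFunction FourierTransform

/-! ### Calculus of primitives of locally integrable functions -/

/-- A comparison principle: the oscillation sums of `f` are dominated by those of `g`. It reduces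
absolute continuity of vector-valued functions to real ones. -/
theorem AbsolutelyContinuousOnInterval.of_dist_le {E F : Type*} [NormedAddCommGroup E]
    [NormedAddCommGroup F] {f : ℝ → E} {g : ℝ → F} {a b C : ℝ}
    (hg : AbsolutelyContinuousOnInterval g a b)
    (h : ∀ x ∈ uIcc a b, ∀ y ∈ uIcc a b, dist (f x) (f y) ≤ C * dist (g x) (g y)) :
    AbsolutelyContinuousOnInterval f a b := by
  unfold AbsolutelyContinuousOnInterval at hg ⊢
  refine squeeze_zero' ?_ ?_ (by simpa using hg.const_mul C)
  · exact Filter.Eventually.of_forall fun _ => Finset.sum_nonneg fun i _ => dist_nonneg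
  · rw [eventually_inf_principal]
    filter_upwards with I hI
    rw [Finset.mul_sum]
    exact Finset.sum_le_sum fun i hi => h _ (hI.1 i hi).1 _ (hI.1 i hi).2

theorem IntervalIntegrable.absolutelyContinuousOnInterval_primitive {E : Type*}
    [NormedAddCommGroup E] [NormedSpace ℝ E] {f : ℝ → E} {a b : ℝ}
    (hf : IntervalIntegrable f volume a b) :
    AbsolutelyContinuousOnInterval (fun x => ∫ s in a..x, f s) a b := by
  refine AbsolutelyContinuousOnInterval.of_dist_le (C := 1)
    (hf.norm.absolutelyContinuousOnInterval_intervalIntegral (c := a) left_mem_uIcc) ?_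
  intro x hx y hy
  have h1 : ∀ z ∈ uIcc a b, IntervalIntegrable f volume a z := fun z hz =>
    hf.mono_set (uIcc_subset_uIcc left_mem_uIcc hz)
  rw [dist_eq_norm, dist_eq_norm, one_mul,
    intervalIntegral.integral_interval_sub_left (h1 x hx) (h1 y hy),
    intervalIntegral.integral_interval_sub_left (h1 x hx).norm (h1 y hy).norm]
  exact intervalIntegral.norm_integral_le_abs_integral_norm

/-- Subtracting from `F` the primitive of `f` leaves an absolutely continuous function with
derivative zero almost everywhere, hence a constant. -/
theorem AbsolutelyContinuousOnInterval.integral_eq_sub_of_ae_hasDerivAt {E : Type*}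
    [NormedAddCommGroup E] [NormedSpace ℝ E] [CompleteSpace E] {F f : ℝ → E} {a b : ℝ}
    (hF : AbsolutelyContinuousOnInterval F a b)
    (hd : ∀ᵐ x, x ∈ uIcc a b → HasDerivAt F (f x) x) (hf : IntervalIntegrable f volume a b) :
    ∫ x in a..b, f x = F b - F a := by
  have hg := hF.sub hf.absolutelyContinuousOnInterval_primitive
  obtain ⟨C, hC⟩ := hg.const_of_ae_hasDerivAt_zero (by
    filter_upwards [hd, hf.ae_hasDerivAt_integral] with x h1 h2 h3
    simpa using (h1 h3).sub (h2 h3 a left_mem_uIcc))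
  have ha := hC a left_mem_uIcc
  have hb := hC b right_mem_uIcc
  simp only [Pi.sub_apply, intervalIntegral.integral_same, sub_zero] at ha hb
  rw [ha, ← hb]; abel

/-- On `[0, ∞)` the function `F` is a primitive of the locally integrable function `f`. -/
def IsPrimitive (F f : ℝ → ℂ) : Prop :=
  ∀ x : ℝ, 0 ≤ x → IntervalIntegrable f volume 0 x ∧ F x = F 0 + ∫ s in (0 : ℝ)..x, f s

namespace IsPrimitive

variable {F G f g : ℝ → ℂ}

theorem absolutelyContinuous (h : IsPrimitive F f) {x : ℝ} (hx : 0 ≤ x) :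
    AbsolutelyContinuousOnInterval F 0 x := by
  refine AbsolutelyContinuousOnInterval.of_dist_le (C := 1)
    (h x hx).1.absolutelyContinuousOnInterval_primitive ?_
  intro y hy z hz
  rw [uIcc_of_le hx] at hy hz
  rw [(h y hy.1).2, (h z hz.1).2]
  simp

theorem ae_hasDerivAt (h : IsPrimitive F f) {x : ℝ} (hx : 0 ≤ x) :
    ∀ᵐ y, y ∈ uIcc 0 x → HasDerivAt F (f y) y := by
  -- The endpoint is discarded because `F` is controlled only on `[0, ∞)`, while the derivative is
  -- two-sided.
  have h0 : ∀ᵐ y : ℝ, y ≠ 0 := by simp [ae_iff]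
  filter_upwards [(h x hx).1.ae_hasDerivAt_integral, h0] with y hy hy0 hyx
  have hyx' := hyx
  rw [uIcc_of_le hx] at hyx
  have h1 := (hy hyx' 0 left_mem_uIcc).const_add (F 0)
  refine h1.congr_of_eventuallyEq ?_
  filter_upwards [Ioi_mem_nhds (lt_of_le_of_ne hyx.1 (Ne.symm hy0))] with z hz
  exact (h z (le_of_lt hz)).2

theorem of_absolutelyContinuous
    (hF : ∀ x : ℝ, 0 ≤ x → AbsolutelyContinuousOnInterval F 0 x)
    (hd : ∀ x : ℝ, 0 ≤ x → ∀ᵐ y, y ∈ uIcc 0 x → HasDerivAt F (f y) y)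
    (hf : ∀ x : ℝ, 0 ≤ x → IntervalIntegrable f volume 0 x) : IsPrimitive F f := by
  intro x hx
  refine ⟨hf x hx, ?_⟩
  rw [(hF x hx).integral_eq_sub_of_ae_hasDerivAt (hd x hx) (hf x hx)]
  ring

theorem continuousOn (h : IsPrimitive F f) : ContinuousOn F (Ici 0) := by
  intro x hx
  have hx1 : (0 : ℝ) ≤ x + 1 := by linarith [show (0 : ℝ) ≤ x from hx]
  have h1 := (h.absolutelyContinuous hx1).continuousOn
  rw [uIcc_of_le hx1] at h1
  refine (h1 x ⟨hx, by linarith⟩).mono_of_mem_nhdsWithin ?_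
  rw [← Ici_inter_Iic]
  exact inter_mem_nhdsWithin _ (Iic_mem_nhds (by linarith))

theorem continuousOn_uIcc (h : IsPrimitive F f) {x : ℝ} (hx : 0 ≤ x) :
    ContinuousOn F (uIcc 0 x) := by
  rw [uIcc_of_le hx]
  exact h.continuousOn.mono Icc_subset_Ici_self

/-- The product rule for locally absolutely continuous functions; every Wronskian identity below
rests on it, since `y'` is differentiable only almost everywhere. -/
theorem mul (h : IsPrimitive F f) (h' : IsPrimitive G g) :
    IsPrimitive (fun x => F x * G x) (fun x => f x * G x + F x * g x) := by
  refine of_absolutelyContinuous (fun x hx => ?_) (fun x hx => ?_) (fun x hx => ?_)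
  · exact (h.absolutelyContinuous hx).smul (h'.absolutelyContinuous hx)
  · filter_upwards [h.ae_hasDerivAt hx, h'.ae_hasDerivAt hx] with y h1 h2 h3
    exact (h1 h3).mul (h2 h3)
  · exact ((h x hx).1.mul_continuousOn (h'.continuousOn_uIcc hx)).add
      ((h' x hx).1.continuousOn_mul (h.continuousOn_uIcc hx))

theorem add (h : IsPrimitive F f) (h' : IsPrimitive G g) :
    IsPrimitive (fun x => F x + G x) (fun x => f x + g x) := by
  intro x hx
  refine ⟨(h x hx).1.add (h' x hx).1, ?_⟩
  simp only
  rw [intervalIntegral.integral_add (h x hx).1 (h' x hx).1, (h x hx).2, (h' x hx).2]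
  ring

theorem sub (h : IsPrimitive F f) (h' : IsPrimitive G g) :
    IsPrimitive (fun x => F x - G x) (fun x => f x - g x) := by
  intro x hx
  refine ⟨(h x hx).1.sub (h' x hx).1, ?_⟩
  simp only
  rw [intervalIntegral.integral_sub (h x hx).1 (h' x hx).1, (h x hx).2, (h' x hx).2]
  ring

theorem congr_ae (h : IsPrimitive F f)
    (hfg : ∀ᵐ x ∂(volume.restrict (Ioi (0 : ℝ))), f x = g x) : IsPrimitive F g := by
  intro x hx
  have h1 : f =ᵐ[volume.restrict (uIoc 0 x)] g := by
    rw [uIoc_of_le hx]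
    exact ae_restrict_of_ae_restrict_of_subset Ioc_subset_Ioi_self hfg
  refine ⟨(h x hx).1.congr_ae h1, ?_⟩
  rw [(h x hx).2]
  congr 1
  refine intervalIntegral.integral_congr_ae ?_
  exact (ae_restrict_iff' measurableSet_uIoc).1 h1

theorem hasDerivWithinAt (h : IsPrimitive F f) (hf : ContinuousOn f (Ici 0)) {x : ℝ}
    (hx : 0 ≤ x) : HasDerivWithinAt F (f x) (Ici 0) x := by
  have hx1 : (0 : ℝ) ≤ x + 1 := by linarith
  have hmem : Icc 0 (x + 1) ∈ 𝓝[Ici 0] x := by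
    rw [← Ici_inter_Iic]
    exact inter_mem_nhdsWithin _ (Iic_mem_nhds (by linarith))
  have hxm : x ∈ Icc 0 (x + 1) := ⟨hx, by linarith⟩
  have h1 : HasDerivWithinAt (fun u => ∫ s in (0 : ℝ)..u, f s) (f x) (Icc 0 (x + 1)) x := by
    have : Fact (x ∈ Icc 0 (x + 1)) := ⟨hxm⟩
    have hc : ContinuousOn f (Icc 0 (x + 1)) := hf.mono Icc_subset_Ici_self
    refine intervalIntegral.integral_hasDerivWithinAt_right (h x hx).1 ?_ (hc x hxm)
    exact hc.stronglyMeasurableAtFilter_nhdsWithin measurableSet_Icc x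
  have h2 := (h1.mono_of_mem_nhdsWithin hmem).const_add (F 0)
  exact h2.congr (fun y hy => (h y hy).2) (h x hx).2

theorem of_hasDerivWithinAt (h : ∀ x : ℝ, 0 ≤ x → HasDerivWithinAt F (f x) (Ici 0) x)
    (hf : ContinuousOn f (Ici 0)) : IsPrimitive F f := by
  intro x hx
  have hc : ContinuousOn f (uIcc 0 x) := by
    rw [uIcc_of_le hx]; exact hf.mono Icc_subset_Ici_self
  refine ⟨hc.intervalIntegrable, ?_⟩
  have h1 := intervalIntegral.integral_eq_sub_of_hasDerivAt_of_le hx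
    (fun y hy => ((h y hy.1).continuousWithinAt).mono Icc_subset_Ici_self)
    (fun y hy => (h y hy.1.le).hasDerivAt (Ici_mem_nhds hy.1)) hc.intervalIntegrable
  rw [h1]; ring

theorem of_hasDerivAt (h : ∀ x : ℝ, HasDerivAt F (f x) x) (hf : Continuous f) :
    IsPrimitive F f :=
  of_hasDerivWithinAt (fun x _ => (h x).hasDerivWithinAt) hf.continuousOn

/-- The tail integral of an integrable function. -/
theorem integral_Ioi (hf : IntegrableOn f (Ioi 0)) :
    IsPrimitive (fun x => ∫ s in Ioi x, f s) (fun x => -f x) := by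
  intro x hx
  have h1 : IntervalIntegrable f volume 0 x := by
    rw [intervalIntegrable_iff_integrableOn_Ioc_of_le hx]
    exact hf.mono_set Ioc_subset_Ioi_self
  refine ⟨h1.neg, ?_⟩
  have h2 := intervalIntegral.integral_interval_add_Ioi hf (hf.mono_set (Ioi_subset_Ioi hx))
  simp only
  rw [intervalIntegral.integral_neg, ← h2]
  ring

theorem integral_zero (hf : ∀ x : ℝ, 0 ≤ x → IntervalIntegrable f volume 0 x) :
    IsPrimitive (fun x => ∫ s in (0 : ℝ)..x, f s) f :=
  fun x hx => ⟨hf x hx, by simp⟩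

theorem eq_zero_add (h : IsPrimitive F f)
    (hf : ∀ᵐ x ∂(volume.restrict (Ioi (0 : ℝ))), f x = 0) {x : ℝ} (hx : 0 ≤ x) : F x = F 0 := by
  have := ((h.congr_ae (g := 0) hf) x hx).2
  simpa using this

end IsPrimitive

theorem HasSecondDerivative.isPrimitive_deriv {y p q : ℝ → ℂ} (h : HasSecondDerivative y p q) :
    IsPrimitive p q :=
  fun x hx => ⟨h.integrable x hx, h.eq_integral x hx⟩

theorem HasSecondDerivative.isPrimitive {y p q : ℝ → ℂ} (h : HasSecondDerivative y p q) :
    IsPrimitive y p :=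
  .of_hasDerivWithinAt h.hasDeriv h.isPrimitive_deriv.continuousOn

theorem HasSecondDerivative.of_isPrimitive {y p q : ℝ → ℂ} (h : IsPrimitive y p)
    (h' : IsPrimitive p q) : HasSecondDerivative y p q where
  hasDeriv _ hx := h.hasDerivWithinAt h'.continuousOn hx
  integrable x hx := (h' x hx).1
  eq_integral x hx := (h' x hx).2

/-! ### Volterra equations with parameters -/

section Volterra

variable {P : Type*} [TopologicalSpace P] [FirstCountableTopology P]

/-- A linear integral equation `n = n₀ + ∫ κ(x, p, s) n(s, p) dμ(s)` whose kernel has norm at most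
`1/2` has a bounded solution, continuous in `x` and in the parameter `p`. -/
theorem exists_boundedContinuous_solution (μ : Measure ℝ) (κ : ℝ → P → ℝ → ℂ)
    (hmeas : ∀ x p, AEStronglyMeasurable (κ x p) μ)
    (hcont : ∀ᵐ s ∂μ, Continuous fun xp : ℝ × P => κ xp.1 xp.2 s)
    (b : ℝ → ℝ) (hb : Integrable b μ) (hκb : ∀ x p, ∀ᵐ s ∂μ, ‖κ x p s‖ ≤ b s)
    (hhalf : ∀ x p, ∫ s, ‖κ x p s‖ ∂μ ≤ 1 / 2) (n₀ : (ℝ × P) →ᵇ ℂ) :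
    ∃ n : (ℝ × P) →ᵇ ℂ, (∀ x p, n (x, p) = n₀ (x, p) + ∫ s, κ x p s * n (s, p) ∂μ) ∧
      ‖n‖ ≤ 2 * ‖n₀‖ := by
  have hnm : ∀ (n : (ℝ × P) →ᵇ ℂ) (p : P), AEStronglyMeasurable (fun s => n (s, p)) μ :=
    fun n p => (n.continuous.comp (by fun_prop)).aestronglyMeasurable
  have hbound : ∀ (n : (ℝ × P) →ᵇ ℂ) x p, ∀ᵐ s ∂μ, ‖κ x p s * n (s, p)‖ ≤ b s * ‖n‖ := by
    intro n x p
    filter_upwards [hκb x p] with s hs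
    rw [norm_mul]
    exact mul_le_mul hs (n.norm_coe_le_norm _) (norm_nonneg _) ((norm_nonneg _).trans hs)
  have hint : ∀ (n : (ℝ × P) →ᵇ ℂ) x p, Integrable (fun s => κ x p s * n (s, p)) μ :=
    fun n x p => (hb.mul_const ‖n‖).mono' ((hmeas x p).mul (hnm n p)) (hbound n x p)
  have hΛc : ∀ n : (ℝ × P) →ᵇ ℂ,
      Continuous fun xp : ℝ × P => ∫ s, κ xp.1 xp.2 s * n (s, xp.2) ∂μ := by
    intro n
    refine continuous_of_dominated (bound := fun s => b s * ‖n‖) ?_ ?_ (hb.mul_const _) ?_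
    · exact fun xp => (hmeas xp.1 xp.2).mul (hnm n xp.2)
    · exact fun xp => hbound n xp.1 xp.2
    · filter_upwards [hcont] with s hs
      exact hs.mul (n.continuous.comp (by fun_prop))
  have hΛb : ∀ (n : (ℝ × P) →ᵇ ℂ) (xp : ℝ × P),
      ‖∫ s, κ xp.1 xp.2 s * n (s, xp.2) ∂μ‖ ≤ 1 / 2 * ‖n‖ := by
    intro n xp
    have hi : Integrable (fun s => ‖κ xp.1 xp.2 s‖) μ :=
      hb.mono' (hmeas _ _).norm (by simpa using hκb xp.1 xp.2)
    calc ‖∫ s, κ xp.1 xp.2 s * n (s, xp.2) ∂μ‖ ≤ ∫ s, ‖κ xp.1 xp.2 s‖ * ‖n‖ ∂μ := by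
          refine norm_integral_le_of_norm_le (hi.mul_const _) (Eventually.of_forall fun s => ?_)
          rw [norm_mul]
          exact mul_le_mul_of_nonneg_left (n.norm_coe_le_norm _) (norm_nonneg _)
      _ = (∫ s, ‖κ xp.1 xp.2 s‖ ∂μ) * ‖n‖ := integral_mul_const _ _
      _ ≤ 1 / 2 * ‖n‖ := mul_le_mul_of_nonneg_right (hhalf _ _) (norm_nonneg _)
  let Λ : ((ℝ × P) →ᵇ ℂ) → ((ℝ × P) →ᵇ ℂ) := fun n =>
    BoundedContinuousFunction.ofNormedAddCommGroup _ (hΛc n) (1 / 2 * ‖n‖) (hΛb n)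
  have hΛ : ∀ n x p, Λ n (x, p) = ∫ s, κ x p s * n (s, p) ∂μ := fun _ _ _ => rfl
  -- Banach's fixed point theorem in the space of bounded continuous functions of both variables
  -- provides continuity in the parameter at no extra cost.
  have hcontr : ContractingWith (1 / 2) fun n => n₀ + Λ n := by
    refine ⟨by norm_num, LipschitzWith.of_dist_le_mul fun n n' => ?_⟩
    rw [dist_add_left, dist_eq_norm]
    have h2 : Λ n - Λ n' = Λ (n - n') := by
      ext ⟨x, p⟩
      rw [BoundedContinuousFunction.sub_apply, hΛ, hΛ, hΛ, ← integral_sub (hint _ _ _) (hint _ _ _)]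
      simp only [BoundedContinuousFunction.sub_apply, mul_sub]
    rw [h2, dist_eq_norm]
    refine (BoundedContinuousFunction.norm_le (by positivity)).2 fun xp => ?_
    rw [show ((1 / 2 : NNReal) : ℝ) = 1 / 2 by norm_num]
    exact hΛb (n - n') xp
  have hfix := hcontr.fixedPoint_isFixedPt
  set n := ContractingWith.fixedPoint (fun n => n₀ + Λ n) hcontr
  have hfix' : n₀ + Λ n = n := hfix
  refine ⟨n, fun x p => ?_, ?_⟩
  · conv_lhs => rw [← hfix']
    rw [BoundedContinuousFunction.add_apply, hΛ]
  · have h1 : ‖Λ n‖ ≤ 1 / 2 * ‖n‖ :=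
      (BoundedContinuousFunction.norm_le (by positivity)).2 fun xp => hΛb n xp
    have h2 : ‖n‖ ≤ ‖n₀‖ + ‖Λ n‖ := by
      conv_lhs => rw [← hfix']
      exact norm_add_le _ _
    linarith

end Volterra

/-- `R` is bounded on the interval, and there the exponential is Lipschitz. -/
theorem AbsolutelyContinuousOnInterval.exp {R : ℝ → ℝ} {a b : ℝ}
    (hR : AbsolutelyContinuousOnInterval R a b) :
    AbsolutelyContinuousOnInterval (fun x => Real.exp (R x)) a b := by
  obtain ⟨M, hM⟩ := hR.exists_bound
  refine hR.of_dist_le (C := Real.exp M) fun x hx y hy => ?_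
  have hmem : ∀ z ∈ uIcc a b, R z ∈ Iic M := fun z hz => (le_abs_self _).trans (hM z hz)
  have := (convex_Iic M).norm_image_sub_le_of_norm_hasDerivWithin_le (f := Real.exp)
    (f' := Real.exp) (C := Real.exp M) (fun z _ => (Real.hasDerivAt_exp z).hasDerivWithinAt)
    (fun z hz => by
      rw [Real.norm_eq_abs, Real.abs_exp]; exact Real.exp_le_exp.2 hz) (hmem y hy) (hmem x hx)
  rwa [dist_eq_norm, dist_eq_norm]

/-- The integrand is the almost everywhere derivative of `exp R`. Taking `R` as twice a primitive
produces the factor `1/2` that turns the weighted Volterra operators into contractions. -/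
theorem integral_mul_exp_eq_sub {w R : ℝ → ℝ} {a b : ℝ} (hw : IntervalIntegrable w volume a b)
    (hR : AbsolutelyContinuousOnInterval R a b)
    (hd : ∀ᵐ x, x ∈ uIcc a b → HasDerivAt R (w x) x) :
    ∫ s in a..b, w s * Real.exp (R s) = Real.exp (R b) - Real.exp (R a) := by
  refine hR.exp.integral_eq_sub_of_ae_hasDerivAt ?_ (hw.mul_continuousOn hR.exp.continuousOn)
  filter_upwards [hd] with x h1 h2
  rw [mul_comm]
  exact (h1 h2).exp

/-- Integrals of integrable functions with the exponential of their primitive as weight. -/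
theorem integral_Ioc_mul_exp_le {w : ℝ → ℝ} (hw : IntegrableOn w (Ioi 0))
    {x : ℝ} (hx : 0 ≤ x) :
    ∫ s in Ioc 0 x, w s * Real.exp (2 * ∫ r in Ioc 0 s, w r) ≤
      1 / 2 * Real.exp (2 * ∫ r in Ioc 0 x, w r) := by
  have hi : IntervalIntegrable w volume 0 x := by
    rw [intervalIntegrable_iff_integrableOn_Ioc_of_le hx]
    exact hw.mono_set Ioc_subset_Ioi_self
  have h1 := integral_mul_exp_eq_sub (R := fun y => 2 * ∫ s in (0 : ℝ)..y, w s)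
    (hi.const_mul 2) (hi.absolutelyContinuousOnInterval_primitive.const_mul 2) (by
      filter_upwards [hi.ae_hasDerivAt_integral] with y h1 h2
      exact (h1 h2 0 left_mem_uIcc).const_mul 2)
  rw [intervalIntegral.integral_of_le hx, intervalIntegral.integral_of_le hx,
    intervalIntegral.integral_same, mul_zero, Real.exp_zero] at h1
  have h2 : ∫ s in Ioc 0 x, 2 * w s * Real.exp (2 * ∫ r in (0 : ℝ)..s, w r) =
      2 * ∫ s in Ioc 0 x, w s * Real.exp (2 * ∫ r in Ioc 0 s, w r) := by
    rw [← integral_const_mul]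
    refine setIntegral_congr_fun measurableSet_Ioc fun s hs => ?_
    rw [intervalIntegral.integral_of_le hs.1.le]; ring
  rw [h2] at h1
  linarith

/-- Tail integrals of integrable functions with the exponential of their tail as weight. -/
theorem integral_Ioi_mul_exp_tail_le {w : ℝ → ℝ} (hw : IntegrableOn w (Ioi 0))
    (hw0 : ∀ s, 0 ≤ w s) {x : ℝ} (hx : 0 ≤ x) :
    IntegrableOn (fun s => w s * Real.exp (2 * ∫ r in Ioi s, w r)) (Ioi x) ∧
    ∫ s in Ioi x, w s * Real.exp (2 * ∫ r in Ioi s, w r) ≤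
      1 / 2 * Real.exp (2 * ∫ r in Ioi x, w r) := by
  have hwx : IntegrableOn w (Ioi x) := hw.mono_set (Ioi_subset_Ioi hx)
  have htail : ∀ y, x ≤ y → ∫ r in Ioi y, w r = (∫ r in Ioi x, w r) - ∫ s in x..y, w s := by
    intro y hy
    rw [← intervalIntegral.integral_interval_add_Ioi hwx (hwx.mono_set (Ioi_subset_Ioi hy))]
    ring
  -- On a finite interval the integral is explicit, and the boundary term at `y` has a favourable
  -- sign and is dropped; the bound survives the limit `y → ∞`.
  have hfin : ∀ y, x ≤ y → IntervalIntegrable w volume x y ∧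
      ∫ s in x..y, w s * Real.exp (2 * ∫ r in Ioi s, w r) ≤
        1 / 2 * Real.exp (2 * ∫ r in Ioi x, w r) := by
    intro y hy
    have hi : IntervalIntegrable w volume x y := by
      rw [intervalIntegrable_iff_integrableOn_Ioc_of_le hy]
      exact hwx.mono_set Ioc_subset_Ioi_self
    refine ⟨hi, ?_⟩
    have h1 := integral_mul_exp_eq_sub
      (R := fun y => 2 * (∫ r in Ioi x, w r) + -2 * ∫ s in x..y, w s) (hi.const_mul (-2)) (by
        refine AbsolutelyContinuousOnInterval.of_dist_le (C := 2)
          hi.absolutelyContinuousOnInterval_primitive fun a _ b _ => ?_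
        rw [dist_add_left, Real.dist_eq, Real.dist_eq, ← mul_sub, abs_mul]
        norm_num) (by
        filter_upwards [hi.ae_hasDerivAt_integral] with z h1 h2
        exact ((h1 h2 x left_mem_uIcc).const_mul (-2)).const_add _)
    have h2 : ∫ s in x..y, -2 * w s * Real.exp (2 * (∫ r in Ioi x, w r) + -2 * ∫ r in x..s, w r) =
        -2 * ∫ s in x..y, w s * Real.exp (2 * ∫ r in Ioi s, w r) := by
      rw [← intervalIntegral.integral_const_mul]
      refine intervalIntegral.integral_congr fun s hs => ?_
      rw [uIcc_of_le hy] at hs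
      rw [htail s hs.1]; ring_nf
    rw [h2] at h1
    simp only [intervalIntegral.integral_same, mul_zero, add_zero] at h1
    have := Real.exp_pos (2 * (∫ r in Ioi x, w r) + -2 * ∫ s in x..y, w s)
    linarith
  have hint : IntegrableOn (fun s => w s * Real.exp (2 * ∫ r in Ioi s, w r)) (Ioi x) := by
    refine Integrable.mono' (hwx.mul_const (Real.exp (2 * ∫ r in Ioi x, w r))) ?_ ?_
    · refine hwx.aestronglyMeasurable.mul ?_
      -- Measurability of the weight comes from monotonicity; the truncation `max s 0` keeps the
      -- tail inside the half-line where `w` is integrable.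
      have hanti : Antitone fun s => ∫ r in Ioi (max s 0), w r := fun a b hab =>
        setIntegral_mono_set (hw.mono_set (Ioi_subset_Ioi (le_max_right _ _)))
          (Eventually.of_forall hw0)
          (Ioi_subset_Ioi (max_le_max_right _ hab)).eventuallyLE
      have hm : Measurable fun s => Real.exp (2 * ∫ r in Ioi (max s 0), w r) :=
        (hanti.measurable.const_mul 2).exp
      refine hm.aestronglyMeasurable.congr ?_
      filter_upwards [ae_restrict_mem measurableSet_Ioi] with s hs
      rw [max_eq_left (hx.trans (le_of_lt hs))]
    · filter_upwards [ae_restrict_mem measurableSet_Ioi] with s hs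
      rw [norm_mul, Real.norm_of_nonneg (hw0 s), Real.norm_of_nonneg (Real.exp_pos _).le]
      refine mul_le_mul_of_nonneg_left (Real.exp_le_exp.2 ?_) (hw0 s)
      refine mul_le_mul_of_nonneg_left ?_ zero_le_two
      exact setIntegral_mono_set hwx (Eventually.of_forall hw0)
          (Ioi_subset_Ioi (le_of_lt hs)).eventuallyLE
  refine ⟨hint, ?_⟩
  refine le_of_tendsto (intervalIntegral_tendsto_integral_Ioi x hint tendsto_id) ?_
  filter_upwards [eventually_ge_atTop x] with y hy
  exact (hfin y hy).2

/-! ### The Jost solution and the regular solution -/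

/-- The closed upper half plane of spectral parameters `k`. -/
abbrev UpperHalf : Type := {k : ℂ // 0 ≤ k.im}

/-- The kernel `(e^{2ikt} - 1) / (2ik)` of the Volterra equations, also for `k = 0`. -/
noncomputable def phaseIntegral (k : ℂ) (t : ℝ) : ℂ :=
  ∫ u in (0 : ℝ)..t, Complex.exp (2 * Complex.I * k * u)

section PhaseIntegral

variable {k : ℂ}

theorem continuous_phaseIntegral :
    Continuous fun kt : ℂ × ℝ => phaseIntegral kt.1 kt.2 :=
  intervalIntegral.continuous_parametric_intervalIntegral_of_continuous (a₀ := 0)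
    (f := fun (kt : ℂ × ℝ) (u : ℝ) => Complex.exp (2 * Complex.I * kt.1 * u)) (by fun_prop)
    continuous_snd

theorem norm_exp_two_I_mul (k : ℂ) (t : ℝ) :
    ‖Complex.exp (2 * Complex.I * k * t)‖ = Real.exp (-2 * k.im * t) := by
  rw [Complex.norm_exp]; simp

theorem norm_exp_I_mul (k : ℂ) (t : ℝ) :
    ‖Complex.exp (Complex.I * k * t)‖ = Real.exp (-k.im * t) := by
  rw [Complex.norm_exp]; simp

theorem norm_exp_two_I_mul_le (hk : 0 ≤ k.im) {t : ℝ} (ht : 0 ≤ t) :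
    ‖Complex.exp (2 * Complex.I * k * t)‖ ≤ 1 := by
  rw [norm_exp_two_I_mul, Real.exp_le_one_iff]
  nlinarith [mul_nonneg hk ht]

/-- The bound is uniform up to and including `k = 0`. Its linear growth in `t` is what the first
moment of `V` has to absorb. -/
theorem norm_phaseIntegral_le (hk : 0 ≤ k.im) {t : ℝ} (ht : 0 ≤ t) : ‖phaseIntegral k t‖ ≤ t := by
  have := intervalIntegral.norm_integral_le_of_norm_le_const (a := 0) (b := t) (C := 1)
    (f := fun u : ℝ => Complex.exp (2 * Complex.I * k * u)) (fun u hu => by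
      rw [uIoc_of_le ht] at hu
      exact norm_exp_two_I_mul_le hk hu.1.le)
  rwa [sub_zero, one_mul, abs_of_nonneg ht] at this

theorem hasDerivAt_phaseIntegral (k : ℂ) (t : ℝ) :
    HasDerivAt (phaseIntegral k) (Complex.exp (2 * Complex.I * k * t)) t :=
  (Continuous.integral_hasStrictDerivAt (f := fun u : ℝ => Complex.exp (2 * Complex.I * k * u))
    (by fun_prop) 0 t).hasDerivAt

theorem phaseIntegral_zero_right (k : ℂ) : phaseIntegral k 0 = 0 :=
  intervalIntegral.integral_same

theorem phaseIntegral_mul (k : ℂ) (t : ℝ) :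
    2 * Complex.I * k * phaseIntegral k t = Complex.exp (2 * Complex.I * k * t) - 1 := by
  have h : ∀ u : ℝ, HasDerivAt (fun u : ℝ => Complex.exp (2 * Complex.I * k * u))
      (2 * Complex.I * k * Complex.exp (2 * Complex.I * k * u)) u := by
    intro u
    have h1 := ((hasDerivAt_id (u : ℂ)).const_mul (2 * Complex.I * k)).cexp.comp_ofReal
    simpa [mul_comm] using h1
  have := intervalIntegral.integral_eq_sub_of_hasDerivAt (a := 0) (b := t) (fun u _ => h u)
    (Continuous.intervalIntegrable (by fun_prop) _ _)
  rw [intervalIntegral.integral_const_mul] at this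
  simpa [phaseIntegral] using this

/-- For large `k` the oscillation or decay of the exponential replaces linear growth by `1/|k|`;
this drives the Jost function to `1` at infinity. -/
theorem norm_phaseIntegral_le_inv (hk : 0 ≤ k.im) (hk0 : k ≠ 0) {t : ℝ} (ht : 0 ≤ t) :
    ‖phaseIntegral k t‖ ≤ ‖k‖⁻¹ := by
  have h1 := phaseIntegral_mul k t
  have h2 : ‖2 * Complex.I * k * phaseIntegral k t‖ ≤ 2 := by
    rw [h1]
    refine (norm_sub_le _ _).trans ?_
    rw [norm_one]
    linarith [norm_exp_two_I_mul_le hk ht]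
  have hk' : 0 < ‖k‖ := norm_pos_iff.2 hk0
  rw [norm_mul, norm_mul, norm_mul, Complex.norm_I, Complex.norm_ofNat] at h2
  rw [← one_div, le_div_iff₀ hk']
  linarith

theorem phaseIntegral_add (k : ℂ) (x t : ℝ) : phaseIntegral k (x + t) =
    phaseIntegral k x + Complex.exp (2 * Complex.I * k * x) * phaseIntegral k t := by
  have hc : Continuous fun u : ℝ => Complex.exp (2 * Complex.I * k * u) := by fun_prop
  unfold phaseIntegral
  rw [← intervalIntegral.integral_add_adjacent_intervals (hc.intervalIntegrable 0 x)
    (hc.intervalIntegrable x (x + t))]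
  congr 1
  rw [← intervalIntegral.integral_const_mul]
  have := intervalIntegral.integral_comp_add_left (a := 0) (b := t)
    (fun u : ℝ => Complex.exp (2 * Complex.I * k * u)) x
  rw [add_zero] at this
  rw [← this]
  refine intervalIntegral.integral_congr fun u _ => ?_
  rw [← Complex.exp_add]
  push_cast; ring_nf

/-- Separates the variables of the Volterra kernel, so that solutions of the integral equations
become combinations of fixed primitives and can be differentiated by the product rule. -/
theorem phaseIntegral_sub (k : ℂ) (s x : ℝ) : phaseIntegral k (s - x) =
    Complex.exp (-(2 * Complex.I * k * x)) * (phaseIntegral k s - phaseIntegral k x) := by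
  have h := phaseIntegral_add k x (s - x)
  rw [add_sub_cancel] at h
  rw [h, add_sub_cancel_left, ← mul_assoc, ← Complex.exp_add, neg_add_cancel, Complex.exp_zero,
    one_mul]

end PhaseIntegral

/-! ### Amplitudes from Volterra equations -/

section Potential

variable {V : ℝ → ℂ}

theorem continuous_exp_integral_Ioi {w : ℝ → ℝ} (hw : Integrable w) :
    Continuous fun x => Real.exp (2 * ∫ r in Ioi x, w r) := by
  have h : ∀ x, ∫ r in Ioi x, w r = (∫ r in Ioi 0, w r) - ∫ r in (0 : ℝ)..x, w r := by
    intro x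
    rw [← intervalIntegral.integral_interval_add_Ioi' (a := 0) (b := x) hw.intervalIntegrable
      hw.integrableOn]
    ring
  rw [funext fun x => congrArg (fun y => Real.exp (2 * y)) (h x)]
  have := intervalIntegral.continuous_primitive (fun a b => hw.intervalIntegrable) 0 (f := w)
    (μ := volume)
  fun_prop

/-- The solution of the Volterra equation of the Jost solution. -/
theorem exists_jost_amplitude (hV : IntegrableOn V (Ioi 0))
    (hVx : IntegrableOn (fun x : ℝ => x * ‖V x‖) (Ioi 0)) :
    ∃ (m : ℝ → UpperHalf → ℂ) (C : ℝ), (Continuous fun xk : ℝ × UpperHalf => m xk.1 xk.2) ∧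
      (∀ x k, ‖m x k‖ ≤ C) ∧
      ∀ x, 0 ≤ x → ∀ k : UpperHalf,
        m x k = 1 + ∫ s in Ioi x, phaseIntegral k (s - x) * V s * m s k := by
  set w : ℝ → ℝ := (Ioi 0).indicator fun x => x * ‖V x‖ with hw_def
  have hw : Integrable w := hVx.integrable_indicator measurableSet_Ioi
  have hw0 : ∀ s, 0 ≤ w s := fun s => indicator_nonneg (fun x hx =>
    mul_nonneg (le_of_lt hx) (norm_nonneg _)) s
  have hws : ∀ s, 0 < s → w s = s * ‖V s‖ := fun s hs => indicator_of_mem (mem_Ioi.2 hs) _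
  -- The unknown is divided by this weight, which replaces the usual iteration of the Volterra
  -- operator by a single contraction with constant `1/2`, whatever the size of the first moment of
  -- `V`.
  set W : ℝ → ℝ := fun x => Real.exp (2 * ∫ r in Ioi x, w r) with hW_def
  have hWc : Continuous W := continuous_exp_integral_Ioi hw
  have hWpos : ∀ x, 0 < W x := fun x => Real.exp_pos _
  have hWanti : Antitone W := fun a b hab => Real.exp_le_exp.2 (mul_le_mul_of_nonneg_left
    (setIntegral_mono_set hw.integrableOn (Eventually.of_forall hw0)
      (Ioi_subset_Ioi hab).eventuallyLE) zero_le_two)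
  have hW1 : ∀ x, 1 ≤ W x := fun x => Real.one_le_exp
    (mul_nonneg zero_le_two (setIntegral_nonneg measurableSet_Ioi fun s _ => hw0 s))
  have htail : ∀ x, 0 ≤ x → IntegrableOn (fun s => w s * W s) (Ioi x) ∧
      ∫ s in Ioi x, w s * W s ≤ 1 / 2 * W x := fun x hx =>
    integral_Ioi_mul_exp_tail_le hw.integrableOn hw0 hx
  clear_value W w
  have hWinv : Continuous fun xk : ℝ × UpperHalf => (W (max xk.1 0) : ℂ)⁻¹ := by
    refine Continuous.inv₀ ?_ fun _ => Complex.ofReal_ne_zero.2 (hWpos _).ne'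
    exact Complex.continuous_ofReal.comp (hWc.comp (by fun_prop))
  -- The kernel conjugated by `W`. The outer maximum makes it vanish for `s ≤ x`, and `max x 0`
  -- extends the equation to all real `x`.
  let κ : ℝ → UpperHalf → ℝ → ℂ := fun x k s =>
    (W (max x 0) : ℂ)⁻¹ * phaseIntegral k (max (s - max x 0) 0) * V s * W s
  have hκn : ∀ x k s, 0 < s → ‖κ x k s‖ ≤
      (Ioi (max x 0)).indicator (fun s => (W (max x 0))⁻¹ * (w s * W s)) s := by
    intro x k s hs
    by_cases hsx : s ∈ Ioi (max x 0)
    · rw [indicator_of_mem hsx, hws s hs]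
      have h1 : ‖phaseIntegral k (max (s - max x 0) 0)‖ ≤ s :=
        (norm_phaseIntegral_le k.2 (le_max_right _ _)).trans
          (max_le (by linarith [le_max_right x 0]) hs.le)
      simp only [κ, norm_mul, norm_inv, Complex.norm_real, Real.norm_eq_abs, abs_of_pos (hWpos _)]
      have := mul_le_mul_of_nonneg_right h1
        (mul_nonneg (mul_nonneg (norm_nonneg (V s)) (hWpos s).le)
          (inv_nonneg.2 (hWpos (max x 0)).le))
      linarith
    · rw [indicator_of_notMem hsx]
      have : max (s - max x 0) 0 = 0 := max_eq_right (sub_nonpos.2 (not_lt.1 hsx))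
      simp only [κ, this, phaseIntegral_zero_right]
      simp
  have hκb : ∀ x k s, 0 < s → ‖κ x k s‖ ≤ w s := by
    intro x k s hs
    refine (hκn x k s hs).trans (indicator_le' (fun r hr => ?_) (fun r _ => hw0 r) s)
    rw [← mul_assoc, mul_comm _ (w r), mul_assoc]
    refine mul_le_of_le_one_right (hw0 r) ?_
    rw [inv_mul_le_one₀ (hWpos _)]
    exact hWanti (le_of_lt hr)
  have hphase : Continuous fun z : ℂ × ℝ => phaseIntegral z.1 z.2 := continuous_phaseIntegral
  obtain ⟨n, hn, hnorm⟩ := exists_boundedContinuous_solution (volume.restrict (Ioi (0 : ℝ))) κ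
    (fun x k => by
      refine ((AEStronglyMeasurable.mul ?_ hV.aestronglyMeasurable).mul ?_)
      · have h1 : Continuous fun s : ℝ => phaseIntegral k (max (s - max x 0) 0) :=
          hphase.comp (continuous_const.prodMk (by fun_prop))
        exact (continuous_const.mul h1).aestronglyMeasurable
      · exact (Complex.continuous_ofReal.comp hWc).aestronglyMeasurable)
    (Eventually.of_forall fun s => by
      have h1 : Continuous fun xk : ℝ × UpperHalf =>
          phaseIntegral xk.2 (max (s - max xk.1 0) 0) :=
        hphase.comp ((continuous_subtype_val.comp continuous_snd).prodMk (by fun_prop))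
      exact ((hWinv.mul h1).mul continuous_const).mul continuous_const)
    w hw.integrableOn
    (fun x k => by
      filter_upwards [ae_restrict_mem measurableSet_Ioi] with s hs using hκb x k s hs)
    (fun x k => by
      obtain ⟨h1, h2⟩ := htail _ (le_max_right x 0)
      calc ∫ s in Ioi 0, ‖κ x k s‖ ≤ ∫ s in Ioi 0,
            (Ioi (max x 0)).indicator (fun s => (W (max x 0))⁻¹ * (w s * W s)) s := by
            refine integral_mono_of_nonneg (Eventually.of_forall fun s => norm_nonneg _)
              ((integrable_indicator_iff measurableSet_Ioi).2
                (Integrable.const_mul h1 _)).integrableOn ?_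
            filter_upwards [ae_restrict_mem measurableSet_Ioi] with s hs using hκn x k s hs
        _ = (W (max x 0))⁻¹ * ∫ s in Ioi (max x 0), w s * W s := by
            rw [setIntegral_indicator measurableSet_Ioi, inter_eq_right.2
              (Ioi_subset_Ioi (le_max_right _ _)), integral_const_mul]
        _ ≤ (W (max x 0))⁻¹ * (1 / 2 * W (max x 0)) :=
            mul_le_mul_of_nonneg_left h2 (inv_nonneg.2 (hWpos _).le)
        _ = 1 / 2 := by field_simp [(hWpos (max x 0)).ne'])
    (BoundedContinuousFunction.ofNormedAddCommGroup (fun xk => (W (max xk.1 0) : ℂ)⁻¹)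
      hWinv 1
      (fun xk => by
        rw [norm_inv, Complex.norm_real, Real.norm_eq_abs, abs_of_pos (hWpos _)]
        exact inv_le_one_of_one_le₀ (hW1 _)))
  refine ⟨fun x k => W (max x 0) * n (x, k), W 0 * ‖n‖, ?_, ?_, ?_⟩
  · exact (Complex.continuous_ofReal.comp (hWc.comp (by fun_prop))).mul
      (n.continuous.comp (by fun_prop))
  · intro x k
    rw [norm_mul, Complex.norm_real, Real.norm_eq_abs, abs_of_pos (hWpos _)]
    exact mul_le_mul (hWanti (le_max_right _ _)) (n.norm_coe_le_norm _) (norm_nonneg _)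
      (hWpos _).le
  · intro x hx k
    have hWx : (W x : ℂ) ≠ 0 := Complex.ofReal_ne_zero.2 (hWpos _).ne'
    simp only
    rw [hn x k, mul_add, ← integral_const_mul, max_eq_left hx]
    congr 1
    · simp [max_eq_left hx, hWx]
    · rw [← integral_indicator measurableSet_Ioi, ← integral_indicator measurableSet_Ioi]
      congr 1
      ext s
      by_cases hs : s ∈ Ioi x
      · have hs0 : s ∈ Ioi (0 : ℝ) := hx.trans_lt hs
        rw [indicator_of_mem hs, indicator_of_mem hs0]
        simp only [κ, max_eq_left hx, max_eq_left (sub_nonneg.2 (le_of_lt (mem_Ioi.1 hs))),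
          max_eq_left (le_of_lt (mem_Ioi.1 hs0))]
        field_simp
      · rw [indicator_of_notMem hs]
        by_cases hs0 : s ∈ Ioi (0 : ℝ)
        · rw [indicator_of_mem hs0]
          have : max (s - x) 0 = 0 := max_eq_right (sub_nonpos.2 (not_lt.1 hs))
          simp [κ, max_eq_left hx, this, phaseIntegral_zero_right]
        · rw [indicator_of_notMem hs0]

/-- The mean value of `e^{2iku}` over `0 ≤ u ≤ t`. -/
noncomputable def phaseMean (k : ℂ) (t : ℝ) : ℂ :=
  ∫ u in (0 : ℝ)..1, Complex.exp (2 * Complex.I * k * t * u)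

theorem continuous_phaseMean : Continuous fun kt : ℂ × ℝ => phaseMean kt.1 kt.2 :=
  intervalIntegral.continuous_parametric_intervalIntegral_of_continuous (a₀ := 0)
    (f := fun (kt : ℂ × ℝ) (u : ℝ) => Complex.exp (2 * Complex.I * kt.1 * kt.2 * u)) (by fun_prop)
    continuous_const

theorem phaseIntegral_eq_mul (k : ℂ) (t : ℝ) : phaseIntegral k t = t * phaseMean k t := by
  have h := intervalIntegral.smul_integral_comp_mul_left (a := 0) (b := 1)
    (fun u : ℝ => Complex.exp (2 * Complex.I * k * u)) t
  rw [mul_zero, mul_one] at h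
  rw [phaseIntegral, ← h, Complex.real_smul]
  congr 1
  refine intervalIntegral.integral_congr fun u _ => ?_
  push_cast; ring_nf

theorem norm_phaseMean_le {k : ℂ} (hk : 0 ≤ k.im) {t : ℝ} (ht : 0 ≤ t) : ‖phaseMean k t‖ ≤ 1 := by
  have := intervalIntegral.norm_integral_le_of_norm_le_const (a := 0) (b := 1) (C := 1)
    (f := fun u : ℝ => Complex.exp (2 * Complex.I * k * t * u))
    (fun u hu => by
      rw [uIoc_of_le zero_le_one] at hu
      have := norm_exp_two_I_mul_le hk (mul_nonneg ht hu.1.le)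
      rwa [Complex.ofReal_mul, ← mul_assoc] at this)
  simpa [phaseMean] using this

set_option maxHeartbeats 800000 in
/-- The solution of the Volterra equation of the regular solution. -/
theorem exists_regular_amplitude (hV : IntegrableOn V (Ioi 0))
    (hVx : IntegrableOn (fun x : ℝ => x * ‖V x‖) (Ioi 0)) :
    ∃ (ψ : ℝ → UpperHalf → ℂ) (C : ℝ), (∀ k, Continuous fun x => ψ x k) ∧
      (∀ x k, 0 ≤ x → ‖ψ x k‖ ≤ C * x) ∧
      ∀ x, 0 ≤ x → ∀ k : UpperHalf, ψ x k = phaseIntegral k x +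
        ∫ s in (0 : ℝ)..x, phaseIntegral k (x - s) * V s * ψ s k := by
  set w : ℝ → ℝ := (Ioi 0).indicator fun x => x * ‖V x‖ with hw_def
  have hw : Integrable w := hVx.integrable_indicator measurableSet_Ioi
  have hw0 : ∀ s, 0 ≤ w s := fun s => indicator_nonneg (fun x hx =>
    mul_nonneg (le_of_lt hx) (norm_nonneg _)) s
  have hws : ∀ s, 0 < s → w s = s * ‖V s‖ := fun s hs => indicator_of_mem (mem_Ioi.2 hs) _
  -- The weight now grows with `x`, because this equation is integrated from `0` instead of from
  -- infinity.
  set W : ℝ → ℝ := fun x => Real.exp (2 * ∫ r in Ioc 0 x, w r) with hW_def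
  have hWpos : ∀ x, 0 < W x := fun x => Real.exp_pos _
  have hWmono : Monotone W := fun a b hab => Real.exp_le_exp.2 (mul_le_mul_of_nonneg_left
    (setIntegral_mono_set hw.integrableOn (Eventually.of_forall hw0)
      (Ioc_subset_Ioc_right hab).eventuallyLE) zero_le_two)
  have hWc : Continuous W := by
    have h1 : W = fun x => Real.exp (2 * ∫ r in (0 : ℝ)..(max x 0), w r) := by
      ext x
      simp only [hW_def]
      rw [intervalIntegral.integral_of_le (le_max_right _ _)]
      rcases le_total 0 x with hx | hx
      · rw [max_eq_left hx]
      · rw [max_eq_right hx, Ioc_eq_empty (not_lt.2 hx), Ioc_self]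
    rw [h1]
    have := (intervalIntegral.continuous_primitive (fun a b => hw.intervalIntegrable) 0 (f := w)
      (μ := volume)).comp (show Continuous fun x : ℝ => max x 0 by fun_prop)
    exact Real.continuous_exp.comp (continuous_const.mul this)
  have hW1 : ∀ x, 1 ≤ W x := fun x => Real.one_le_exp
    (mul_nonneg zero_le_two (setIntegral_nonneg measurableSet_Ioc fun s _ => hw0 s))
  have hWle : ∀ x, W x ≤ Real.exp (2 * ∫ r, w r) := fun x => Real.exp_le_exp.2
    (mul_le_mul_of_nonneg_left (setIntegral_le_integral hw (Eventually.of_forall hw0)) zero_le_two)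
  have htail : ∀ x, 0 ≤ x → IntegrableOn (fun s => w s * W s) (Ioc 0 x) ∧
      ∫ s in Ioc 0 x, w s * W s ≤ 1 / 2 * W x := fun x hx =>
    ⟨by
      have : IntegrableOn (fun s => w s * W s) (Icc 0 x) :=
        hw.integrableOn.mul_continuousOn hWc.continuousOn isCompact_Icc
      exact this.mono_set Ioc_subset_Icc_self, integral_Ioc_mul_exp_le hw.integrableOn hx⟩
  clear_value W w
  have hWinv : Continuous fun xk : ℝ × UpperHalf => (W xk.1 : ℂ)⁻¹ := by
    refine Continuous.inv₀ ?_ fun _ => Complex.ofReal_ne_zero.2 (hWpos _).ne'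
    exact Complex.continuous_ofReal.comp (hWc.comp (by fun_prop))
  -- The unknown is divided by `x W(x)`, which builds the vanishing at `0` into the estimate.
  -- Writing `max x s` for `x` in the denominator changes nothing where the phase factor is nonzero
  -- and keeps the kernel continuous in `x` for `s > 0`.
  let κ : ℝ → UpperHalf → ℝ → ℂ := fun x k s =>
    (W x : ℂ)⁻¹ * ((max x s : ℝ) : ℂ)⁻¹ * phaseIntegral k (max (x - s) 0) * V s * (s * W s)
  have hκn : ∀ x k s, 0 < s → ‖κ x k s‖ ≤
      (Ioc 0 x).indicator (fun s => (W x)⁻¹ * (w s * W s)) s := by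
    intro x k s hs
    by_cases hsx : s ≤ x
    · rw [indicator_of_mem (mem_Ioc.2 ⟨hs, hsx⟩), hws s hs]
      have hx : 0 < x := hs.trans_le hsx
      have h1 : ‖phaseIntegral k (max (x - s) 0)‖ ≤ x :=
        (norm_phaseIntegral_le k.2 (le_max_right _ _)).trans
          (max_le (by linarith) hx.le)
      have h2 : x⁻¹ * ‖phaseIntegral k (max (x - s) 0)‖ ≤ 1 := by
        rwa [inv_mul_le_one₀ hx]
      simp only [κ, norm_mul, norm_inv, Complex.norm_real, Real.norm_eq_abs, abs_of_pos (hWpos _),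
        max_eq_left hsx, abs_of_pos hx, abs_of_pos hs]
      have := mul_le_mul_of_nonneg_right h2
        (mul_nonneg (mul_nonneg (mul_nonneg (norm_nonneg (V s)) hs.le) (hWpos s).le)
          (inv_nonneg.2 (hWpos x).le))
      linarith
    · rw [indicator_of_notMem (fun h => hsx h.2)]
      have : max (x - s) 0 = 0 := max_eq_right (by linarith)
      simp only [κ, this, phaseIntegral_zero_right]
      simp
  have hκb : ∀ x k s, 0 < s → ‖κ x k s‖ ≤ w s := by
    intro x k s hs
    refine (hκn x k s hs).trans (indicator_le' (fun r hr => ?_) (fun r _ => hw0 r) s)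
    rw [← mul_assoc, mul_comm _ (w r), mul_assoc]
    refine mul_le_of_le_one_right (hw0 r) ?_
    rw [inv_mul_le_one₀ (hWpos _)]
    exact hWmono hr.2
  have hphase : Continuous fun z : ℂ × ℝ => phaseIntegral z.1 z.2 := continuous_phaseIntegral
  -- The inhomogeneity divided by `x` is expressed through `phaseMean`, which stays continuous at `x
  -- = 0`.
  obtain ⟨n₀, hn₀, hn₀b⟩ : ∃ n₀ : (ℝ × UpperHalf) →ᵇ ℂ,
      (∀ x k, n₀ (x, k) = (W x : ℂ)⁻¹ * phaseMean k (max x 0)) ∧ ‖n₀‖ ≤ 1 := by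
    have hc : Continuous fun xk : ℝ × UpperHalf =>
        (W xk.1 : ℂ)⁻¹ * phaseMean xk.2 (max xk.1 0) := by
      have h1 : Continuous fun xk : ℝ × UpperHalf => ((xk.2 : ℂ), max xk.1 0) :=
        (continuous_subtype_val.comp continuous_snd).prodMk (by fun_prop)
      exact hWinv.mul (continuous_phaseMean.comp h1)
    have hb : ∀ xk : ℝ × UpperHalf, ‖(W xk.1 : ℂ)⁻¹ * phaseMean xk.2 (max xk.1 0)‖ ≤ 1 := by
      intro xk
      rw [norm_mul, norm_inv, Complex.norm_real, Real.norm_eq_abs, abs_of_pos (hWpos _)]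
      exact mul_le_one₀ (inv_le_one_of_one_le₀ (hW1 _)) (norm_nonneg _)
        (norm_phaseMean_le xk.2.2 (le_max_right _ _))
    exact ⟨BoundedContinuousFunction.ofNormedAddCommGroup _ hc 1 hb, fun x k => rfl,
      BoundedContinuousFunction.norm_ofNormedAddCommGroup_le hc zero_le_one hb⟩
  obtain ⟨n, hn, hnorm⟩ := exists_boundedContinuous_solution (volume.restrict (Ioi (0 : ℝ))) κ
    (fun x k => by
      refine ((AEStronglyMeasurable.mul ?_ hV.aestronglyMeasurable).mul ?_)
      · have h1 : Continuous fun s : ℝ => phaseIntegral k (max (x - s) 0) :=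
          hphase.comp (continuous_const.prodMk (by fun_prop))
        refine AEStronglyMeasurable.mul (AEStronglyMeasurable.const_mul ?_ _)
          h1.aestronglyMeasurable
        have : Measurable fun s : ℝ => (((max x s : ℝ) : ℂ))⁻¹ := by fun_prop
        exact this.aestronglyMeasurable
      · have : Continuous fun s : ℝ => (s : ℂ) * W s := by fun_prop
        exact this.aestronglyMeasurable)
    (by
      filter_upwards [ae_restrict_mem measurableSet_Ioi] with s hs
      have h1 : Continuous fun xk : ℝ × UpperHalf =>
          phaseIntegral xk.2 (max (xk.1 - s) 0) :=
        hphase.comp ((continuous_subtype_val.comp continuous_snd).prodMk (by fun_prop))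
      have h2 : Continuous fun xk : ℝ × UpperHalf => (((max xk.1 s : ℝ) : ℂ))⁻¹ := by
        refine Continuous.inv₀ (by fun_prop) fun xk => Complex.ofReal_ne_zero.2 ?_
        exact (lt_max_of_lt_right hs).ne'
      exact (((hWinv.mul h2).mul h1).mul continuous_const).mul continuous_const)
    w hw.integrableOn
    (fun x k => by
      filter_upwards [ae_restrict_mem measurableSet_Ioi] with s hs using hκb x k s hs)
    (fun x k => by
      rcases le_total x 0 with hx | hx
      · refine (le_of_eq ?_).trans (show (0 : ℝ) ≤ 1 / 2 by norm_num)
        rw [setIntegral_congr_fun (g := fun _ => 0) measurableSet_Ioi fun s hs => ?_]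
        · simp
        · have := hκn x k s hs
          rw [indicator_of_notMem (fun h => (h.1.trans_le h.2).not_ge hx)] at this
          exact le_antisymm this (norm_nonneg _)
      obtain ⟨h1, h2⟩ := htail x hx
      calc ∫ s in Ioi 0, ‖κ x k s‖ ≤ ∫ s in Ioi 0,
            (Ioc 0 x).indicator (fun s => (W x)⁻¹ * (w s * W s)) s := by
            refine integral_mono_of_nonneg (Eventually.of_forall fun s => norm_nonneg _)
              ((integrable_indicator_iff measurableSet_Ioc).2
                (Integrable.const_mul h1 _)).integrableOn ?_
            filter_upwards [ae_restrict_mem measurableSet_Ioi] with s hs using hκn x k s hs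
        _ = (W x)⁻¹ * ∫ s in Ioc 0 x, w s * W s := by
            rw [setIntegral_indicator measurableSet_Ioc, inter_eq_right.2
              Ioc_subset_Ioi_self, integral_const_mul]
        _ ≤ (W x)⁻¹ * (1 / 2 * W x) :=
            mul_le_mul_of_nonneg_left h2 (inv_nonneg.2 (hWpos _).le)
        _ = 1 / 2 := by field_simp [(hWpos x).ne'])
    n₀
  have hnorm2 : ∀ z, ‖n z‖ ≤ 2 := fun z => (n.norm_coe_le_norm z).trans (by linarith)
  refine ⟨fun x k => x * W x * n (x, k), 2 * Real.exp (2 * ∫ r, w r), ?_, ?_, ?_⟩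
  · intro k
    have : Continuous fun x : ℝ => n (x, k) := n.continuous.comp (by fun_prop)
    fun_prop
  · intro x k hx
    rw [norm_mul, norm_mul, Complex.norm_real, Complex.norm_real, Real.norm_eq_abs,
      Real.norm_eq_abs, abs_of_pos (hWpos _), abs_of_nonneg hx]
    calc x * W x * ‖n (x, k)‖ ≤ x * Real.exp (2 * ∫ r, w r) * 2 :=
          mul_le_mul (mul_le_mul_of_nonneg_left (hWle x) hx) (hnorm2 _) (norm_nonneg _)
            (by positivity)
      _ = _ := by ring
  · intro x hx k
    rcases hx.eq_or_lt with rfl | hx0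
    · simp [phaseIntegral_zero_right]
    have hWx : (W x : ℂ) ≠ 0 := Complex.ofReal_ne_zero.2 (hWpos _).ne'
    have hxc : (x : ℂ) ≠ 0 := Complex.ofReal_ne_zero.2 hx0.ne'
    beta_reduce
    rw [hn x k, mul_add, ← integral_const_mul, intervalIntegral.integral_of_le hx]
    congr 1
    · rw [phaseIntegral_eq_mul]
      rw [hn₀, max_eq_left hx]
      field_simp
    · rw [← integral_indicator measurableSet_Ioi, ← integral_indicator measurableSet_Ioc]
      congr 1
      ext s
      by_cases hs0 : s ∈ Ioi (0 : ℝ)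
      · rw [indicator_of_mem hs0]
        by_cases hs : s ≤ x
        · rw [indicator_of_mem (mem_Ioc.2 ⟨hs0, hs⟩)]
          simp only [κ, max_eq_left hs, max_eq_left (sub_nonneg.2 hs)]
          field_simp
        · rw [indicator_of_notMem fun h => hs h.2]
          have : max (x - s) 0 = 0 := max_eq_right (by linarith)
          simp [κ, this, phaseIntegral_zero_right]
      · rw [indicator_of_notMem hs0, indicator_of_notMem fun h => hs0 h.1]

end Potential

/-! ### From amplitudes to solutions of the differential equation -/

theorem IsPrimitive.congr {F G f g : ℝ → ℂ} (h : IsPrimitive F f) (hFG : ∀ x, 0 ≤ x → F x = G x)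
    (hfg : ∀ᵐ x ∂(volume.restrict (Ioi (0 : ℝ))), f x = g x) : IsPrimitive G g := by
  intro x hx
  have := h.congr_ae hfg x hx
  rwa [hFG x hx, hFG 0 le_rfl] at this

theorem IsPrimitive.const_mul {F f : ℝ → ℂ} (h : IsPrimitive F f) (c : ℂ) :
    IsPrimitive (fun x => c * F x) (fun x => c * f x) := by
  intro x hx
  refine ⟨(h x hx).1.const_mul c, ?_⟩
  beta_reduce
  rw [intervalIntegral.integral_const_mul, (h x hx).2, mul_add]

theorem isPrimitive_exp (c : ℂ) :
    IsPrimitive (fun x : ℝ => Complex.exp (c * x)) (fun x => c * Complex.exp (c * x)) := by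
  refine .of_hasDerivAt (fun x => ?_) (by fun_prop)
  simpa [mul_comm] using ((hasDerivAt_id (x : ℂ)).const_mul c).cexp.comp_ofReal

theorem isPrimitive_phaseIntegral (k : ℂ) :
    IsPrimitive (phaseIntegral k) (fun x => Complex.exp (2 * Complex.I * k * x)) :=
  .of_hasDerivAt (hasDerivAt_phaseIntegral k) (by fun_prop)

theorem tendsto_integral_Ioi_atTop {f : ℝ → ℝ} (hf : IntegrableOn f (Ioi 0)) :
    Tendsto (fun x => ∫ s in Ioi x, f s) atTop (𝓝 0) := by
  have h := (intervalIntegral_tendsto_integral_Ioi 0 hf tendsto_id).const_sub (∫ s in Ioi 0, f s)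
  rw [sub_self] at h
  refine h.congr' ?_
  filter_upwards [eventually_ge_atTop (0 : ℝ)] with x hx
  rw [← intervalIntegral.integral_interval_add_Ioi hf (hf.mono_set (Ioi_subset_Ioi hx))]
  simp

section Potential

variable {V : ℝ → ℂ} {k : ℂ} {m ψ : ℝ → ℂ} {C : ℝ}

theorem integrableOn_mul_amplitude (hV : IntegrableOn V (Ioi 0)) (hm : Continuous m)
    (hmC : ∀ x, ‖m x‖ ≤ C) : IntegrableOn (fun s => V s * m s) (Ioi 0) := by
  simp_rw [mul_comm (V _)]
  exact Integrable.bdd_mul (c := C) hV hm.aestronglyMeasurable (Eventually.of_forall hmC)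

theorem norm_phaseIntegral_mul_amplitude_le (hk : 0 ≤ k.im) (hmC : ∀ x, ‖m x‖ ≤ C) {x s : ℝ}
    (hx : 0 ≤ x) (hs : x < s) : ‖phaseIntegral k (s - x) * V s * m s‖ ≤ C * (s * ‖V s‖) := by
  rw [norm_mul, norm_mul]
  have h1 : ‖phaseIntegral k (s - x)‖ ≤ s :=
    (norm_phaseIntegral_le hk (by linarith)).trans (by linarith)
  have h2 := mul_le_mul (mul_le_mul_of_nonneg_right h1 (norm_nonneg (V s))) (hmC s)
    (norm_nonneg _) (mul_nonneg (by linarith) (norm_nonneg _))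
  linarith

theorem integrableOn_phaseIntegral_mul_amplitude (hk : 0 ≤ k.im) (hV : IntegrableOn V (Ioi 0))
    (hVx : IntegrableOn (fun x : ℝ => x * ‖V x‖) (Ioi 0)) (hm : Continuous m)
    (hmC : ∀ x, ‖m x‖ ≤ C) {x : ℝ} (hx : 0 ≤ x) :
    IntegrableOn (fun s => phaseIntegral k (s - x) * V s * m s) (Ioi x) := by
  have hsub : Ioi x ⊆ Ioi (0 : ℝ) := Ioi_subset_Ioi hx
  refine Integrable.mono' (Integrable.const_mul (hVx.mono_set hsub) C) ?_ ?_
  · have h1 : Continuous fun s => phaseIntegral k (s - x) :=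
      continuous_phaseIntegral.comp (continuous_const.prodMk (by fun_prop))
    exact (h1.aestronglyMeasurable.mul (hV.mono_set hsub).aestronglyMeasurable).mul
      hm.aestronglyMeasurable
  · filter_upwards [ae_restrict_mem measurableSet_Ioi] with s hs
    exact norm_phaseIntegral_mul_amplitude_le hk hmC hx hs

/-- By `phaseIntegral_sub` the solution is `e^{ikx} + e^{-ikx} (N - D Q)`, where `D` is the phase
integral and `N`, `Q` are tail integrals; two differentiations give the equation. The limit of `m`
follows from the vanishing tail of the first moment. The decay of the derivative is needed to
discard a Wronskian at infinity. -/
theorem jost_solution (hk : 0 ≤ k.im) (hV : IntegrableOn V (Ioi 0))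
    (hVx : IntegrableOn (fun x : ℝ => x * ‖V x‖) (Ioi 0)) (hm : Continuous m)
    (hmC : ∀ x, ‖m x‖ ≤ C)
    (hmeq : ∀ x, 0 ≤ x → m x = 1 + ∫ s in Ioi x, phaseIntegral k (s - x) * V s * m s) :
    (∃ p : ℝ → ℂ, HasSecondDerivative (fun x => m x * Complex.exp (Complex.I * k * x)) p
        (fun x => V x * (m x * Complex.exp (Complex.I * k * x)) -
          k ^ 2 * (m x * Complex.exp (Complex.I * k * x))) ∧
        ∃ C', ∀ x, 0 ≤ x → ‖p x‖ ≤ C' * Real.exp (-k.im * x)) ∧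
      Tendsto m atTop (𝓝 1) := by
  have hVm := integrableOn_mul_amplitude hV hm hmC
  have hDVm : IntegrableOn (fun s => phaseIntegral k s * V s * m s) (Ioi 0) := by
    simpa using integrableOn_phaseIntegral_mul_amplitude hk hV hVx hm hmC le_rfl
  set Q : ℝ → ℂ := fun x => ∫ s in Ioi x, V s * m s with hQ
  set N : ℝ → ℂ := fun x => ∫ s in Ioi x, phaseIntegral k s * V s * m s with hN
  have hQp : IsPrimitive Q fun x => -(V x * m x) := .integral_Ioi hVm
  have hNp : IsPrimitive N fun x => -(phaseIntegral k x * V x * m x) := .integral_Ioi hDVm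
  have hRp : IsPrimitive (fun x => N x - phaseIntegral k x * Q x)
      (fun x => -(Complex.exp (2 * Complex.I * k * x) * Q x)) :=
    (hNp.sub ((isPrimitive_phaseIntegral k).mul hQp)).congr (fun _ _ => rfl)
      (Eventually.of_forall fun x => by ring)
  have hmR : ∀ x, 0 ≤ x → m x =
      1 + Complex.exp (-(2 * Complex.I * k * x)) * (N x - phaseIntegral k x * Q x) := by
    intro x hx
    rw [hmeq x hx, hQ, hN]
    simp only
    rw [← integral_const_mul, ← integral_sub (hDVm.mono_set (Ioi_subset_Ioi hx))
      (Integrable.const_mul (hVm.mono_set (Ioi_subset_Ioi hx)) _), ← integral_const_mul]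
    congr 2
    ext s
    rw [phaseIntegral_sub]; ring
  have hexp : ∀ x : ℝ, Complex.exp (-(2 * Complex.I * k * x)) * Complex.exp (Complex.I * k * x) =
      Complex.exp (-(Complex.I * k) * x) := by
    intro x; rw [← Complex.exp_add]; ring_nf
  have hexp2 : ∀ x : ℝ, Complex.exp (-(Complex.I * k) * x) * Complex.exp (2 * Complex.I * k * x) =
      Complex.exp (Complex.I * k * x) := by
    intro x; rw [← Complex.exp_add]; ring_nf
  have he : ∀ x : ℝ, 0 ≤ x → Complex.exp (Complex.I * k * x) + Complex.exp (-(Complex.I * k) * x) *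
      (N x - phaseIntegral k x * Q x) = m x * Complex.exp (Complex.I * k * x) := by
    intro x hx
    linear_combination -Complex.exp (Complex.I * k * x) * hmR x hx -
      (N x - phaseIntegral k x * Q x) * hexp x
  have hE1 := isPrimitive_exp (Complex.I * k)
  have hE2 := isPrimitive_exp (-(Complex.I * k))
  set p : ℝ → ℂ := fun x => Complex.I * k * Complex.exp (Complex.I * k * x) +
    (-(Complex.I * k) * (Complex.exp (-(Complex.I * k) * x) * (N x - phaseIntegral k x * Q x)) -
      Complex.exp (Complex.I * k * x) * Q x) with hp
  have hyp : IsPrimitive (fun x => m x * Complex.exp (Complex.I * k * x)) p := by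
    refine (hE1.add (hE2.mul hRp)).congr he (Eventually.of_forall fun x => ?_)
    simp only [hp]
    rw [← hexp2 x]; ring
  have hpq : IsPrimitive p (fun x => V x * (m x * Complex.exp (Complex.I * k * x)) -
          k ^ 2 * (m x * Complex.exp (Complex.I * k * x))) := by
    refine ((hE1.const_mul (Complex.I * k)).add (((hE2.mul hRp).const_mul (-(Complex.I * k))).sub
      (hE1.mul hQp))).congr (fun _ _ => rfl) ?_
    filter_upwards [ae_restrict_mem measurableSet_Ioi] with x hx
    have h1 := he x (le_of_lt hx)
    have h2 : Complex.I * Complex.I = -1 := Complex.I_mul_I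
    have h3 : k ^ 2 * (m x * Complex.exp (Complex.I * k * x)) = -(Complex.I * k) * (Complex.I * k) *
        (Complex.exp (Complex.I * k * x) + Complex.exp (-(Complex.I * k) * x) *
      (N x - phaseIntegral k x * Q x)) := by
      linear_combination Complex.I ^ 2 * k ^ 2 * h1 +
        k ^ 2 * (m x * Complex.exp (Complex.I * k * x)) * h2
    rw [h3, ← hexp2 x]; ring
  refine ⟨⟨p, .of_isPrimitive hyp hpq, ?_⟩, ?_⟩
  · refine ⟨‖k‖ * (2 + C) + ∫ s in Ioi 0, ‖V s * m s‖, fun x hx => ?_⟩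
    -- Eliminating the term with the growing exponential by `he` leaves `e^{ikx}` times a bounded
    -- function.
    have h1 : p x = Complex.exp (Complex.I * k * x) * (Complex.I * k * (2 - m x) - Q x) := by
      simp only [hp]
      linear_combination (-(Complex.I * k)) * he x hx
    rw [h1, norm_mul, norm_exp_I_mul, mul_comm]
    refine mul_le_mul_of_nonneg_right ?_ (Real.exp_pos _).le
    refine (norm_sub_le _ _).trans (add_le_add ?_ ?_)
    · rw [norm_mul, norm_mul, Complex.norm_I, one_mul]
      refine mul_le_mul_of_nonneg_left ((norm_sub_le _ _).trans ?_) (norm_nonneg _)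
      rw [Complex.norm_ofNat]
      linarith [hmC x]
    · refine (norm_integral_le_integral_norm _).trans ?_
      exact setIntegral_mono_set hVm.norm (Eventually.of_forall fun s => norm_nonneg _)
        (Ioi_subset_Ioi hx).eventuallyLE
  · rw [tendsto_iff_norm_sub_tendsto_zero]
    have h1 := (tendsto_integral_Ioi_atTop hVx).const_mul C
    rw [mul_zero] at h1
    refine squeeze_zero' (Eventually.of_forall fun _ => norm_nonneg _) ?_ h1
    filter_upwards [eventually_ge_atTop (0 : ℝ)] with x hx
    rw [hmeq x hx, add_sub_cancel_left, ← integral_const_mul]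
    refine norm_integral_le_of_norm_le
      (Integrable.const_mul (hVx.mono_set (Ioi_subset_Ioi hx)) C) ?_
    filter_upwards [ae_restrict_mem measurableSet_Ioi] with s hs
    exact norm_phaseIntegral_mul_amplitude_le hk hmC hx hs

/-- At `x = 0` the phase integral is estimated by `1/|k|` instead of by `s`, so only integrability
of `V` enters. -/
theorem norm_jost_sub_one_le (hk : 0 ≤ k.im) (hk0 : k ≠ 0) (hV : IntegrableOn V (Ioi 0))
    (hmC : ∀ x, ‖m x‖ ≤ C)
    (hmeq : m 0 = 1 + ∫ s in Ioi 0, phaseIntegral k (s - 0) * V s * m s) :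
    ‖m 0 - 1‖ ≤ ‖k‖⁻¹ * (C * ∫ s in Ioi 0, ‖V s‖) := by
  rw [hmeq, add_sub_cancel_left, ← mul_assoc, ← integral_const_mul]
  refine norm_integral_le_of_norm_le (Integrable.const_mul hV.norm _) ?_
  filter_upwards [ae_restrict_mem measurableSet_Ioi] with s hs
  rw [norm_mul, norm_mul, sub_zero]
  have h1 := norm_phaseIntegral_le_inv hk hk0 (le_of_lt hs)
  have h2 := mul_le_mul (mul_le_mul_of_nonneg_right h1 (norm_nonneg (V s))) (hmC s)
    (norm_nonneg _) (mul_nonneg (inv_nonneg.2 (norm_nonneg _)) (norm_nonneg _))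
  linarith

/-- As for the Jost solution, separating the kernel leaves products of primitives, now with base
point `0`. The normalization at the origin makes the Wronskian with the Jost solution equal to
`e(0)`. -/
theorem regular_solution (hV : IntegrableOn V (Ioi 0)) (hψ : Continuous ψ)
    (hψeq : ∀ x, 0 ≤ x → ψ x = phaseIntegral k x +
      ∫ s in (0 : ℝ)..x, phaseIntegral k (x - s) * V s * ψ s) :
    ∃ p : ℝ → ℂ, HasSecondDerivative (fun x => ψ x * Complex.exp (-(Complex.I * k) * x)) p
        (fun x => V x * (ψ x * Complex.exp (-(Complex.I * k) * x)) -
          k ^ 2 * (ψ x * Complex.exp (-(Complex.I * k) * x))) ∧ ψ 0 = 0 ∧ p 0 = 1 := by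
  have hVi : ∀ (g : ℝ → ℂ), Continuous g → ∀ x, 0 ≤ x →
      IntervalIntegrable (fun s => g s * V s) volume 0 x := by
    intro g hg x hx
    refine IntervalIntegrable.continuousOn_mul ?_ hg.continuousOn
    rw [intervalIntegrable_iff_integrableOn_Ioc_of_le hx]
    exact hV.mono_set Ioc_subset_Ioi_self
  have hD : Continuous (phaseIntegral k) :=
    continuous_phaseIntegral.comp (continuous_const.prodMk continuous_id)
  set a : ℝ → ℂ := fun s => Complex.exp (-(2 * Complex.I * k * s)) * ψ s with ha
  have hac : Continuous a := by fun_prop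
  set Q : ℝ → ℂ := fun x => ∫ s in (0 : ℝ)..x, a s * V s with hQ
  set N : ℝ → ℂ := fun x => ∫ s in (0 : ℝ)..x, phaseIntegral k s * a s * V s with hN
  have hQp : IsPrimitive Q fun x => a x * V x := .integral_zero (hVi a hac)
  have hNp : IsPrimitive N fun x => phaseIntegral k x * a x * V x :=
    .integral_zero (hVi _ (hD.mul hac))
  have hψR : ∀ x, 0 ≤ x → phaseIntegral k x + (phaseIntegral k x * Q x - N x) = ψ x := by
    intro x hx
    rw [hψeq x hx, hQ, hN]
    simp only
    rw [← intervalIntegral.integral_const_mul, ← intervalIntegral.integral_sub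
      ((hVi a hac x hx).const_mul _) (hVi (fun s => phaseIntegral k s * a s) (hD.mul hac) x hx)]
    congr 1
    refine intervalIntegral.integral_congr fun s _ => ?_
    simp only [ha]
    rw [phaseIntegral_sub]; ring
  have hψp : IsPrimitive ψ fun x => Complex.exp (2 * Complex.I * k * x) * (1 + Q x) := by
    refine ((isPrimitive_phaseIntegral k).add
      (((isPrimitive_phaseIntegral k).mul hQp).sub hNp)).congr hψR
      (Eventually.of_forall fun x => by ring)
  have hexp2 : ∀ x : ℝ, Complex.exp (2 * Complex.I * k * x) * Complex.exp (-(Complex.I * k) * x) =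
      Complex.exp (Complex.I * k * x) := by
    intro x; rw [← Complex.exp_add]; ring_nf
  have hexp3 : ∀ x : ℝ, Complex.exp (Complex.I * k * x) * Complex.exp (-(2 * Complex.I * k * x)) =
      Complex.exp (-(Complex.I * k) * x) := by
    intro x; rw [← Complex.exp_add]; ring_nf
  have hE1 := isPrimitive_exp (Complex.I * k)
  have hE2 := isPrimitive_exp (-(Complex.I * k))
  have hψ0 : ψ 0 = 0 := by rw [hψeq 0 le_rfl]; simp [phaseIntegral_zero_right]
  have hyp := hψp.mul hE2
  set p : ℝ → ℂ := fun x => -(Complex.I * k) * (ψ x * Complex.exp (-(Complex.I * k) * x)) +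
    (Complex.exp (Complex.I * k * x) + Complex.exp (Complex.I * k * x) * Q x) with hp
  refine ⟨p, .of_isPrimitive (hyp.congr (fun _ _ => rfl) (Eventually.of_forall fun x => ?_))
    (((hyp.const_mul (-(Complex.I * k))).add (hE1.add (hE1.mul hQp))).congr (fun _ _ => rfl)
      (Eventually.of_forall fun x => ?_)), hψ0, ?_⟩
  · simp only [hp]
    linear_combination (1 + Q x) * hexp2 x
  · simp only [ha]
    have h2 : Complex.I * Complex.I = -1 := Complex.I_mul_I
    linear_combination (-(Complex.I * k) * (1 + Q x)) * hexp2 x + ψ x * V x * hexp3 x +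
      k ^ 2 * ψ x * Complex.exp (-(Complex.I * k) * x) * h2
  · simp [hp, hψ0, hQ]

end Potential

/-! ### The Green function -/

section Green

variable {V : ℝ → ℂ}

theorem integrableOn_sq_norm (f : HalfLineL2) : IntegrableOn (fun x => ‖f x‖ ^ 2) (Ioi (0 : ℝ)) :=
  (memLp_two_iff_integrable_sq_norm (Lp.aestronglyMeasurable f)).1 (Lp.memLp f)

theorem norm_intervalIntegral_le_of_bound {q : ℝ → ℂ} {b : ℝ → ℝ} (hb : IntegrableOn b (Ioi 0))
    (hb0 : ∀ x, 0 ≤ b x) {c : ℝ}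
    (hq : ∀ᵐ x ∂(volume.restrict (Ioi (0 : ℝ))), ‖q x‖ ≤ c + b x) {T : ℝ} (hT : 0 ≤ T) :
    ‖∫ s in (0 : ℝ)..T, q s‖ ≤ c * T + ∫ s in Ioi 0, b s := by
  have hbT : IntegrableOn b (Ioc 0 T) := hb.mono_set Ioc_subset_Ioi_self
  have hcT : IntegrableOn (fun _ : ℝ => c) (Ioc 0 T) := by simp
  rw [intervalIntegral.integral_of_le hT]
  calc ‖∫ s in Ioc 0 T, q s‖ ≤ ∫ s in Ioc 0 T, (c + b s) :=
        norm_integral_le_of_norm_le (hcT.add hbT)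
          (ae_restrict_of_ae_restrict_of_subset Ioc_subset_Ioi_self hq)
    _ = c * T + ∫ s in Ioc 0 T, b s := by
        rw [integral_add hcT hbT]
        simp [hT, mul_comm]
    _ ≤ _ := by
        gcongr
        · exact Eventually.of_forall hb0
        · exact Ioc_subset_Ioi_self

/-- Solutions of the inhomogeneous equation with square integrable data grow at most
polynomially. -/
theorem HasSecondDerivative.polynomial_growth {y p q : ℝ → ℂ} (h : HasSecondDerivative y p q)
    {b : ℝ → ℝ} (hb : IntegrableOn b (Ioi 0)) (hb0 : ∀ x, 0 ≤ b x) {c : ℝ} (hc : 0 ≤ c)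
    (hq : ∀ᵐ x ∂(volume.restrict (Ioi (0 : ℝ))), ‖q x‖ ≤ c + b x) :
    ∃ K, 0 ≤ K ∧ ∀ T, 0 ≤ T → ‖p T‖ ≤ K * (1 + T) ∧ ‖y T‖ ≤ K * (1 + T) ^ 2 := by
  have hB : 0 ≤ ∫ s in Ioi 0, b s := setIntegral_nonneg measurableSet_Ioi fun s _ => hb0 s
  set K := ‖p 0‖ + c + ∫ s in Ioi 0, b s with hK
  have hK0 : 0 ≤ K := by positivity
  have hp : ∀ T, 0 ≤ T → ‖p T‖ ≤ K * (1 + T) := by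
    intro T hT
    rw [h.eq_integral T hT]
    refine (norm_add_le _ _).trans ?_
    have := norm_intervalIntegral_le_of_bound hb hb0 hq hT
    have h1 := norm_nonneg (p 0)
    nlinarith [mul_nonneg h1 hT, mul_nonneg hB hT]
  refine ⟨K + ‖y 0‖, by positivity, fun T hT => ⟨?_, ?_⟩⟩
  · exact (hp T hT).trans (by nlinarith [mul_nonneg (norm_nonneg (y 0)) hT, norm_nonneg (y 0)])
  · rw [(h.isPrimitive T hT).2]
    refine (norm_add_le _ _).trans ?_
    have h1 : ‖∫ s in (0 : ℝ)..T, p s‖ ≤ K * (1 + T) * |T - 0| := by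
      refine intervalIntegral.norm_integral_le_of_norm_le_const fun s hs => ?_
      rw [uIoc_of_le hT] at hs
      exact (hp s hs.1.le).trans (mul_le_mul_of_nonneg_left (by linarith [hs.2]) hK0)
    rw [sub_zero, abs_of_nonneg hT] at h1
    nlinarith [mul_nonneg hK0 hT, norm_nonneg (y 0), mul_nonneg (norm_nonneg (y 0)) hT,
      mul_nonneg (mul_nonneg (norm_nonneg (y 0)) hT) hT]

theorem tendsto_mul_exp_neg_atTop {c : ℝ} (hc : 0 < c) (K : ℝ) :
    Tendsto (fun T : ℝ => K * (1 + T) ^ 2 * Real.exp (-c * T)) atTop (𝓝 0) := by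
  have h := Real.tendsto_pow_mul_exp_neg_atTop_nhds_zero 2
  have h1 : Tendsto (fun T : ℝ => c * (1 + T)) atTop atTop :=
    (tendsto_const_nhds.add_atTop tendsto_id).const_mul_atTop hc
  have h2 := (h.comp h1).const_mul (K * Real.exp c / c ^ 2)
  rw [mul_zero] at h2
  refine h2.congr fun T => ?_
  simp only [Function.comp_apply]
  have h3 : Real.exp (-(c * (1 + T))) = Real.exp (-c) * Real.exp (-c * T) := by
    rw [← Real.exp_add]; ring_nf
  have h4 : Real.exp c * Real.exp (-c) = 1 := by rw [← Real.exp_add]; simp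
  have h5 : c ^ 2 * (c ^ 2)⁻¹ = 1 := mul_inv_cancel₀ (by positivity)
  rw [h3, div_eq_mul_inv]
  linear_combination (K * (1 + T) ^ 2 * Real.exp (-c * T)) * h4 +
    (K * (1 + T) ^ 2 * Real.exp (-c * T)) * Real.exp c * Real.exp (-c) * h5

variable {k : ℂ} {e pe φ pφ : ℝ → ℂ}

/-- The Green function of `L_V - k²` in the upper half plane is bounded by a multiple of
`√x √s`. -/
theorem green_bound (hk : 0 < k.im) {B C₁ C₂ C₃ : ℝ} (hC₁ : 0 ≤ C₁) (hC₂ : 0 ≤ C₂)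
    (hB : ∀ᵐ x ∂(volume.restrict (Ioi (0 : ℝ))), ‖V x‖ ≤ B)
    (he : HasSecondDerivative e pe fun x => V x * e x - k ^ 2 * e x)
    (hφ : HasSecondDerivative φ pφ fun x => V x * φ x - k ^ 2 * φ x)
    (hφ0 : φ 0 = 0) (hφ1 : pφ 0 = 1)
    (hebd : ∀ x, 0 ≤ x → ‖e x‖ ≤ C₁ * Real.exp (-k.im * x))
    (hpebd : ∀ x, 0 ≤ x → ‖pe x‖ ≤ C₃ * Real.exp (-k.im * x))
    (hφbd : ∀ x, 0 ≤ x → ‖φ x‖ ≤ C₂ * x * Real.exp (k.im * x))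
    {f g : HalfLineL2} (hfg : (f, g + k ^ 2 • f) ∈ schrodingerGraph V)
    (hg : IntegrableOn (fun s : ℝ => √s * ‖g s‖) (Ioi 0)) :
    ∀ᵐ x ∂(volume.restrict (Ioi (0 : ℝ))),
      ‖e 0‖ * ‖f x‖ ≤ 2 * (C₁ * C₂) * (√x * ∫ s in Ioi 0, √s * ‖g s‖) := by
  obtain ⟨y, p, q, hy, hy0, hfy, hgy⟩ := hfg
  simp only at hfy hgy
  have hq : ∀ᵐ x ∂(volume.restrict (Ioi (0 : ℝ))), q x = V x * y x - k ^ 2 * y x - g x := by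
    filter_upwards [hfy, hgy, Lp.coeFn_add g (k ^ 2 • f), Lp.coeFn_smul (k ^ 2) f] with x h1 h2 h3 h4
    rw [h3, Pi.add_apply, h4, Pi.smul_apply, h1, smul_eq_mul] at h2
    linear_combination h2
  -- The function `y` is known only to be square integrable; `t ≤ 1 + t²` majorizes `|y''|` by a
  -- constant plus an integrable function, and this already yields polynomial growth of `y` and
  -- `y'`.
  obtain ⟨K, hK0, hK⟩ := hy.polynomial_growth
    (b := fun x => (|B| + ‖k ^ 2‖) * ‖f x‖ ^ 2 + ‖g x‖ ^ 2) (c := |B| + ‖k ^ 2‖ + 1)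
    (Integrable.fun_add (Integrable.const_mul (integrableOn_sq_norm f) (|B| + ‖k ^ 2‖))
      (integrableOn_sq_norm g))
    (fun x => by positivity) (by positivity) (by
      filter_upwards [hq, hfy, hB] with x h1 h2 h3
      rw [h1, ← h2]
      refine (norm_sub_le _ _).trans ?_
      have h4 : ‖V x * f x - k ^ 2 * f x‖ ≤ (|B| + ‖k ^ 2‖) * ‖f x‖ := by
        refine (norm_sub_le _ _).trans ?_
        rw [norm_mul, norm_mul, add_mul]
        gcongr
        exact h3.trans (le_abs_self B)
      have h5 : ∀ t : ℝ, t ≤ 1 + t ^ 2 := fun t => by nlinarith [sq_nonneg (t - 1), sq_nonneg t]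
      have h6 := mul_le_mul_of_nonneg_left (h5 ‖f x‖) (show 0 ≤ |B| + ‖k ^ 2‖ by positivity)
      linarith [h5 ‖g x‖])
  set J := ∫ s in Ioi 0, √s * ‖g s‖ with hJ
  -- The Wronskian of two homogeneous solutions is constant; those with `y` have derivative `-g φ`
  -- and `-g e`. These three identities replace an explicit resolvent kernel.
  have hW0 : ∀ x, 0 ≤ x → pφ x * e x - φ x * pe x = e 0 := by
    have h1 := (hφ.isPrimitive_deriv.mul he.isPrimitive).sub (hφ.isPrimitive.mul he.isPrimitive_deriv)
    intro x hx
    have h2 := h1.eq_zero_add (Eventually.of_forall fun x => by ring) hx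
    simpa [hφ0, hφ1] using h2
  have hWφ : ∀ x, 0 ≤ x → p x * φ x - y x * pφ x = ∫ s in (0 : ℝ)..x, -(g s * φ s) := by
    have h1 := (hy.isPrimitive_deriv.mul hφ.isPrimitive).sub (hy.isPrimitive.mul hφ.isPrimitive_deriv)
    have h2 := h1.congr_ae (g := fun s => -(g s * φ s)) (by
      filter_upwards [hq] with x hx
      rw [hx]; ring)
    intro x hx
    simpa [hφ0, hy0] using (h2 x hx).2
  have hWe : IsPrimitive (fun x => p x * e x - y x * pe x) fun s => -(g s * e s) := by
    have h1 := (hy.isPrimitive_deriv.mul he.isPrimitive).sub (hy.isPrimitive.mul he.isPrimitive_deriv)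
    refine h1.congr_ae ?_
    filter_upwards [hq] with x hx
    rw [hx]; ring
  -- Exponential decay of `e` and `e'` defeats the polynomial growth of `y`. This is where `Im k >
  -- 0` is used strictly.
  have hWe0 : Tendsto (fun x => p x * e x - y x * pe x) atTop (𝓝 0) := by
    refine squeeze_zero_norm' ?_ (tendsto_mul_exp_neg_atTop hk (K * (C₁ + C₃)))
    filter_upwards [eventually_ge_atTop (0 : ℝ)] with T hT
    obtain ⟨h1, h2⟩ := hK T hT
    refine (norm_sub_le _ _).trans ?_
    rw [norm_mul, norm_mul]
    have h3 : ‖p T‖ ≤ K * (1 + T) ^ 2 := by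
      have h4 := mul_nonneg (mul_nonneg hK0 hT) hT
      have h5 := mul_nonneg hK0 hT
      linarith
    have h4 := mul_le_mul h3 (hebd T hT) (norm_nonneg _) (by positivity)
    have h5 := mul_le_mul h2 (hpebd T hT) (norm_nonneg _) (by positivity)
    linarith
  have hJφ : ∀ x, 0 ≤ x → ‖∫ s in (0 : ℝ)..x, -(g s * φ s)‖ ≤
      C₂ * Real.exp (k.im * x) * (√x * J) := by
    intro x hx
    rw [intervalIntegral.integral_of_le hx]
    calc ‖∫ s in Ioc 0 x, -(g s * φ s)‖ ≤
          ∫ s in Ioc 0 x, C₂ * Real.exp (k.im * x) * √x * (√s * ‖g s‖) := by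
          refine norm_integral_le_of_norm_le
            (Integrable.const_mul (hg.mono_set Ioc_subset_Ioi_self) _) ?_
          filter_upwards [ae_restrict_mem measurableSet_Ioc] with s hs
          rw [norm_neg, norm_mul]
          have h1 : ‖φ s‖ ≤ C₂ * (√x * √s) * Real.exp (k.im * x) := by
            refine (hφbd s hs.1.le).trans ?_
            -- For `s ≤ x` the factor `s` from the regular solution is the minimum of the two
            -- variables, hence at most their geometric mean.
            have h2 : s ≤ √x * √s := by
              nth_rewrite 1 [← Real.mul_self_sqrt hs.1.le]
              gcongr
              exact hs.2
            gcongr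
            exact hs.2
          calc ‖g s‖ * ‖φ s‖ ≤ ‖g s‖ * (C₂ * (√x * √s) * Real.exp (k.im * x)) := by gcongr
            _ = _ := by ring
      _ = C₂ * Real.exp (k.im * x) * √x * ∫ s in Ioc 0 x, √s * ‖g s‖ := integral_const_mul _ _
      _ ≤ C₂ * Real.exp (k.im * x) * √x * J := by
          refine mul_le_mul_of_nonneg_left ?_ (by positivity)
          exact setIntegral_mono_set hg (Eventually.of_forall fun s => by positivity)
            Ioc_subset_Ioi_self.eventuallyLE
      _ = _ := by ring
  -- The factor `x` comes from the bound on `φ(x)` and is distributed here, since on `s ≥ x` it is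
  -- at most `√x √s`.
  have hJe : ∀ x, 0 ≤ x → x * ‖p x * e x - y x * pe x‖ ≤
      C₁ * Real.exp (-k.im * x) * (√x * J) := by
    intro x hx
    have h1 : ∀ T, x ≤ T → x * ‖p x * e x - y x * pe x‖ ≤ x * ‖p T * e T - y T * pe T‖ +
        C₁ * Real.exp (-k.im * x) * (√x * J) := by
      intro T hT
      have h2 : p x * e x - y x * pe x =
          (p T * e T - y T * pe T) - ∫ s in x..T, -(g s * e s) := by
        have h3 := (hWe x hx).2
        have h4 := (hWe T (hx.trans hT)).2
        beta_reduce at h3 h4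
        rw [h3, h4, ← intervalIntegral.integral_interval_sub_left
          (hWe T (hx.trans hT)).1 (hWe x hx).1]
        ring
      have h3 : x * ‖∫ s in x..T, -(g s * e s)‖ ≤ C₁ * Real.exp (-k.im * x) * (√x * J) := by
        rw [intervalIntegral.integral_of_le hT]
        have hsub : Ioc x T ⊆ Ioi 0 := fun s hs => hx.trans_lt hs.1
        calc x * ‖∫ s in Ioc x T, -(g s * e s)‖ = ‖∫ s in Ioc x T, (x : ℂ) * -(g s * e s)‖ := by
              rw [integral_const_mul, norm_mul, Complex.norm_real, Real.norm_of_nonneg hx]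
          _ ≤ ∫ s in Ioc x T, C₁ * Real.exp (-k.im * x) * √x * (√s * ‖g s‖) := by
              refine norm_integral_le_of_norm_le (Integrable.const_mul (hg.mono_set hsub) _) ?_
              filter_upwards [ae_restrict_mem measurableSet_Ioc] with s hs
              rw [norm_mul, norm_neg, norm_mul, Complex.norm_real, Real.norm_of_nonneg hx]
              have h4 : x ≤ √x * √s := by
                nth_rewrite 1 [← Real.mul_self_sqrt hx]
                gcongr
                exact hs.1.le
              have h5 : ‖e s‖ ≤ C₁ * Real.exp (-k.im * x) := by
                refine (hebd s (hx.trans hs.1.le)).trans ?_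
                gcongr ?_ * Real.exp ?_
                nlinarith [hs.1]
              calc x * (‖g s‖ * ‖e s‖) ≤ (√x * √s) * (‖g s‖ * (C₁ * Real.exp (-k.im * x))) := by
                    gcongr
                _ = _ := by ring
          _ = C₁ * Real.exp (-k.im * x) * √x * ∫ s in Ioc x T, √s * ‖g s‖ :=
              integral_const_mul _ _
          _ ≤ C₁ * Real.exp (-k.im * x) * √x * J := by
              refine mul_le_mul_of_nonneg_left ?_ (by positivity)
              exact setIntegral_mono_set hg (Eventually.of_forall fun s => by positivity)
                hsub.eventuallyLE
          _ = _ := by ring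
      rw [h2]
      refine (mul_le_mul_of_nonneg_left (norm_sub_le _ _) hx).trans ?_
      rw [mul_add]
      linarith
    have h2 : Tendsto (fun T => x * ‖p T * e T - y T * pe T‖ +
        C₁ * Real.exp (-k.im * x) * (√x * J)) atTop
        (𝓝 (x * 0 + C₁ * Real.exp (-k.im * x) * (√x * J))) := by
      have := hWe0.norm
      rw [norm_zero] at this
      exact (this.const_mul x).add_const _
    rw [mul_zero, zero_add] at h2
    exact ge_of_tendsto h2 ((eventually_ge_atTop x).mono h1)
  filter_upwards [hfy, ae_restrict_mem measurableSet_Ioi] with x hxy hx0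
  have hx : 0 ≤ x := le_of_lt hx0
  have hee : Real.exp (k.im * x) * Real.exp (-k.im * x) = 1 := by
    rw [← Real.exp_add]; simp
  -- Variation of constants: the `p x` terms cancel and the coefficient of `y x` is the constant
  -- Wronskian. In the two products the exponentials of `φ` and `e` cancel exactly.
  have hmain : e 0 * y x = φ x * (p x * e x - y x * pe x) - e x * (p x * φ x - y x * pφ x) := by
    rw [← hW0 x hx]; ring
  rw [hxy, ← norm_mul, hmain]
  refine (norm_sub_le _ _).trans ?_
  rw [norm_mul, norm_mul, hWφ x hx]
  have h1 : ‖φ x‖ * ‖p x * e x - y x * pe x‖ ≤ C₁ * C₂ * (√x * J) := by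
    calc ‖φ x‖ * ‖p x * e x - y x * pe x‖
        ≤ C₂ * x * Real.exp (k.im * x) * ‖p x * e x - y x * pe x‖ := by gcongr; exact hφbd x hx
      _ = C₂ * Real.exp (k.im * x) * (x * ‖p x * e x - y x * pe x‖) := by ring
      _ ≤ C₂ * Real.exp (k.im * x) * (C₁ * Real.exp (-k.im * x) * (√x * J)) := by
          exact mul_le_mul_of_nonneg_left (hJe x hx) (by positivity)
      _ = C₁ * C₂ * (√x * J) * (Real.exp (k.im * x) * Real.exp (-k.im * x)) := by ring
      _ = _ := by rw [hee, mul_one]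
  have h2 : ‖e x‖ * ‖∫ s in (0 : ℝ)..x, -(g s * φ s)‖ ≤ C₁ * C₂ * (√x * J) := by
    calc ‖e x‖ * ‖∫ s in (0 : ℝ)..x, -(g s * φ s)‖
        ≤ C₁ * Real.exp (-k.im * x) * (C₂ * Real.exp (k.im * x) * (√x * J)) := by
          have := hJφ x hx
          have h3 := hebd x hx
          gcongr
      _ = C₁ * C₂ * (√x * J) * (Real.exp (k.im * x) * Real.exp (-k.im * x)) := by ring
      _ = _ := by rw [hee, mul_one]
  linarith

end Green

/-! ### Zero-free Jost functions and uniform resolvent bounds -/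

section Potential

variable {V : ℝ → ℂ}

theorem ae_norm_le_of_memLp_top (hVb : MemLp V ∞ (volume.restrict (Ioi (0 : ℝ)))) :
    ∃ B : ℝ, 0 ≤ B ∧ ∀ᵐ x ∂(volume.restrict (Ioi (0 : ℝ))), ‖V x‖ ≤ B := by
  refine ⟨(eLpNorm V ∞ (volume.restrict (Ioi (0 : ℝ)))).toReal, ENNReal.toReal_nonneg, ?_⟩
  have h := hVb.2
  rw [eLpNorm_exponent_top] at h ⊢
  filter_upwards [ae_le_eLpNormEssSup (f := V) (μ := volume.restrict (Ioi (0 : ℝ)))] with x hx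
  rw [← toReal_enorm]
  exact ENNReal.toReal_mono h.ne hx

/-- Boundedness handles `x ≤ 1`; beyond that `|V| ≤ x |V|`. -/
theorem integrableOn_of_bounded (hVb : MemLp V ∞ (volume.restrict (Ioi (0 : ℝ))))
    (hVx : IntegrableOn (fun x : ℝ => x * ‖V x‖) (Ioi 0)) : IntegrableOn V (Ioi 0) := by
  obtain ⟨B, hB0, hB⟩ := ae_norm_le_of_memLp_top hVb
  have h1 : IntegrableOn (fun x => (Ioc (0 : ℝ) 1).indicator (fun _ => B) x) (Ioi 0) :=
    ((integrable_indicator_iff measurableSet_Ioc).2 (by simp)).integrableOn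
  refine Integrable.mono' (Integrable.fun_add h1 hVx) hVb.1 ?_
  filter_upwards [hB, ae_restrict_mem measurableSet_Ioi] with x hx hx0
  have hx0' : (0 : ℝ) < x := hx0
  by_cases h : x ≤ 1
  · rw [indicator_of_mem (mem_Ioc.2 ⟨hx0', h⟩)]
    nlinarith [mul_nonneg hx0'.le (norm_nonneg (V x))]
  · rw [indicator_of_notMem fun h' => h h'.2]
    nlinarith [norm_nonneg (V x), not_le.1 h]

/-- The Jost function is close to `1` outside a large disc, and on the remaining compact part of the
closed half plane it is continuous without zeros. -/
theorem exists_lower_bound_jost {m : ℝ → UpperHalf → ℂ} {C : ℝ} (hV : IntegrableOn V (Ioi 0))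
    (hm : Continuous fun xk : ℝ × UpperHalf => m xk.1 xk.2) (hmC : ∀ x k, ‖m x k‖ ≤ C)
    (hmeq : ∀ x, 0 ≤ x → ∀ k : UpperHalf,
      m x k = 1 + ∫ s in Ioi x, phaseIntegral k (s - x) * V s * m s k)
    (hne : ∀ k, m 0 k ≠ 0) : ∃ c > 0, ∀ k, c ≤ ‖m 0 k‖ := by
  -- Chosen so that `|e(0,k) - 1| ≤ 1/2` for `|k| ≥ R`; the summand `1` keeps `R` positive when `V`
  -- vanishes.
  set R : ℝ := 2 * (|C| * ∫ s in Ioi 0, ‖V s‖) + 1 with hR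
  have hI : 0 ≤ ∫ s in Ioi 0, ‖V s‖ := setIntegral_nonneg measurableSet_Ioi fun s _ => norm_nonneg _
  have hRpos : 0 < R := by positivity
  have hfar : ∀ k : UpperHalf, R ≤ ‖(k : ℂ)‖ → 1 / 2 ≤ ‖m 0 k‖ := by
    intro k hk
    have hk0 : 0 < ‖(k : ℂ)‖ := hRpos.trans_le hk
    have h1 := norm_jost_sub_one_le k.2 (norm_pos_iff.1 hk0) hV (fun x => hmC x k)
      (hmeq 0 le_rfl k)
    have h2 : ‖(k : ℂ)‖⁻¹ * (C * ∫ s in Ioi 0, ‖V s‖) ≤ 1 / 2 := by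
      rw [inv_mul_le_iff₀ hk0]
      have := mul_le_mul_of_nonneg_right (le_abs_self C) hI
      linarith
    have h3 := norm_sub_norm_le (1 : ℂ) (1 - m 0 k)
    rw [norm_one, sub_sub_cancel, norm_sub_rev] at h3
    linarith
  have hcl : IsClosed {k : ℂ | 0 ≤ k.im} := isClosed_le continuous_const Complex.continuous_im
  have hcomp : IsCompact {k : UpperHalf | ‖(k : ℂ)‖ ≤ R} := by
    have := hcl.isClosedEmbedding_subtypeVal.isCompact_preimage (isCompact_closedBall (0 : ℂ) R)
    convert! this using 1
    ext k
    simp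
  have hcont : Continuous fun k : UpperHalf => ‖m 0 k‖ :=
    (hm.comp (continuous_const.prodMk continuous_id)).norm
  obtain ⟨k₀, hk₀, hmin⟩ := hcomp.exists_isMinOn ⟨⟨0, by simp⟩, by simp [hRpos.le]⟩
    hcont.continuousOn
  refine ⟨min (1 / 2) ‖m 0 k₀‖, lt_min (by norm_num) (norm_pos_iff.2 (hne k₀)), fun k => ?_⟩
  rcases le_total R ‖(k : ℂ)‖ with h | h
  · exact (min_le_left _ _).trans (hfar k h)
  · exact (min_le_right _ _).trans (hmin h)

/-- The resolvent kernel of `L_V` is bounded by a multiple of `√x √s`, uniformly in the spectral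
parameter, if the Jost function has no zeros in the closed upper half plane. -/
theorem exists_resolvent_bound (hVb : MemLp V ∞ (volume.restrict (Ioi (0 : ℝ))))
    (hVx : IntegrableOn (fun x : ℝ => x * ‖V x‖) (Ioi 0))
    (hne : ∀ (k : ℂ) (m : ℝ → ℂ) (C : ℝ), 0 ≤ k.im → Continuous m → (∀ x, ‖m x‖ ≤ C) →
      (∀ x, 0 ≤ x → m x = 1 + ∫ s in Ioi x, phaseIntegral k (s - x) * V s * m s) → m 0 ≠ 0) :
    ∃ M : ℝ, 0 ≤ M ∧ ∀ k : ℂ, 0 < k.im → ∀ f g : HalfLineL2,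
      (f, g + k ^ 2 • f) ∈ schrodingerGraph V →
      IntegrableOn (fun s : ℝ => √s * ‖g s‖) (Ioi 0) →
      ∀ᵐ x ∂(volume.restrict (Ioi (0 : ℝ))), ‖f x‖ ≤ M * (√x * ∫ s in Ioi 0, √s * ‖g s‖) := by
  have hV := integrableOn_of_bounded hVb hVx
  obtain ⟨B, hB0, hB⟩ := ae_norm_le_of_memLp_top hVb
  obtain ⟨m, C₁, hm, hmC, hmeq⟩ := exists_jost_amplitude hV hVx
  obtain ⟨ψ, C₂, hψ, hψC, hψeq⟩ := exists_regular_amplitude hV hVx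
  have hmk : ∀ k, Continuous fun x => m x k := fun k =>
    hm.comp (continuous_id.prodMk continuous_const)
  obtain ⟨c, hc, hcm⟩ := exists_lower_bound_jost hV hm hmC hmeq fun k =>
    hne k _ C₁ k.2 (hmk k) (fun x => hmC x k) fun x hx => hmeq x hx k
  have hC₁ : 0 ≤ C₁ := (norm_nonneg _).trans (hmC 0 ⟨0, by simp⟩)
  have hC₂ : 0 ≤ C₂ := by
    have := hψC 1 ⟨0, by simp⟩ zero_le_one
    rw [mul_one] at this
    exact (norm_nonneg _).trans this
  refine ⟨c⁻¹ * (2 * (C₁ * C₂)), by positivity, fun k hk f g hfg hg => ?_⟩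
  obtain ⟨⟨pe, he, C₃, hpe⟩, -⟩ := jost_solution hk.le hV hVx (hmk ⟨k, hk.le⟩)
    (fun x => hmC x ⟨k, hk.le⟩) fun x hx => hmeq x hx ⟨k, hk.le⟩
  obtain ⟨pφ, hφ, hψ0, hpφ0⟩ := regular_solution (k := k) hV (hψ ⟨k, hk.le⟩)
    fun x hx => hψeq x hx ⟨k, hk.le⟩
  have h := green_bound hk hC₁ hC₂ hB he hφ (by simp [hψ0]) hpφ0 (fun x _ => ?_) hpe
    (fun x hx => ?_) hfg hg
  · filter_upwards [h] with x hx
    have h1 : c * ‖f x‖ ≤ 2 * (C₁ * C₂) * (√x * ∫ s in Ioi 0, √s * ‖g s‖) := by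
      refine (mul_le_mul_of_nonneg_right ?_ (norm_nonneg _)).trans hx
      simpa using hcm ⟨k, hk.le⟩
    rw [mul_assoc, ← div_eq_inv_mul, le_div_iff₀ hc]
    linarith
  · rw [norm_mul, norm_exp_I_mul]
    exact mul_le_mul_of_nonneg_right (hmC x _) (Real.exp_pos _).le
  · rw [norm_mul, Complex.norm_exp]
    have : (-(Complex.I * k) * x).re = k.im * x := by simp
    rw [this]
    exact mul_le_mul_of_nonneg_right (hψC x _ hx) (Real.exp_pos _).le

/-- The only place where the spectral hypotheses enter. For real `k` a zero is a spectral
singularity; for `Im k > 0` the Jost solution decays exponentially and satisfies the boundary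
condition, so it is an eigenfunction for `k²`. It is not zero because its amplitude tends to `1`. -/
theorem jost_ne_zero (hVb : MemLp V ∞ (volume.restrict (Ioi (0 : ℝ))))
    (hVx : IntegrableOn (fun x : ℝ => x * ‖V x‖) (Ioi 0))
    (h_eig : ∀ z : ℂ, ¬ IsEigenvalue (schrodingerOp V) z)
    (h_sing : ∀ z : ℂ, ¬ IsSpectralSingularity V z)
    (k : ℂ) (m : ℝ → ℂ) (C : ℝ) (hk : 0 ≤ k.im) (hm : Continuous m) (hmC : ∀ x, ‖m x‖ ≤ C)
    (hmeq : ∀ x, 0 ≤ x → m x = 1 + ∫ s in Ioi x, phaseIntegral k (s - x) * V s * m s) :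
    m 0 ≠ 0 := by
  intro hm0
  have hV := integrableOn_of_bounded hVb hVx
  obtain ⟨⟨pe, he, -⟩, hlim⟩ := jost_solution hk hV hVx hm hmC hmeq
  rcases hk.eq_or_lt with hk0 | hk0
  · have hkr : (k.re : ℂ) = k := Complex.ext (by simp) (by simp [← hk0])
    have hjost : IsJostSolution V k fun x => m x * Complex.exp (Complex.I * k * x) := by
      refine ⟨⟨pe, _, he, Eventually.of_forall fun x => by ring⟩, hlim.congr fun x => ?_⟩
      rw [mul_assoc, ← Complex.exp_add]
      simp
    refine h_sing (k ^ 2) ⟨k.re, by rw [hkr],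
      fun x => m x * Complex.exp (Complex.I * k * x), ?_, by simp [hm0]⟩
    rwa [hkr]
  · set e : ℝ → ℂ := fun x => m x * Complex.exp (Complex.I * k * x) with he_def
    have hec : Continuous e := by fun_prop
    have heL : MemLp e 2 (volume.restrict (Ioi (0 : ℝ))) := by
      rw [memLp_two_iff_integrable_sq_norm hec.aestronglyMeasurable]
      have h1 : IntegrableOn (fun x : ℝ => C ^ 2 * Real.exp (-(2 * k.im) * x)) (Ioi 0) :=
        (exp_neg_integrableOn_Ioi 0 (by linarith)).const_mul _
      refine Integrable.mono' h1 (by fun_prop) (Eventually.of_forall fun x => ?_)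
      rw [Real.norm_of_nonneg (by positivity), he_def]
      rw [norm_mul, norm_exp_I_mul, mul_pow, ← Real.exp_nat_mul]
      have h2 : ((2 : ℕ) : ℝ) * (-k.im * x) = -(2 * k.im) * x := by push_cast; ring
      rw [h2]
      gcongr
      exact hmC x
    have hgraph : (heL.toLp e, k ^ 2 • heL.toLp e) ∈ schrodingerGraph V := by
      refine ⟨e, pe, _, he, by simp [he_def, hm0], heL.coeFn_toLp, ?_⟩
      filter_upwards [Lp.coeFn_smul (k ^ 2) (heL.toLp e), heL.coeFn_toLp] with x h1 h2
      rw [h1, Pi.smul_apply, h2, smul_eq_mul]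
      simp only [he_def]
      ring
    rw [← schrodingerOp_graph, LinearPMap.mem_graph_iff] at hgraph
    obtain ⟨f, hf1, hf2⟩ := hgraph
    simp only at hf1 hf2
    refine h_eig (k ^ 2) ⟨f, fun hf0 => ?_, by rw [hf2, hf1]⟩
    rw [hf1] at hf0
    have h1 : e =ᵐ[volume.restrict (Ioi (0 : ℝ))] fun _ => (0 : ℂ) := by
      have h2 := heL.coeFn_toLp
      rw [hf0] at h2
      exact h2.symm.trans (Lp.coeFn_zero _ _ _)
    have h2 := Measure.eqOn_open_of_ae_eq h1 isOpen_Ioi hec.continuousOn continuousOn_const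
    have h3 : Tendsto m atTop (𝓝 0) := by
      refine tendsto_const_nhds.congr' ?_
      filter_upwards [eventually_gt_atTop (0 : ℝ)] with x hx
      have h4 := h2 hx
      simp only [he_def, mul_eq_zero, Complex.exp_ne_zero, or_false] at h4
      exact h4.symm
    exact zero_ne_one (tendsto_nhds_unique h3 hlim)

end Potential

/-! ### Multiplication operators -/

section MulOp

variable {α : Type*} [MeasurableSpace α] {μ : Measure α} {a b : α → ℂ}

/-- Multiplication by a bounded function on `L₂`. -/
noncomputable def mulOp (a : α → ℂ) (ha : MemLp a ∞ μ) : Lp ℂ 2 μ →L[ℂ] Lp ℂ 2 μ :=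
  (ContinuousLinearMap.mul ℂ ℂ).holderL μ ∞ 2 2 (ha.toLp a)

theorem coeFn_mulOp (ha : MemLp a ∞ μ) (f : Lp ℂ 2 μ) : mulOp a ha f =ᵐ[μ] fun x => a x * f x := by
  have h := (ContinuousLinearMap.mul ℂ ℂ).coeFn_holder (r := 2) (ha.toLp a) f
  filter_upwards [h, ha.coeFn_toLp] with x h1 h2
  refine h1.trans ?_
  rw [h2]; rfl

theorem norm_mulOp_apply_le (ha : MemLp a ∞ μ) {c : ℝ} (h : ∀ᵐ x ∂μ, ‖a x‖ ≤ c)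
    (f : Lp ℂ 2 μ) : ‖mulOp a ha f‖ ≤ c * ‖f‖ := by
  refine Lp.norm_le_mul_norm_of_ae_le_mul ?_
  filter_upwards [coeFn_mulOp ha f, h] with x h1 h2
  rw [h1, norm_mul]
  exact mul_le_mul_of_nonneg_right h2 (norm_nonneg _)

theorem norm_mulOp_le (ha : MemLp a ∞ μ) {c : ℝ} (hc : 0 ≤ c) (h : ∀ᵐ x ∂μ, ‖a x‖ ≤ c) :
    ‖mulOp a ha‖ ≤ c :=
  ContinuousLinearMap.opNorm_le_bound _ hc (norm_mulOp_apply_le ha h)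

theorem mulOp_comp (ha : MemLp a ∞ μ) (hb : MemLp b ∞ μ) {c : α → ℂ} (hc : MemLp c ∞ μ)
    (h : ∀ᵐ x ∂μ, c x = a x * b x) : mulOp c hc = (mulOp a ha).comp (mulOp b hb) := by
  ext1 f
  refine Lp.ext ?_
  filter_upwards [coeFn_mulOp hc f, coeFn_mulOp ha (mulOp b hb f), coeFn_mulOp hb f, h]
    with x h1 h2 h3 h4
  rw [ContinuousLinearMap.comp_apply, h1, h2, h3, h4, mul_assoc]

theorem adjoint_mulOp (ha : MemLp a ∞ μ) {c : α → ℂ} (hc : MemLp c ∞ μ)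
    (h : ∀ᵐ x ∂μ, c x = star (a x)) : ContinuousLinearMap.adjoint (mulOp a ha) = mulOp c hc := by
  symm
  rw [ContinuousLinearMap.eq_adjoint_iff]
  intro f g
  rw [L2.inner_def, L2.inner_def]
  refine integral_congr_ae ?_
  filter_upwards [coeFn_mulOp hc f, coeFn_mulOp ha g, h] with x h1 h2 h3
  rw [h1, h2, h3]
  simp
  ring

end MulOp

theorem integral_norm_mul_norm_le {α : Type*} [MeasurableSpace α] {μ : Measure α}
    (f g : Lp ℂ 2 μ) : Integrable (fun x => ‖f x‖ * ‖g x‖) μ ∧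
      ∫ x, ‖f x‖ * ‖g x‖ ∂μ ≤ ‖f‖ * ‖g‖ := by
  have hf := (Lp.memLp f).norm
  have hg := (Lp.memLp g).norm
  have h1 : ‖hf.toLp _‖ = ‖f‖ := by rw [Lp.norm_toLp, eLpNorm_norm, Lp.norm_def]
  have h2 : ‖hg.toLp _‖ = ‖g‖ := by rw [Lp.norm_toLp, eLpNorm_norm, Lp.norm_def]
  refine ⟨hf.integrable_mul hg, ?_⟩
  rw [← h1, ← h2]
  refine le_trans (le_of_eq ?_) (real_inner_le_norm (hf.toLp _) (hg.toLp _))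
  rw [L2.inner_def]
  refine integral_congr_ae ?_
  filter_upwards [hf.coeFn_toLp, hg.coeFn_toLp] with x h3 h4
  rw [h3, h4]
  simp [mul_comm]

/-! ### Resolvents between square roots of the potential -/

section Sandwich

variable {V : ℝ → ℂ}

theorem memLp_sqrt_norm (hVb : MemLp V ∞ (volume.restrict (Ioi (0 : ℝ)))) :
    MemLp (fun x => ((√‖V x‖ : ℝ) : ℂ)) ∞ (volume.restrict (Ioi (0 : ℝ))) := by
  obtain ⟨B, hB0, hB⟩ := ae_norm_le_of_memLp_top hVb
  refine memLp_top_of_bound ?_ (√B) ?_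
  · exact Complex.continuous_ofReal.comp_aestronglyMeasurable
      (Real.continuous_sqrt.comp_aestronglyMeasurable hVb.1.norm)
  · filter_upwards [hB] with x hx
    rw [Complex.norm_real, Real.norm_of_nonneg (Real.sqrt_nonneg _)]
    exact Real.sqrt_le_sqrt hx

/-- A uniform bound for `A (L - k²)⁻¹ A`, where `A` is multiplication by `√|V|`. -/
theorem exists_sandwich_bound (hVb : MemLp V ∞ (volume.restrict (Ioi (0 : ℝ))))
    (hVx : IntegrableOn (fun x : ℝ => x * ‖V x‖) (Ioi 0)) {V' : ℝ → ℂ} {M : ℝ} (hM : 0 ≤ M)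
    (hbound : ∀ k : ℂ, 0 < k.im → ∀ f g : HalfLineL2,
      (f, g + k ^ 2 • f) ∈ schrodingerGraph V' →
      IntegrableOn (fun s : ℝ => √s * ‖g s‖) (Ioi 0) →
      ∀ᵐ x ∂(volume.restrict (Ioi (0 : ℝ))), ‖f x‖ ≤ M * (√x * ∫ s in Ioi 0, √s * ‖g s‖)) :
    ∃ M' : ℝ, 0 ≤ M' ∧ ∀ k : ℂ, 0 < k.im → ∀ f h : HalfLineL2,
      (f, mulOp _ (memLp_sqrt_norm hVb) h + k ^ 2 • f) ∈ schrodingerGraph V' →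
      ‖mulOp _ (memLp_sqrt_norm hVb) f‖ ≤ M' * ‖h‖ := by
  -- The first moment of `V` is the squared norm of this function. The sandwiched kernel is bounded
  -- by a multiple of the product of its values at `x` and `s`, hence of Hilbert-Schmidt size. The
  -- potential of the resolvent is kept separate so that the free operator is covered too.
  have hwL : MemLp (fun x : ℝ => ((√(x * ‖V x‖) : ℝ) : ℂ)) 2 (volume.restrict (Ioi (0 : ℝ))) := by
    have hm : AEStronglyMeasurable (fun x : ℝ => ((√(x * ‖V x‖) : ℝ) : ℂ))
        (volume.restrict (Ioi (0 : ℝ))) := Complex.continuous_ofReal.comp_aestronglyMeasurable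
      (Real.continuous_sqrt.comp_aestronglyMeasurable hVx.1)
    rw [memLp_two_iff_integrable_sq_norm hm]
    refine hVx.congr ?_
    filter_upwards [ae_restrict_mem measurableSet_Ioi] with x hx
    have hx0 : (0 : ℝ) < x := hx
    rw [Complex.norm_real, Real.norm_of_nonneg (Real.sqrt_nonneg _), Real.sq_sqrt (by positivity)]
  set w : HalfLineL2 := hwL.toLp _ with hw
  have hwx : ∀ᵐ x ∂(volume.restrict (Ioi (0 : ℝ))), ‖w x‖ = √x * √‖V x‖ := by
    filter_upwards [hwL.coeFn_toLp, ae_restrict_mem measurableSet_Ioi] with x h1 h2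
    rw [hw, h1, Complex.norm_real, Real.norm_of_nonneg (Real.sqrt_nonneg _),
      Real.sqrt_mul (le_of_lt h2)]
  refine ⟨M * (‖w‖ * ‖w‖), by positivity, fun k hk f h hfg => ?_⟩
  set g := mulOp _ (memLp_sqrt_norm hVb) h with hg
  have hgw : (fun s : ℝ => √s * ‖g s‖) =ᵐ[volume.restrict (Ioi (0 : ℝ))]
      fun s => ‖w s‖ * ‖h s‖ := by
    filter_upwards [hwx, coeFn_mulOp (memLp_sqrt_norm hVb) h] with s h1 h2
    rw [hg, h2, h1, norm_mul, Complex.norm_real, Real.norm_of_nonneg (Real.sqrt_nonneg _)]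
    ring
  obtain ⟨hint, hle⟩ := integral_norm_mul_norm_le w h
  have hb := hbound k hk f g hfg (hint.congr hgw.symm)
  have hJ : ∫ s in Ioi 0, √s * ‖g s‖ ≤ ‖w‖ * ‖h‖ := by rwa [integral_congr_ae hgw]
  have : ‖mulOp _ (memLp_sqrt_norm hVb) f‖ ≤ M * (‖w‖ * ‖h‖) * ‖w‖ := by
    refine Lp.norm_le_mul_norm_of_ae_le_mul ?_
    filter_upwards [hb, hwx, coeFn_mulOp (memLp_sqrt_norm hVb) f] with x h1 h2 h3
    rw [h3, h2, norm_mul, Complex.norm_real, Real.norm_of_nonneg (Real.sqrt_nonneg _)]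
    calc √‖V x‖ * ‖f x‖ ≤ √‖V x‖ * (M * (√x * (‖w‖ * ‖h‖))) := by
          gcongr
          exact h1.trans (by gcongr)
      _ = _ := by ring
  linarith

end Sandwich

/-! ### Plancherel's theorem for integrable vector-valued functions -/

section Plancherel

open FourierTransform SchwartzMap

variable {H : Type*} [NormedAddCommGroup H] [InnerProductSpace ℂ H]

theorem continuous_fourier_of_integrable {u : ℝ → H} (hu : Integrable u) : Continuous (𝓕 u) :=
  VectorFourier.fourierIntegral_continuous (L := innerₗ ℝ) Real.continuous_fourierChar
    continuous_inner hu

variable [CompleteSpace H]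

/-- The transform on `L²` and the integral agree as distributions: tested against smooth compactly
supported functions, both move the transform onto the test function. -/
theorem coeFn_fourier_toLp {u : ℝ → H} (hu : Integrable u) (hu2 : MemLp u 2 volume) :
    (𝓕 (hu2.toLp u) : Lp H 2 (volume : Measure ℝ)) =ᵐ[volume] 𝓕 u := by
  refine ae_eq_of_integral_contDiff_smul_eq
    ((Lp.memLp _).locallyIntegrable (by norm_num))
    (continuous_fourier_of_integrable hu).locallyIntegrable fun g hg hgc => ?_
  have hgc' : HasCompactSupport fun x => (g x : ℂ) :=
    hgc.comp_left (g := fun x : ℝ => (x : ℂ)) Complex.ofReal_zero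
  have hg' : ContDiff ℝ (⊤ : ℕ∞) fun x => (g x : ℂ) :=
    Complex.ofRealCLM.contDiff.comp hg
  set G : 𝓢(ℝ, ℂ) := hgc'.toSchwartzMap hg' with hG
  have hGx : ∀ x, G x = g x := fun x => rfl
  have h1 := congrArg (fun T => T G) (Lp.fourier_toTemperedDistribution_eq (hu2.toLp u))
  simp only [TemperedDistribution.fourier_apply, Lp.toTemperedDistribution_apply] at h1
  have h2 : ∫ x, g x • (𝓕 (hu2.toLp u) : Lp H 2 (volume : Measure ℝ)) x =
      ∫ x, G x • (𝓕 (hu2.toLp u) : Lp H 2 (volume : Measure ℝ)) x := by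
    simp only [hGx, Complex.coe_smul]
  have h3 : ∫ x, g x • 𝓕 u x = ∫ x, G x • 𝓕 u x := by
    simp only [hGx, Complex.coe_smul]
  rw [h2, h3, ← h1]
  have h4 : ∫ x, (𝓕 G) x • (hu2.toLp u) x = ∫ x, (𝓕 G) x • u x := by
    refine integral_congr_ae ?_
    filter_upwards [hu2.coeFn_toLp] with x hx
    rw [hx]
  rw [h4]
  simpa using! VectorFourier.integral_fourierIntegral_smul_eq_flip (L := innerₗ ℝ)
    Real.continuous_fourierChar continuous_inner G.integrable hu

/-- Plancherel's theorem for functions that are integrable and square integrable. -/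
theorem lintegral_enorm_fourier_sq {u : ℝ → H} (hu : Integrable u) (hu2 : MemLp u 2 volume) :
    ∫⁻ x, ‖𝓕 u x‖ₑ ^ 2 = ∫⁻ x, ‖u x‖ₑ ^ 2 := by
  have h1 : ∀ v : Lp H 2 (volume : Measure ℝ), ∫⁻ x, ‖v x‖ₑ ^ 2 = ‖v‖ₑ ^ 2 := by
    intro v
    rw [Lp.enorm_def, eLpNorm_eq_lintegral_rpow_enorm_toReal (by norm_num) (by norm_num)]
    simp only [ENNReal.toReal_ofNat, ENNReal.rpow_ofNat, one_div]
    rw [← ENNReal.rpow_ofNat, ← ENNReal.rpow_mul]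
    simp
  have h2 := h1 (𝓕 (hu2.toLp u))
  have h3 := h1 (hu2.toLp u)
  have h4 : ‖(𝓕 (hu2.toLp u) : Lp H 2 (volume : Measure ℝ))‖ₑ = ‖hu2.toLp u‖ₑ := by
    rw [← ofReal_norm, ← ofReal_norm, Lp.norm_fourier_eq]
  rw [h4, ← h3] at h2
  calc ∫⁻ x, ‖𝓕 u x‖ₑ ^ 2
      = ∫⁻ x, ‖(𝓕 (hu2.toLp u) : Lp H 2 (volume : Measure ℝ)) x‖ₑ ^ 2 := by
        refine lintegral_congr_ae ?_
        filter_upwards [coeFn_fourier_toLp hu hu2] with x hx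
        rw [hx]
    _ = ∫⁻ x, ‖(hu2.toLp u) x‖ₑ ^ 2 := h2
    _ = ∫⁻ x, ‖u x‖ₑ ^ 2 := by
        refine lintegral_congr_ae ?_
        filter_upwards [hu2.coeFn_toLp] with x hx
        rw [hx]

end Plancherel

/-! ### One-parameter groups and their Laplace transforms -/

section Group

variable {H : Type*} [NormedAddCommGroup H] [InnerProductSpace ℂ H]

/-- A strongly continuous one-parameter group of bounded operators. -/
structure IsC0Group (U : ℝ → H →L[ℂ] H) : Prop where
  zero : U 0 = ContinuousLinearMap.id ℂ H
  add : ∀ s t : ℝ, U (s + t) = (U s).comp (U t)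
  continuous : ∀ f : H, Continuous fun t => U t f

/-- The infinitesimal generator of `U` maps `f` to `g`. -/
def HasGenerator (U : ℝ → H →L[ℂ] H) (f g : H) : Prop :=
  Tendsto (fun t : ℝ => (t : ℂ)⁻¹ • (U t f - f)) (𝓝[≠] 0) (𝓝 g)

/-- The operators `U t`, `t ≥ 0`, grow at most like `e^{ωt}`. -/
def HasGrowth (U : ℝ → H →L[ℂ] H) (ω : ℝ) : Prop :=
  ∃ K : ℝ, ∀ t : ℝ, 0 ≤ t → ‖U t‖ ≤ K * Real.exp (ω * t)

/-- The Laplace transform of a one-parameter group, with junk value zero if it does not exist. -/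
noncomputable def laplaceTransform (U : ℝ → H →L[ℂ] H) (p : ℂ) : H →L[ℂ] H :=
  open Classical in
  if h : ∃ R : H →L[ℂ] H, ∀ f, R f = ∫ t in Ioi (0 : ℝ), Complex.exp (-p * t) • U t f then
    h.choose else 0

variable {U : ℝ → H →L[ℂ] H} {ω : ℝ} {p : ℂ}

theorem HasGrowth.exists_nonneg (h : HasGrowth U ω) :
    ∃ K : ℝ, 0 ≤ K ∧ ∀ t : ℝ, 0 ≤ t → ‖U t‖ ≤ K * Real.exp (ω * t) := by
  obtain ⟨K, hK⟩ := h
  refine ⟨|K|, abs_nonneg K, fun t ht => (hK t ht).trans ?_⟩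
  gcongr
  exact le_abs_self K

theorem HasGenerator.unique {f g g' : H} (h : HasGenerator U f g) (h' : HasGenerator U f g') :
    g = g' :=
  tendsto_nhds_unique h h'

theorem HasGenerator.neg {f g : H} (h : HasGenerator U f g) :
    HasGenerator (fun t => U (-t)) f (-g) := by
  have h1 : Tendsto (fun t : ℝ => -t) (𝓝[≠] 0) (𝓝[≠] 0) := by
    refine tendsto_nhdsWithin_iff.2 ⟨?_, ?_⟩
    · have : Tendsto (fun t : ℝ => -t) (𝓝 0) (𝓝 (-0)) := continuous_neg.tendsto 0
      rw [neg_zero] at this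
      exact this.mono_left nhdsWithin_le_nhds
    · filter_upwards [self_mem_nhdsWithin] with t ht
      simpa using ht
  have h2 := (Tendsto.comp h h1).neg
  refine h2.congr fun t => ?_
  simp only [Function.comp_apply, Complex.ofReal_neg, inv_neg, neg_smul, neg_neg]

theorem hasGenerator_neg_iff {f g : H} :
    HasGenerator (fun t => U (-t)) f (-g) ↔ HasGenerator U f g := by
  refine ⟨fun h => ?_, fun h => h.neg⟩
  simpa using h.neg

namespace IsC0Group

theorem neg (hU : IsC0Group U) : IsC0Group fun t => U (-t) where
  zero := by simp [hU.zero]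
  add s t := by rw [neg_add, hU.add]
  continuous f := (hU.continuous f).comp continuous_neg

theorem apply_add (hU : IsC0Group U) (s t : ℝ) (f : H) : U (s + t) f = U s (U t f) := by
  rw [hU.add]; rfl

theorem apply_zero (hU : IsC0Group U) (f : H) : U 0 f = f := by rw [hU.zero]; rfl

theorem apply_comm (hU : IsC0Group U) (s t : ℝ) (f : H) : U s (U t f) = U t (U s f) := by
  rw [← hU.apply_add, ← hU.apply_add, add_comm]

theorem apply_neg_apply (hU : IsC0Group U) (t : ℝ) (f : H) : U (-t) (U t f) = f := by
  rw [← hU.apply_add, neg_add_cancel, hU.apply_zero]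

theorem apply_apply_neg (hU : IsC0Group U) (t : ℝ) (f : H) : U t (U (-t) f) = f := by
  rw [← hU.apply_add, add_neg_cancel, hU.apply_zero]

theorem integrableOn_exp_smul (hU : IsC0Group U) (hω : HasGrowth U ω) (hp : ω < p.re) (f : H) :
    IntegrableOn (fun t : ℝ => Complex.exp (-p * t) • U t f) (Ioi 0) := by
  obtain ⟨K, hK0, hK⟩ := hω.exists_nonneg
  have h1 : IntegrableOn (fun t : ℝ => K * ‖f‖ * Real.exp (-(p.re - ω) * t)) (Ioi 0) :=
    (exp_neg_integrableOn_Ioi 0 (sub_pos.2 hp)).const_mul _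
  refine Integrable.mono' h1 ?_ ?_
  · have := hU.continuous f
    exact Continuous.aestronglyMeasurable (by fun_prop)
  · filter_upwards [ae_restrict_mem measurableSet_Ioi] with t ht
    rw [norm_smul, Complex.norm_exp]
    have h2 : (-p * t).re = -p.re * t := by simp
    have h3 : Real.exp (-(p.re - ω) * t) = Real.exp (-p.re * t) * Real.exp (ω * t) := by
      rw [← Real.exp_add]; ring_nf
    rw [h2, h3]
    calc Real.exp (-p.re * t) * ‖U t f‖ ≤ Real.exp (-p.re * t) * (K * Real.exp (ω * t) * ‖f‖) := by
          gcongr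
          exact (U t).le_of_opNorm_le (hK t (le_of_lt ht)) f
      _ = _ := by ring

theorem laplaceTransform_apply (hU : IsC0Group U) (hω : HasGrowth U ω) (hp : ω < p.re) (f : H) :
    laplaceTransform U p f = ∫ t in Ioi (0 : ℝ), Complex.exp (-p * t) • U t f := by
  have hex : ∃ R : H →L[ℂ] H, ∀ f, R f = ∫ t in Ioi (0 : ℝ), Complex.exp (-p * t) • U t f := by
    obtain ⟨K, hK0, hK⟩ := hω.exists_nonneg
    have hint := hU.integrableOn_exp_smul hω hp
    refine ⟨LinearMap.mkContinuous ⟨⟨fun f => ∫ t in Ioi (0 : ℝ), Complex.exp (-p * t) • U t f,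
      fun f g => ?_⟩, fun c f => ?_⟩
      (K * ∫ t in Ioi (0 : ℝ), Real.exp (-(p.re - ω) * t)) fun f => ?_, fun f => rfl⟩
    · rw [← integral_add (hint f) (hint g)]
      simp only [map_add, smul_add]
    · rw [RingHom.id_apply, ← integral_smul]
      simp only [map_smul, smul_comm c]
    · have h1 : IntegrableOn (fun t : ℝ => K * ‖f‖ * Real.exp (-(p.re - ω) * t)) (Ioi 0) :=
        (exp_neg_integrableOn_Ioi 0 (sub_pos.2 hp)).const_mul _
      have h2 := norm_integral_le_of_norm_le (f := fun t : ℝ => Complex.exp (-p * t) • U t f) h1 (by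
        filter_upwards [ae_restrict_mem measurableSet_Ioi] with t ht
        rw [norm_smul, Complex.norm_exp]
        have h2 : (-p * t).re = -p.re * t := by simp
        have h3 : Real.exp (-(p.re - ω) * t) = Real.exp (-p.re * t) * Real.exp (ω * t) := by
          rw [← Real.exp_add]; ring_nf
        rw [h2, h3]
        calc Real.exp (-p.re * t) * ‖U t f‖
            ≤ Real.exp (-p.re * t) * (K * Real.exp (ω * t) * ‖f‖) := by
              gcongr
              exact (U t).le_of_opNorm_le (hK t (le_of_lt ht)) f
          _ = _ := by ring)
      rw [integral_const_mul] at h2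
      refine h2.trans (le_of_eq ?_)
      ring
  rw [laplaceTransform, dif_pos hex]
  exact hex.choose_spec f

variable [CompleteSpace H]

theorem apply_laplaceTransform (hU : IsC0Group U) (hω : HasGrowth U ω) (hp : ω < p.re) (h : ℝ)
    (f : H) : U h (laplaceTransform U p f) = laplaceTransform U p (U h f) := by
  rw [hU.laplaceTransform_apply hω hp, hU.laplaceTransform_apply hω hp,
    ← ContinuousLinearMap.integral_comp_comm _ (hU.integrableOn_exp_smul hω hp f)]
  simp only [map_smul, hU.apply_comm h]

/-- A shift of the integration variable gives `U(h) R = e^{ph} (R - ∫₀^h e^{-pt} U(t) f dt)`, which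
is differentiated at `h = 0`. Thus the Laplace transform is a right inverse of `p` minus the
generator. -/
theorem hasGenerator_laplaceTransform (hU : IsC0Group U) (hω : HasGrowth U ω) (hp : ω < p.re)
    (f : H) : HasGenerator U (laplaceTransform U p f) (p • laplaceTransform U p f - f) := by
  set R := laplaceTransform U p f with hR
  have hint := hU.integrableOn_exp_smul hω hp f
  have hcont : Continuous fun t : ℝ => Complex.exp (-p * t) • U t f := by
    have := hU.continuous f
    fun_prop
  have hkey : ∀ h : ℝ, U h R = Complex.exp (p * h) •
      (R - ∫ t in (0 : ℝ)..h, Complex.exp (-p * t) • U t f) := by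
    intro h
    have h1 : ∀ t : ℝ, Complex.exp (-p * t) • U t (U h f) =
        Complex.exp (p * h) • (Complex.exp (-p * (t + h : ℝ)) • U (t + h) f) := by
      intro t
      rw [hU.apply_add, smul_smul, ← Complex.exp_add]
      congr 2
      push_cast; ring
    rw [hR, hU.apply_laplaceTransform hω hp, hU.laplaceTransform_apply hω hp,
      hU.laplaceTransform_apply hω hp]
    simp_rw [h1]
    rw [integral_smul]
    congr 1
    have h2 : ∫ t in Ioi (0 : ℝ), Complex.exp (-p * (t + h : ℝ)) • U (t + h) f =
        ∫ t in Ioi h, Complex.exp (-p * t) • U t f := by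
      have := (measurePreserving_add_right volume h).setIntegral_preimage_emb
        (measurableEmbedding_addRight h) (fun t : ℝ => Complex.exp (-p * t) • U t f) (Ioi h)
      rwa [preimage_add_const_Ioi, sub_self] at this
    rw [h2, eq_sub_iff_add_eq, add_comm]
    refine intervalIntegral.integral_interval_add_Ioi' (hcont.intervalIntegrable _ _) ?_
    -- The derivative is two-sided, so negative shifts must be admitted; they only add a compact
    -- interval.
    rcases le_total 0 h with h0 | h0
    · exact hint.mono_set (Ioi_subset_Ioi h0)
    · rw [← Ioc_union_Ioi_eq_Ioi h0]
      exact ((hcont.intervalIntegrable h 0).1).union hint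
  have hd : HasDerivAt (fun h : ℝ => U h R) (p • R - f) 0 := by
    have h1 : HasDerivAt (fun h : ℝ => Complex.exp (p * h)) p 0 := by
      simpa using ((hasDerivAt_id ((0 : ℝ) : ℂ)).const_mul p).cexp.comp_ofReal
    have h2 : HasDerivAt (fun h : ℝ => R - ∫ t in (0 : ℝ)..h, Complex.exp (-p * t) • U t f)
        (-f) 0 := by
      have := (hcont.integral_hasStrictDerivAt 0 0).hasDerivAt.const_sub R
      simpa [hU.apply_zero] using this
    have h3 := h1.smul h2
    simp only [Complex.ofReal_zero, mul_zero, Complex.exp_zero, one_smul,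
      intervalIntegral.integral_same, sub_zero] at h3
    refine (h3.congr_of_eventuallyEq (Eventually.of_forall hkey)).congr_deriv ?_
    abel
  rw [hasDerivAt_iff_tendsto_slope_zero] at hd
  refine hd.congr fun t => ?_
  rw [zero_add, hU.apply_zero, ← Complex.ofReal_inv, Complex.coe_smul]

/-- The Laplace transform commutes with the group, hence with its generator, so the right inverse is
also a left inverse. -/
theorem laplaceTransform_sub_of_hasGenerator (hU : IsC0Group U) (hω : HasGrowth U ω)
    (hp : ω < p.re) {f g : H} (h : HasGenerator U f g) :
    laplaceTransform U p (p • f - g) = f := by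
  have h1 := hU.hasGenerator_laplaceTransform hω hp f
  have h2 : HasGenerator U (laplaceTransform U p f) (laplaceTransform U p g) := by
    refine (((laplaceTransform U p).continuous.tendsto g).comp h).congr fun t => ?_
    simp only [Function.comp_apply, map_smul, map_sub, hU.apply_laplaceTransform hω hp]
  have h3 := h1.unique h2
  rw [map_sub, map_smul, ← h3]
  abel

theorem adjoint_laplaceTransform (hU : IsC0Group U) (hω : HasGrowth U ω) (hp : ω < p.re)
    {U' : ℝ → H →L[ℂ] H} (hU' : IsC0Group U')
    (had : ∀ t, 0 ≤ t → U' t = ContinuousLinearMap.adjoint (U t)) :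
    ContinuousLinearMap.adjoint (laplaceTransform U p) = laplaceTransform U' (star p) := by
  have hω' : HasGrowth U' ω := by
    obtain ⟨K, hK⟩ := hω
    refine ⟨K, fun t ht => ?_⟩
    rw [had t ht, LinearIsometryEquiv.norm_map]
    exact hK t ht
  have hp' : ω < (star p).re := by simpa using hp
  symm
  rw [ContinuousLinearMap.eq_adjoint_iff]
  intro f g
  rw [hU.laplaceTransform_apply hω hp, hU'.laplaceTransform_apply hω' hp',
    ← integral_inner (hU.integrableOn_exp_smul hω hp g), ← inner_conj_symm,
    ← integral_inner (hU'.integrableOn_exp_smul hω' hp' f), ← integral_conj]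
  refine setIntegral_congr_fun measurableSet_Ioi fun t ht => ?_
  rw [inner_conj_symm, inner_smul_left, inner_smul_right, had t (le_of_lt ht),
    ContinuousLinearMap.adjoint_inner_left]
  congr 1
  rw [← Complex.exp_conj]
  simp

end IsC0Group

end Group

/-! ### Linear evolution equations with bounded coefficients -/

section Evolution

variable {H : Type*} [NormedAddCommGroup H] [InnerProductSpace ℂ H] {A : ℝ → H →L[ℂ] H} {b : ℝ}

/-- A uniform operator bound upgrades strong continuity to joint continuity in time and vector. -/
theorem continuous_apply_of_strongly_continuous (hA : ∀ f, Continuous fun t => A t f)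
    (hb : ∀ t, ‖A t‖ ≤ b) {v : ℝ → H} (hv : Continuous v) : Continuous fun t => A t (v t) := by
  have hb0 : 0 ≤ b := (norm_nonneg _).trans (hb 0)
  have h1 : Continuous fun q : H × ℝ => A q.2 q.1 := by
    refine continuous_prod_of_continuous_lipschitzWith _ b.toNNReal (fun f => hA f) fun t => ?_
    refine (A t).lipschitz.weaken ?_
    rw [← NNReal.coe_le_coe, coe_nnnorm, Real.coe_toNNReal _ hb0]
    exact hb t
  exact h1.comp (hv.prodMk continuous_id)

theorem evolution_unique (hb : ∀ t, ‖A t‖ ≤ b) {v w : ℝ → H}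
    (hv : ∀ t, HasDerivAt v (A t (v t)) t) (hw : ∀ t, HasDerivAt w (A t (w t)) t)
    (h0 : v 0 = w 0) : v = w := by
  have hb0 : 0 ≤ b := (norm_nonneg _).trans (hb 0)
  refine ODE_solution_unique_univ (v := fun t x => A t x) (s := fun _ => univ) (K := b.toNNReal)
    (t₀ := 0) (fun t => ?_) (fun t => ⟨hv t, mem_univ _⟩) (fun t => ⟨hw t, mem_univ _⟩) h0
  refine ((A t).lipschitz.weaken ?_).lipschitzOnWith
  rw [← NNReal.coe_le_coe, coe_nnnorm, Real.coe_toNNReal _ hb0]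
  exact hb t

variable [CompleteSpace H]

theorem abs_integral_cosh_le {c : ℝ} (hc : 0 < c) (t : ℝ) :
    |∫ s in (0 : ℝ)..t, Real.cosh (c * s)| ≤ c⁻¹ * Real.cosh (c * t) := by
  have h : ∫ s in (0 : ℝ)..t, Real.cosh (c * s) = c⁻¹ * Real.sinh (c * t) := by
    rw [intervalIntegral.integral_comp_mul_left (fun s => Real.cosh s) hc.ne',
      intervalIntegral.integral_eq_sub_of_hasDerivAt (f := Real.sinh)
        (fun x _ => Real.hasDerivAt_sinh x) (Real.continuous_cosh.intervalIntegrable _ _)]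
    simp
  rw [h, abs_mul, abs_of_pos (inv_pos.2 hc), Real.abs_sinh, ← Real.cosh_abs (c * t)]
  gcongr
  exact (Real.sinh_lt_cosh _).le

/-- Picard iteration on the whole line at once, as a contraction in a space weighted by `cosh`, an
even weight that serves both time directions. -/
theorem exists_evolution_apply (hA : ∀ f, Continuous fun t => A t f) (hb : ∀ t, ‖A t‖ ≤ b)
    (f : H) : ∃ w : ℝ → H, w 0 = f ∧ (∀ t, HasDerivAt w (A t (w t)) t) ∧
      ∀ t, ‖w t‖ ≤ 2 * Real.cosh ((2 * b + 1) * t) * ‖f‖ := by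
  have hb0 : 0 ≤ b := (norm_nonneg _).trans (hb 0)
  -- Any positive rate with `b / c ≤ 1/2` would do; the summand `1` covers `b = 0`.
  set c := 2 * b + 1 with hc
  have hc0 : 0 < c := by positivity
  have hpos : ∀ t, 0 < Real.cosh (c * t) := fun t => Real.cosh_pos _
  have hcosh : Continuous fun t => Real.cosh (c * t) :=
    Real.continuous_cosh.comp (by fun_prop)
  have hgc : ∀ n : ℝ →ᵇ H, Continuous fun s => Real.cosh (c * s) • A s (n s) := fun n =>
    hcosh.smul (continuous_apply_of_strongly_continuous hA hb n.continuous)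
  have hΛc : ∀ n : ℝ →ᵇ H, Continuous fun t =>
      (Real.cosh (c * t))⁻¹ • ∫ s in (0 : ℝ)..t, Real.cosh (c * s) • A s (n s) := by
    intro n
    have h1 : Continuous fun t => ∫ s in (0 : ℝ)..t, Real.cosh (c * s) • A s (n s) :=
      intervalIntegral.continuous_primitive (fun a b => (hgc n).intervalIntegrable a b) 0
    exact (hcosh.inv₀ fun t => (hpos t).ne').smul h1
  have hΛb : ∀ (n : ℝ →ᵇ H) (t : ℝ),
      ‖(Real.cosh (c * t))⁻¹ • ∫ s in (0 : ℝ)..t, Real.cosh (c * s) • A s (n s)‖ ≤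
        1 / 2 * ‖n‖ := by
    intro n t
    have h1 : ‖∫ s in (0 : ℝ)..t, Real.cosh (c * s) • A s (n s)‖ ≤
        |∫ s in (0 : ℝ)..t, Real.cosh (c * s) * (b * ‖n‖)| := by
      refine intervalIntegral.norm_integral_le_abs_of_norm_le (Eventually.of_forall fun s => ?_)
        (Continuous.intervalIntegrable (by fun_prop) _ _)
      rw [norm_smul, Real.norm_of_nonneg (hpos s).le]
      gcongr
      exact ((A s).le_of_opNorm_le (hb s) _).trans (by gcongr; exact n.norm_coe_le_norm s)
    rw [intervalIntegral.integral_mul_const, abs_mul, abs_of_nonneg (a := b * ‖n‖) (by positivity)]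
      at h1
    rw [norm_smul, norm_inv, Real.norm_of_nonneg (hpos t).le, inv_mul_le_iff₀ (hpos t)]
    refine h1.trans ?_
    have h2 := abs_integral_cosh_le hc0 t
    calc _ ≤ c⁻¹ * Real.cosh (c * t) * (b * ‖n‖) := by gcongr
      _ = Real.cosh (c * t) * (c⁻¹ * b * ‖n‖) := by ring
      _ ≤ _ := by
        have h3 : c⁻¹ * b ≤ 1 / 2 := by
          rw [inv_mul_le_iff₀ hc0]; linarith
        gcongr
  let Λ : (ℝ →ᵇ H) → (ℝ →ᵇ H) := fun n =>
    BoundedContinuousFunction.ofNormedAddCommGroup _ (hΛc n) (1 / 2 * ‖n‖) (hΛb n)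
  have hΛ : ∀ n t, Λ n t =
    (Real.cosh (c * t))⁻¹ • ∫ s in (0 : ℝ)..t, Real.cosh (c * s) • A s (n s) := fun _ _ => rfl
  have hn₀ : ∀ t, ‖(Real.cosh (c * t))⁻¹ • f‖ ≤ ‖f‖ := by
    intro t
    rw [norm_smul, norm_inv, Real.norm_of_nonneg (hpos t).le, inv_mul_le_iff₀ (hpos t)]
    exact le_mul_of_one_le_left (norm_nonneg _) (Real.one_le_cosh _)
  let n₀ : ℝ →ᵇ H := BoundedContinuousFunction.ofNormedAddCommGroup
    (fun t => (Real.cosh (c * t))⁻¹ • f)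
    ((hcosh.inv₀ fun t => (hpos t).ne').smul continuous_const) ‖f‖ hn₀
  have hn₀n : ‖n₀‖ ≤ ‖f‖ := (BoundedContinuousFunction.norm_le (norm_nonneg _)).2 hn₀
  have hcontr : ContractingWith (1 / 2) fun n => n₀ + Λ n := by
    refine ⟨by norm_num, LipschitzWith.of_dist_le_mul fun n n' => ?_⟩
    rw [dist_add_left, dist_eq_norm]
    have h2 : Λ n - Λ n' = Λ (n - n') := by
      ext t
      rw [BoundedContinuousFunction.sub_apply, hΛ, hΛ, hΛ, ← smul_sub,
        ← intervalIntegral.integral_sub ((hgc n).intervalIntegrable _ _)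
          ((hgc n').intervalIntegrable _ _)]
      simp only [BoundedContinuousFunction.sub_apply, map_sub, smul_sub]
    rw [h2, dist_eq_norm]
    refine (BoundedContinuousFunction.norm_le (by positivity)).2 fun t => ?_
    rw [show ((1 / 2 : NNReal) : ℝ) = 1 / 2 by norm_num]
    exact hΛb (n - n') t
  have hfix : n₀ + Λ (ContractingWith.fixedPoint _ hcontr) = ContractingWith.fixedPoint _ hcontr :=
    hcontr.fixedPoint_isFixedPt
  generalize ContractingWith.fixedPoint _ hcontr = n at hfix
  have hnn : ‖n‖ ≤ 2 * ‖f‖ := by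
    have h1 : ‖Λ n‖ ≤ 1 / 2 * ‖n‖ :=
      (BoundedContinuousFunction.norm_le (by positivity)).2 fun t => hΛb n t
    have h2 : ‖n‖ ≤ ‖n₀‖ + ‖Λ n‖ := by
      conv_lhs => rw [← hfix]
      exact norm_add_le _ _
    linarith
  have hn : ∀ t, Real.cosh (c * t) • n t =
      f + ∫ s in (0 : ℝ)..t, A s (Real.cosh (c * s) • n s) := by
    intro t
    conv_lhs => rw [← hfix]
    rw [BoundedContinuousFunction.add_apply, hΛ, smul_add, smul_inv_smul₀ (hpos t).ne']
    simp only [ContinuousLinearMap.map_smul_of_tower]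
    congr 1
    exact smul_inv_smul₀ (hpos t).ne' f
  refine ⟨fun t => Real.cosh (c * t) • n t, ?_, fun t => ?_, fun t => ?_⟩
  · beta_reduce
    rw [hn 0, intervalIntegral.integral_same, add_zero]
  · have h1 : Continuous fun s => A s (Real.cosh (c * s) • n s) :=
      continuous_apply_of_strongly_continuous hA hb (hcosh.smul n.continuous)
    exact ((h1.integral_hasStrictDerivAt 0 t).hasDerivAt.const_add f).congr_of_eventuallyEq
      (Eventually.of_forall hn)
  · beta_reduce
    rw [norm_smul, Real.norm_of_nonneg (hpos t).le]
    calc Real.cosh (c * t) * ‖n t‖ ≤ Real.cosh (c * t) * (2 * ‖f‖) := by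
          gcongr
          exact (n.norm_coe_le_norm t).trans hnn
      _ = _ := by ring

/-- The solution operators of `w' = A(t) w`. -/
theorem exists_evolution (hA : ∀ f, Continuous fun t => A t f) (hb : ∀ t, ‖A t‖ ≤ b) :
    ∃ W : ℝ → H →L[ℂ] H, (∀ f, W 0 f = f) ∧ (∀ f t, HasDerivAt (fun t => W t f) (A t (W t f)) t) ∧
      ∀ t, ‖W t‖ ≤ 2 * Real.exp ((2 * b + 1) * |t|) := by
  have hb0 : 0 ≤ b := (norm_nonneg _).trans (hb 0)
  choose w h0 hd hn using exists_evolution_apply hA hb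
  have hadd : ∀ f g, w (f + g) = w f + w g := fun f g =>
    evolution_unique hb (hd _) (fun t => by
      rw [Pi.add_apply, map_add]; exact (hd f t).add (hd g t)) (by simp [h0])
  have hsmul : ∀ (z : ℂ) f, w (z • f) = z • w f := fun z f =>
    evolution_unique hb (hd _) (fun t => by
      rw [Pi.smul_apply, map_smul]; exact (hd f t).const_smul z) (by simp [h0])
  refine ⟨fun t => LinearMap.mkContinuous ⟨⟨fun f => w f t, fun f g => congrFun (hadd f g) t⟩,
    fun z f => congrFun (hsmul z f) t⟩ _ fun f => hn f t, h0, hd, fun t => ?_⟩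
  refine ContinuousLinearMap.opNorm_le_bound _ (by positivity) fun f => (hn f t).trans ?_
  gcongr
  rw [← Real.cosh_abs, abs_mul, abs_of_pos (show 0 < 2 * b + 1 by positivity)]
  rw [Real.cosh_eq]
  have := Real.exp_le_exp.2 (show -((2 * b + 1) * |t|) ≤ (2 * b + 1) * |t| by
    have : 0 ≤ (2 * b + 1) * |t| := by positivity
    linarith)
  linarith

end Evolution

/-! ### Bounded perturbations of unitary groups -/

section Perturbation

variable {H : Type*} [NormedAddCommGroup H] [InnerProductSpace ℂ H] {U₀ U U' : ℝ → H →L[ℂ] H}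
  {B B' : H →L[ℂ] H}

/-- `U` is the one-parameter group generated by the sum of the generator of `U₀` and of `B`. -/
def IsPerturbation (U₀ U : ℝ → H →L[ℂ] H) (B : H →L[ℂ] H) : Prop :=
  ∀ f t, HasDerivAt (fun t => U₀ (-t) (U t f)) (U₀ (-t) (B (U t f))) t

theorem IsPerturbation.neg (h : IsPerturbation U₀ U B) :
    IsPerturbation (fun t => U₀ (-t)) (fun t => U (-t)) (-B) := by
  intro f t
  have := (h f (-t)).scomp t (hasDerivAt_neg t)
  refine this.congr_deriv ?_
  simp

theorem inner_apply_of_isometric (hiso : ∀ t f, ‖U₀ t f‖ = ‖f‖) (t : ℝ) (f g : H) :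
    inner ℂ (U₀ t f) (U₀ t g) = inner ℂ f g :=
  LinearIsometry.inner_map_map ⟨(U₀ t).toLinearMap, hiso t⟩ f g

/-- Groups generated by a perturbation and by its negative adjoint are in duality. -/
theorem IsPerturbation.inner_apply_apply (h : IsPerturbation U₀ U B) (h' : IsPerturbation U₀ U' B')
    (hU : IsC0Group U) (hU' : IsC0Group U') (hiso : ∀ t f, ‖U₀ t f‖ = ‖f‖)
    (hB : ∀ f g, inner ℂ (B f) g + inner ℂ f (B' g) = 0) (t : ℝ) (f g : H) :
    inner ℂ (U t f) (U' t g) = inner ℂ f g := by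
  have h1 : ∀ t, HasDerivAt (fun t => inner ℂ (U₀ (-t) (U t f)) (U₀ (-t) (U' t g))) 0 t := by
    intro t
    refine ((h f t).inner ℂ (h' g t)).congr_deriv ?_
    rw [inner_apply_of_isometric hiso, inner_apply_of_isometric hiso, add_comm, hB]
  have h2 := is_const_of_deriv_eq_zero (fun t => (h1 t).differentiableAt) (fun t => (h1 t).deriv) t 0
  rw [inner_apply_of_isometric hiso, inner_apply_of_isometric hiso] at h2
  simpa only [hU.apply_zero, hU'.apply_zero] using h2

/-- Duality of the two groups together with invertibility of `U'(t)`: put `U'(-t) f` into the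
invariant pairing. -/
theorem IsPerturbation.adjoint_eq [CompleteSpace H] (h : IsPerturbation U₀ U B)
    (h' : IsPerturbation U₀ U' B') (hU : IsC0Group U) (hU' : IsC0Group U')
    (hiso : ∀ t f, ‖U₀ t f‖ = ‖f‖)
    (hB : ∀ f g, inner ℂ (B f) g + inner ℂ f (B' g) = 0) (t : ℝ) :
    U' (-t) = ContinuousLinearMap.adjoint (U t) := by
  rw [ContinuousLinearMap.eq_adjoint_iff]
  intro f g
  have h1 := h.inner_apply_apply h' hU hU' hiso hB t g (U' (-t) f)
  rw [hU'.apply_apply_neg] at h1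
  rw [← inner_conj_symm, ← h1, inner_conj_symm]

/-- The difference quotient of `U` is that of `U₀` plus `U₀(t)` applied to a quotient converging to
`B f`. The last term always converges, so the two generators have the same domain. -/
theorem IsPerturbation.hasGenerator_iff (h : IsPerturbation U₀ U B) (hU₀ : IsC0Group U₀)
    (hU : IsC0Group U) (hiso : ∀ t f, ‖U₀ t f‖ = ‖f‖) (f g : H) :
    HasGenerator U₀ f g ↔ HasGenerator U f (g + B f) := by
  have h1 : Tendsto (fun t : ℝ => (t : ℂ)⁻¹ • (U₀ (-t) (U t f) - f)) (𝓝[≠] 0) (𝓝 (B f)) := by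
    have h2 := h f 0
    rw [hasDerivAt_iff_tendsto_slope_zero] at h2
    simp only [zero_add, neg_zero, hU.apply_zero, hU₀.apply_zero] at h2
    refine h2.congr fun t => ?_
    rw [← Complex.ofReal_inv, Complex.coe_smul]
  have h2 : Tendsto (fun t : ℝ => U₀ t ((t : ℂ)⁻¹ • (U₀ (-t) (U t f) - f))) (𝓝[≠] 0)
      (𝓝 (B f)) := by
    have h3 : Tendsto (fun t : ℝ => U₀ t (B f)) (𝓝[≠] 0) (𝓝 (B f)) := by
      have := (hU₀.continuous (B f)).tendsto 0
      rw [hU₀.apply_zero] at this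
      exact this.mono_left nhdsWithin_le_nhds
    have h4 : Tendsto (fun t : ℝ => U₀ t ((t : ℂ)⁻¹ • (U₀ (-t) (U t f) - f) - B f)) (𝓝[≠] 0)
        (𝓝 0) := by
      rw [tendsto_zero_iff_norm_tendsto_zero]
      simp only [hiso]
      rw [← tendsto_zero_iff_norm_tendsto_zero]
      simpa using h1.sub_const (B f)
    have := h4.add h3
    simpa using this
  have h3 : ∀ t : ℝ, (t : ℂ)⁻¹ • (U t f - f) =
      (t : ℂ)⁻¹ • (U₀ t f - f) + U₀ t ((t : ℂ)⁻¹ • (U₀ (-t) (U t f) - f)) := by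
    intro t
    rw [map_smul, map_sub, hU₀.apply_apply_neg, ← smul_add]
    congr 1
    abel
  constructor
  · intro hg
    exact (hg.add h2).congr fun t => (h3 t).symm
  · intro hg
    have := hg.sub h2
    rw [add_sub_cancel_right] at this
    exact this.congr fun t => by rw [h3]; abel

/-- The interaction picture: `W = U₀(-t) U(t)` must solve an equation with the bounded coefficient
`U₀(-t) B U₀(t)`, so no unbounded operator enters the construction. -/
theorem exists_perturbation [CompleteSpace H] (hU₀ : IsC0Group U₀) (hiso : ∀ t f, ‖U₀ t f‖ = ‖f‖)
    (B : H →L[ℂ] H) :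
    ∃ U : ℝ → H →L[ℂ] H, IsC0Group U ∧ IsPerturbation U₀ U B ∧
      ∃ K ω : ℝ, 0 ≤ ω ∧ ∀ t, ‖U t‖ ≤ K * Real.exp (ω * |t|) := by
  have hone : ∀ t, ‖U₀ t‖ ≤ 1 := fun t =>
    ContinuousLinearMap.opNorm_le_bound _ zero_le_one fun f => by rw [hiso, one_mul]
  have hAb : ∀ t, ‖(U₀ (-t)).comp (B.comp (U₀ t))‖ ≤ ‖B‖ := fun t =>
    ContinuousLinearMap.opNorm_le_bound _ (norm_nonneg _) fun f => by
      rw [ContinuousLinearMap.comp_apply, hiso, ContinuousLinearMap.comp_apply]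
      exact (B.le_opNorm _).trans (by rw [hiso])
  have hAc : ∀ f, Continuous fun t => ((U₀ (-t)).comp (B.comp (U₀ t))) f := fun f =>
    continuous_apply_of_strongly_continuous (hU₀.neg.continuous) (fun t => hone (-t))
      (B.continuous.comp (hU₀.continuous f))
  obtain ⟨W, hW0, hWd, hWn⟩ := exists_evolution hAc hAb
  have hd : ∀ f t, HasDerivAt (fun t => U₀ (-t) (((U₀ t).comp (W t)) f))
      (U₀ (-t) (B (((U₀ t).comp (W t)) f))) t := by
    intro f t
    simp only [ContinuousLinearMap.comp_apply, hU₀.apply_neg_apply]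
    exact hWd f t
  refine ⟨fun t => (U₀ t).comp (W t), ⟨?_, fun s t => ?_, fun f => ?_⟩, hd, 2, 2 * ‖B‖ + 1,
    by positivity, fun t => ?_⟩
  · ext1 f
    rw [ContinuousLinearMap.comp_apply, hW0, hU₀.apply_zero]; rfl
  · ext1 f
    -- The group law amounts to a cocycle identity for `W`: both sides, as functions of `s`, solve
    -- the same equation with the same value at `0`.
    have h1 := evolution_unique hAb (v := fun s => U₀ t (W (s + t) f))
      (w := fun s => W s (U₀ t (W t f))) (fun s => ?_) (hWd _) (by simp [hW0])
    · have h2 := congrFun h1 s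
      simp only [ContinuousLinearMap.comp_apply] at h2 ⊢
      rw [← h2, ← hU₀.apply_add]
    · have h2 := ((U₀ t).restrictScalars ℝ).hasFDerivAt.comp_hasDerivAt s ((hWd f (s + t)).comp_add_const s t)
      refine (h2.congr_deriv ?_)
      simp only [ContinuousLinearMap.comp_apply, ContinuousLinearMap.coe_restrictScalars']
      rw [← hU₀.apply_add, ← hU₀.apply_add]
      congr 2
      ring
  · exact continuous_apply_of_strongly_continuous hU₀.continuous hone
      (continuous_iff_continuousAt.2 fun t => (hWd f t).continuousAt)
  · refine (ContinuousLinearMap.opNorm_comp_le _ _).trans ?_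
    calc ‖U₀ t‖ * ‖W t‖ ≤ 1 * ‖W t‖ := by gcongr; exact hone t
      _ ≤ _ := by rw [one_mul]; exact hWn t

end Perturbation

/-! ### Laplace transforms and square integrals of orbits -/

theorem lintegral_enorm_sq_le_of_norm_le {α E : Type*} [NormedAddCommGroup E] [MeasurableSpace α] {μ : Measure α}
    {u v : α → E} {c : ℝ} (h : ∀ x, ‖u x‖ ≤ c * ‖v x‖) :
    ∫⁻ x, ‖u x‖ₑ ^ 2 ∂μ ≤ ENNReal.ofReal c ^ 2 * ∫⁻ x, ‖v x‖ₑ ^ 2 ∂μ := by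
  rw [← lintegral_const_mul' _ _ (by finiteness)]
  refine lintegral_mono fun x => ?_
  rw [← mul_pow]
  gcongr
  rw [← ofReal_norm, ← ofReal_norm, ← ENNReal.ofReal_mul' (norm_nonneg _)]
  exact ENNReal.ofReal_le_ofReal (h x)

section Energy

variable {H : Type*} [NormedAddCommGroup H] [InnerProductSpace ℂ H] {U₀ U U' : ℝ → H →L[ℂ] H}
  {ω a : ℝ}

/-- The damped orbit `e^{-at} T U(t) f`, cut off to `t > 0`. -/
noncomputable def dampedOrbit (U : ℝ → H →L[ℂ] H) (a : ℝ) (T : H →L[ℂ] H) (f : H) : ℝ → H :=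
  indicator (Ioi 0) fun t => (Real.exp (-a * t) : ℂ) • T (U t f)

theorem HasGrowth.norm_dampedOrbit_le (hω : HasGrowth U ω) (T : H →L[ℂ] H) (f : H) :
    ∃ K : ℝ, 0 ≤ K ∧ ∀ a t, ‖dampedOrbit U a T f t‖ ≤
      indicator (Ioi 0) (fun t => K * Real.exp (-(a - ω) * t)) t := by
  obtain ⟨K, hK0, hK⟩ := hω.exists_nonneg
  refine ⟨‖T‖ * K * ‖f‖, by positivity, fun a t => ?_⟩
  by_cases ht : t ∈ Ioi (0 : ℝ)
  · rw [dampedOrbit, indicator_of_mem ht, indicator_of_mem ht, norm_smul, Complex.norm_real,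
      Real.norm_of_nonneg (Real.exp_pos _).le]
    have h3 : Real.exp (-(a - ω) * t) = Real.exp (-a * t) * Real.exp (ω * t) := by
      rw [← Real.exp_add]; ring_nf
    rw [h3]
    calc Real.exp (-a * t) * ‖T (U t f)‖
        ≤ Real.exp (-a * t) * (‖T‖ * (K * Real.exp (ω * t) * ‖f‖)) := by
          gcongr
          refine T.le_opNorm_of_le ?_
          exact (U t).le_of_opNorm_le (hK t (le_of_lt ht)) f
      _ = _ := by ring
  · rw [dampedOrbit, indicator_of_notMem ht, indicator_of_notMem ht, norm_zero]

namespace IsC0Group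

theorem aestronglyMeasurable_dampedOrbit (hU : IsC0Group U) (a : ℝ) (T : H →L[ℂ] H) (f : H) :
    AEStronglyMeasurable (dampedOrbit U a T f) := by
  have := hU.continuous f
  have h : Continuous fun t : ℝ => (Real.exp (-a * t) : ℂ) • T (U t f) := by fun_prop
  exact h.aestronglyMeasurable.indicator measurableSet_Ioi

theorem integrable_dampedOrbit (hU : IsC0Group U) (hω : HasGrowth U ω) (ha : ω < a)
    (T : H →L[ℂ] H) (f : H) : Integrable (dampedOrbit U a T f) := by
  obtain ⟨K, hK0, hK⟩ := hω.norm_dampedOrbit_le T f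
  refine Integrable.mono' ?_ (hU.aestronglyMeasurable_dampedOrbit a T f)
    (Eventually.of_forall (hK a))
  rw [integrable_indicator_iff measurableSet_Ioi]
  exact (exp_neg_integrableOn_Ioi 0 (sub_pos.2 ha)).const_mul _

theorem memLp_dampedOrbit (hU : IsC0Group U) (hω : HasGrowth U ω) (ha : ω < a)
    (T : H →L[ℂ] H) (f : H) : MemLp (dampedOrbit U a T f) 2 volume := by
  obtain ⟨K, hK0, hK⟩ := hω.norm_dampedOrbit_le T f
  have hm := hU.aestronglyMeasurable_dampedOrbit a T f
  refine (memLp_two_iff_integrable_sq_norm hm).2 ?_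
  have h1 : Integrable (indicator (Ioi 0) fun t => K ^ 2 * Real.exp (-(2 * (a - ω)) * t)) := by
    rw [integrable_indicator_iff measurableSet_Ioi]
    exact (exp_neg_integrableOn_Ioi 0 (by linarith)).const_mul _
  refine h1.mono' (hm.norm.pow 2) (Eventually.of_forall fun t => ?_)
  rw [Real.norm_of_nonneg (by positivity)]
  refine (pow_le_pow_left₀ (norm_nonneg _) (hK a t) 2).trans (le_of_eq ?_)
  by_cases ht : t ∈ Ioi (0 : ℝ)
  · rw [indicator_of_mem ht, indicator_of_mem ht, mul_pow, ← Real.exp_nat_mul]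
    congr 2
    push_cast; ring
  · rw [indicator_of_notMem ht, indicator_of_notMem ht]; norm_num

variable [CompleteSpace H]

/-- The damping `a` and the frequency `l` combine to the point `a + 2πil`, so Fourier inversion
theory on the line governs the Laplace transform on `Re p = a`. -/
theorem fourier_dampedOrbit (hU : IsC0Group U) (hω : HasGrowth U ω) (ha : ω < a)
    (T : H →L[ℂ] H) (f : H) (l : ℝ) :
    𝓕 (dampedOrbit U a T f) l = T (laplaceTransform U (a + 2 * Real.pi * l * Complex.I) f) := by
  have hp : ω < (a + 2 * Real.pi * l * Complex.I : ℂ).re := by simpa using ha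
  rw [Real.fourier_real_eq_integral_exp_smul, hU.laplaceTransform_apply hω hp,
    ← ContinuousLinearMap.integral_comp_comm _ (hU.integrableOn_exp_smul hω hp f),
    ← integral_indicator measurableSet_Ioi]
  congr 1
  ext t
  rw [dampedOrbit]
  by_cases ht : t ∈ Ioi (0 : ℝ)
  · rw [indicator_of_mem ht, indicator_of_mem ht, map_smul, smul_smul, Complex.ofReal_exp,
      ← Complex.exp_add]
    congr 2
    push_cast; ring
  · rw [indicator_of_notMem ht, indicator_of_notMem ht, smul_zero]

theorem lintegral_enorm_laplaceTransform_sq (hU : IsC0Group U) (hω : HasGrowth U ω) (ha : ω < a)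
    (T : H →L[ℂ] H) (f : H) :
    ∫⁻ l : ℝ, ‖T (laplaceTransform U (a + 2 * Real.pi * l * Complex.I) f)‖ₑ ^ 2 =
      ∫⁻ t, ‖dampedOrbit U a T f t‖ₑ ^ 2 := by
  rw [← lintegral_enorm_fourier_sq (hU.integrable_dampedOrbit hω ha T f)
    (hU.memLp_dampedOrbit hω ha T f)]
  simp only [hU.fourier_dampedOrbit hω ha]

end IsC0Group

theorem HasGenerator.hasDerivAt {f g : H} (hU : IsC0Group U) (h : HasGenerator U f g) :
    HasDerivAt (fun t => U t f) g 0 := by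
  rw [hasDerivAt_iff_tendsto_slope_zero]
  refine h.congr fun t => ?_
  rw [zero_add, hU.apply_zero, ← Complex.ofReal_inv, Complex.coe_smul]

/-- The generator of an isometric group is skew-symmetric. -/
theorem HasGenerator.re_inner_eq_zero {f g : H} (hU₀ : IsC0Group U₀) (hiso : ∀ t f, ‖U₀ t f‖ = ‖f‖)
    (h : HasGenerator U₀ f g) : (inner ℂ f g).re = 0 := by
  have h1 := (h.hasDerivAt hU₀).inner ℂ (h.hasDerivAt hU₀)
  have h2 : (fun t => inner ℂ (U₀ t f) (U₀ t f)) = fun _ => inner ℂ f f := by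
    ext t
    exact inner_apply_of_isometric hiso t f f
  rw [h2] at h1
  have h3 := h1.unique (hasDerivAt_const 0 _)
  rw [hU₀.apply_zero, ← inner_conj_symm g f] at h3
  have h4 := congrArg Complex.re h3
  simp only [Complex.add_re, Complex.conj_re, Complex.zero_re] at h4
  linarith

end Energy

/-! ### Smooth operators in the sense of Kato -/

section Smooth

variable {H : Type*} [NormedAddCommGroup H] [InnerProductSpace ℂ H]
  {U₀ U U' : ℝ → H →L[ℂ] H} {A B C : H →L[ℂ] H} {ω a M M₀ D : ℝ}

/-- The operators `A (p - G)⁻¹ A` are bounded by `M`, where `G` is the generator of `U` and `Re p`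
is larger than the growth exponent. -/
def ResolventBound (U : ℝ → H →L[ℂ] H) (A : H →L[ℂ] H) (M : ℝ) : Prop :=
  ∀ ω, 0 ≤ ω → HasGrowth U ω → ∀ p : ℂ, ω < p.re → ∀ h,
    ‖A (laplaceTransform U p (A h))‖ ≤ M * ‖h‖

/-- `∫₀^∞ e^{-2at} ‖A U(t) f‖² dt ≤ D² ‖f‖²` for all `a` larger than the growth exponent. -/
def EnergyBound (U : ℝ → H →L[ℂ] H) (A : H →L[ℂ] H) (D : ℝ) : Prop :=
  ∀ ω, 0 ≤ ω → HasGrowth U ω → ∀ a, ω < a → ∀ f,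
    ∫⁻ t, ‖dampedOrbit U a A f t‖ₑ ^ 2 ≤ ENNReal.ofReal (D * ‖f‖) ^ 2

theorem hasGrowth_zero_of_isometric (hiso : ∀ t f, ‖U₀ t f‖ = ‖f‖) : HasGrowth U₀ 0 :=
  ⟨1, fun t _ => ContinuousLinearMap.opNorm_le_bound _ (by positivity) fun f => by simp [hiso]⟩

theorem lintegral_dampedOrbit_id_sq (hiso : ∀ t f, ‖U₀ t f‖ = ‖f‖) (ha : 0 < a) (f : H) :
    ∫⁻ t, ‖dampedOrbit U₀ a (ContinuousLinearMap.id ℂ H) f t‖ₑ ^ 2 =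
      ENNReal.ofReal (‖f‖ ^ 2 / (2 * a)) := by
  have h1 : ∀ t, ‖dampedOrbit U₀ a (ContinuousLinearMap.id ℂ H) f t‖ₑ ^ 2 =
      indicator (Ioi 0) (fun t => ENNReal.ofReal (‖f‖ ^ 2 * Real.exp (-(2 * a) * t))) t := by
    intro t
    by_cases ht : t ∈ Ioi (0 : ℝ)
    · rw [dampedOrbit, indicator_of_mem ht, indicator_of_mem ht, ← ofReal_norm,
        ← ENNReal.ofReal_pow (norm_nonneg _), norm_smul, Complex.norm_real,
        Real.norm_of_nonneg (Real.exp_pos _).le, ContinuousLinearMap.id_apply, hiso, mul_pow,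
        ← Real.exp_nat_mul, mul_comm]
      congr 3
      push_cast; ring
    · rw [dampedOrbit, indicator_of_notMem ht, indicator_of_notMem ht]; simp
  simp_rw [h1]
  rw [lintegral_indicator measurableSet_Ioi, ← ofReal_integral_eq_lintegral_ofReal,
    integral_const_mul, integral_exp_mul_Ioi (by linarith)]
  · congr 1
    simp; field_simp
  · exact (exp_neg_integrableOn_Ioi 0 (by linarith)).const_mul _
  · exact Eventually.of_forall fun t => by positivity

variable [CompleteSpace H]

/-- With `y` the transform of `A h` and a skew-symmetric generator, `Re p ‖y‖² = Re ⟨y, A h⟩ = Re ⟨A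
y, h⟩`, and the right side is at most `M₀ ‖h‖²`. -/
theorem norm_laplaceTransform_comp_le (hU₀ : IsC0Group U₀) (hiso : ∀ t f, ‖U₀ t f‖ = ‖f‖)
    (hA : ContinuousLinearMap.adjoint A = A) (hM : ResolventBound U₀ A M₀) {p : ℂ}
    (hp : 0 < p.re) (h : H) :
    ‖laplaceTransform U₀ p (A h)‖ ≤ √(M₀ / p.re) * ‖h‖ := by
  have hg := hasGrowth_zero_of_isometric hiso
  set y := laplaceTransform U₀ p (A h) with hy
  have h1 := (hU₀.hasGenerator_laplaceTransform hg hp (A h)).re_inner_eq_zero hU₀ hiso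
  rw [← hy, inner_sub_right, inner_smul_right, inner_self_eq_norm_sq_to_K] at h1
  have h2 : inner ℂ y (A h) = inner ℂ (A y) h := by
    conv_rhs => rw [← hA]
    rw [ContinuousLinearMap.adjoint_inner_left]
  have h5 : (p * (‖y‖ : ℂ) ^ 2).re = p.re * ‖y‖ ^ 2 := by
    rw [← Complex.ofReal_pow, Complex.re_mul_ofReal]
  rw [h2, Complex.sub_re] at h1
  replace h1 := (congrArg (· - (inner ℂ (A y) h).re) h5).symm.trans h1
  beta_reduce at h1
  have h3 : (inner ℂ (A y) h).re ≤ M₀ * ‖h‖ * ‖h‖ := by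
    refine (Complex.re_le_norm _).trans ((norm_inner_le_norm _ _).trans ?_)
    gcongr
    exact hM 0 le_rfl hg p hp h
  have h4 : ‖y‖ ^ 2 ≤ M₀ / p.re * ‖h‖ ^ 2 := by
    rw [div_mul_eq_mul_div, le_div_iff₀ hp]
    linarith
  rw [← Real.sqrt_sq (norm_nonneg h), ← Real.sqrt_mul' _ (sq_nonneg _)]
  exact Real.le_sqrt_of_sq_le h4

/-- The operator is the adjoint of the one in `norm_laplaceTransform_comp_le`, because the adjoint
of a unitary group is its time reversal. -/
theorem norm_comp_laplaceTransform_neg_le (hU₀ : IsC0Group U₀) (hiso : ∀ t f, ‖U₀ t f‖ = ‖f‖)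
    (hA : ContinuousLinearMap.adjoint A = A) (hM : ResolventBound U₀ A M₀) {p : ℂ}
    (hp : 0 < p.re) (h : H) :
    ‖A (laplaceTransform (fun t => U₀ (-t)) (star p) h)‖ ≤ √(M₀ / p.re) * ‖h‖ := by
  have hg := hasGrowth_zero_of_isometric hiso
  have had : ∀ t, 0 ≤ t → U₀ (-t) = ContinuousLinearMap.adjoint (U₀ t) := by
    intro t _
    rw [ContinuousLinearMap.eq_adjoint_iff]
    intro f g
    rw [← inner_apply_of_isometric hiso t, hU₀.apply_apply_neg]
  have h1 := hU₀.adjoint_laplaceTransform hg hp hU₀.neg had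
  have h2 : A.comp (laplaceTransform (fun t => U₀ (-t)) (star p)) =
      ContinuousLinearMap.adjoint ((laplaceTransform U₀ p).comp A) := by
    rw [ContinuousLinearMap.adjoint_comp, hA, h1]
  rw [← ContinuousLinearMap.comp_apply, h2]
  refine ContinuousLinearMap.le_of_opNorm_le _ ?_ h
  rw [LinearIsometryEquiv.norm_map]
  exact ContinuousLinearMap.opNorm_le_bound _ (Real.sqrt_nonneg _)
    (norm_laplaceTransform_comp_le hU₀ hiso hA hM hp)

/-- The first resolvent identity for the points on either side of the imaginary axis. The sum is the
Laplace transform of the orbit over the whole line, and the factor `2 Re p` compensates the blow-up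
of the resolvents near the axis. -/
theorem laplaceTransform_add_laplaceTransform_neg (hU₀ : IsC0Group U₀)
    (hiso : ∀ t f, ‖U₀ t f‖ = ‖f‖) {p : ℂ} (hp : 0 < p.re) (f : H) :
    laplaceTransform U₀ p f + laplaceTransform (fun t => U₀ (-t)) (star p) f =
      laplaceTransform (fun t => U₀ (-t)) (star p) ((2 * p.re : ℂ) • laplaceTransform U₀ p f) := by
  have hg := hasGrowth_zero_of_isometric hiso
  have hg' : HasGrowth (fun t => U₀ (-t)) 0 := hasGrowth_zero_of_isometric fun t => hiso (-t)
  have h1 := (hU₀.hasGenerator_laplaceTransform hg hp f).neg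
  have h2 := hU₀.neg.laplaceTransform_sub_of_hasGenerator hg' (p := star p) (by simpa using hp) h1
  rw [sub_neg_eq_add, ← add_sub_assoc, ← add_smul, map_sub] at h2
  have h3 : star p + p = 2 * p.re := by
    rw [add_comm, ← Complex.ofReal_ofNat, ← Complex.ofReal_mul]
    exact Complex.add_conj p
  rw [h3, sub_eq_iff_eq_add] at h2
  exact h2.symm

/-- Kato's theorem: uniform resolvent bounds imply smoothness with respect to a unitary group. -/
theorem ResolventBound.energyBound_of_isometric (hM : ResolventBound U₀ A M₀) (hM0 : 0 ≤ M₀)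
    (hU₀ : IsC0Group U₀) (hiso : ∀ t f, ‖U₀ t f‖ = ‖f‖)
    (hA : ContinuousLinearMap.adjoint A = A) : EnergyBound U₀ A √(2 * M₀) := by
  intro ω hω0 _ a ha f
  have ha0 : 0 < a := hω0.trans_lt ha
  have hg := hasGrowth_zero_of_isometric hiso
  have hg' : HasGrowth (fun t => U₀ (-t)) 0 := hasGrowth_zero_of_isometric fun t => hiso (-t)
  set v := dampedOrbit (fun t => U₀ (-t)) a A f with hv
  set w := dampedOrbit U₀ a A f with hw
  have hw1 := hU₀.integrable_dampedOrbit hg ha0 A f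
  have hw2 := hU₀.memLp_dampedOrbit hg ha0 A f
  have hv1 : Integrable (fun t => v (-t)) := (hU₀.neg.integrable_dampedOrbit hg' ha0 A f).comp_neg
  have hv2 : MemLp (fun t => v (-t)) 2 volume :=
    (hU₀.neg.memLp_dampedOrbit hg' ha0 A f).comp_measurePreserving
      (Measure.measurePreserving_neg (volume : Measure ℝ))
  -- Away from `t = 0` the function is the two-sided orbit `e^{-a|t|} A U₀(t) f`, whose transform is
  -- a product of two resolvents.
  have hF : ∀ l : ℝ, 𝓕 (w + fun t => v (-t)) l =
      A (laplaceTransform (fun t => U₀ (-t)) (star (a + 2 * Real.pi * l * Complex.I))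
        ((2 * a : ℂ) • laplaceTransform U₀ (a + 2 * Real.pi * l * Complex.I) f)) := by
    intro l
    have h1 : 𝓕 (w + fun t => v (-t)) l = 𝓕 w l + 𝓕 (fun t => v (-t)) l := by
      simp only [Real.fourier_eq, Pi.add_apply, smul_add]
      exact integral_add ((Real.fourierIntegral_convergent_iff l).2 hw1)
        ((Real.fourierIntegral_convergent_iff l).2 hv1)
    have h2 : 𝓕 (fun t => v (-t)) l = 𝓕 v (-l) :=
      Real.fourier_comp_linearIsometry (LinearIsometryEquiv.neg ℝ) v l
    have hp : 0 < (a + 2 * Real.pi * l * Complex.I : ℂ).re := by simpa using ha0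
    have h3 := laplaceTransform_add_laplaceTransform_neg hU₀ hiso hp f
    have h4 : (a + 2 * Real.pi * (-l : ℝ) * Complex.I : ℂ) =
        star (a + 2 * Real.pi * l * Complex.I : ℂ) := by
      simp
    have h5 : ((a + 2 * Real.pi * l * Complex.I : ℂ).re : ℂ) = a := by simp
    rw [h5] at h3
    rw [h1, h2, hw, hv, hU₀.fourier_dampedOrbit hg ha0, hU₀.neg.fourier_dampedOrbit hg' ha0, h4,
      ← map_add, h3]
  have hle : ∀ t, ‖w t‖ ≤ 1 * ‖(w + fun t => v (-t)) t‖ := by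
    intro t
    rw [one_mul, Pi.add_apply]
    by_cases ht : t ∈ Ioi (0 : ℝ)
    · have h1 : v (-t) = 0 := by
        rw [hv, dampedOrbit, indicator_of_notMem]
        simpa using le_of_lt ht
      rw [h1, add_zero]
    · rw [hw, dampedOrbit, indicator_of_notMem ht, norm_zero]
      exact norm_nonneg _
  have hFle : ∀ l : ℝ, ‖𝓕 (w + fun t => v (-t)) l‖ ≤ √(M₀ / a) * (2 * a) *
      ‖ContinuousLinearMap.id ℂ H
        (laplaceTransform U₀ (a + 2 * Real.pi * l * Complex.I) f)‖ := by
    intro l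
    have hp : 0 < (a + 2 * Real.pi * l * Complex.I : ℂ).re := by simpa using ha0
    have h1 := norm_comp_laplaceTransform_neg_le hU₀ hiso hA hM hp
      ((2 * a : ℂ) • laplaceTransform U₀ (a + 2 * Real.pi * l * Complex.I) f)
    rw [hF]
    refine h1.trans (le_of_eq ?_)
    have h5 : (a + 2 * Real.pi * l * Complex.I : ℂ).re = a := by simp
    rw [h5, norm_smul, mul_assoc, ContinuousLinearMap.id_apply]
    simp [abs_of_pos ha0, mul_assoc]
  -- The powers of `a` cancel: `(M₀/a) (2a)² · ‖f‖²/(2a) = 2 M₀ ‖f‖²`, so the bound does not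
  -- degenerate as `a → 0`.
  calc ∫⁻ t, ‖w t‖ₑ ^ 2 ≤ ENNReal.ofReal 1 ^ 2 * ∫⁻ t, ‖(w + fun t => v (-t)) t‖ₑ ^ 2 :=
        lintegral_enorm_sq_le_of_norm_le hle
    _ = ∫⁻ l, ‖𝓕 (w + fun t => v (-t)) l‖ₑ ^ 2 := by
        rw [ENNReal.ofReal_one, one_pow, one_mul, lintegral_enorm_fourier_sq (hw1.add hv1)
          (hw2.add hv2)]
    _ ≤ _ := lintegral_enorm_sq_le_of_norm_le hFle
    _ = ENNReal.ofReal (√(2 * M₀) * ‖f‖) ^ 2 := by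
        rw [hU₀.lintegral_enorm_laplaceTransform_sq hg ha0, lintegral_dampedOrbit_id_sq hiso ha0,
          ← ENNReal.ofReal_pow (by positivity), ← ENNReal.ofReal_mul (by positivity),
          ← ENNReal.ofReal_pow (by positivity)]
        congr 1
        rw [mul_pow, mul_pow, mul_pow, Real.sq_sqrt (by positivity), Real.sq_sqrt (by positivity)]
        field_simp

/-- The second resolvent identity. This order controls `A` times the perturbed resolvent by `A`
times the free one; the opposite order, proved next, controls the perturbed resolvent itself. -/
theorem IsPerturbation.laplaceTransform_eq (h : IsPerturbation U₀ U B) (hU₀ : IsC0Group U₀)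
    (hU : IsC0Group U) (hiso : ∀ t f, ‖U₀ t f‖ = ‖f‖) (hω0 : 0 ≤ ω) (hω : HasGrowth U ω) {p : ℂ}
    (hp : ω < p.re) (f : H) :
    laplaceTransform U p f =
      laplaceTransform U₀ p f + laplaceTransform U p (B (laplaceTransform U₀ p f)) := by
  have hg := hasGrowth_zero_of_isometric hiso
  have h1 := (h.hasGenerator_iff hU₀ hU hiso _ _).1
    (hU₀.hasGenerator_laplaceTransform hg (hω0.trans_lt hp) f)
  have h2 := hU.laplaceTransform_sub_of_hasGenerator hω hp h1
  rw [← sub_sub, sub_sub_cancel, map_sub] at h2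
  exact (sub_eq_iff_eq_add.1 h2)

theorem IsPerturbation.laplaceTransform_eq' (h : IsPerturbation U₀ U B) (hU₀ : IsC0Group U₀)
    (hU : IsC0Group U) (hiso : ∀ t f, ‖U₀ t f‖ = ‖f‖) (hω0 : 0 ≤ ω) (hω : HasGrowth U ω) {p : ℂ}
    (hp : ω < p.re) (f : H) :
    laplaceTransform U p f =
      laplaceTransform U₀ p f + laplaceTransform U₀ p (B (laplaceTransform U p f)) := by
  have hg := hasGrowth_zero_of_isometric hiso
  have h1 := hU.hasGenerator_laplaceTransform hω hp f
  rw [← sub_add_cancel (p • laplaceTransform U p f - f) (B (laplaceTransform U p f)),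
    ← h.hasGenerator_iff hU₀ hU hiso] at h1
  have h2 := hU₀.laplaceTransform_sub_of_hasGenerator hg (hω0.trans_lt hp) h1
  rw [← sub_add, sub_sub_cancel, map_add] at h2
  exact h2.symm

/-- The resolvent identity gives `A R = A R₀ + (A R A) C R₀`, and `‖C x‖ ≤ ‖A x‖` makes this at most
`(1 + M) ‖A R₀ f‖` pointwise on each vertical line. Plancherel in both directions does the rest. -/
theorem EnergyBound.of_isPerturbation (hD : EnergyBound U₀ A D) (hM : ResolventBound U A M)
    (hM0 : 0 ≤ M) (h : IsPerturbation U₀ U (A.comp C)) (hU₀ : IsC0Group U₀) (hU : IsC0Group U)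
    (hiso : ∀ t f, ‖U₀ t f‖ = ‖f‖) (hC : ∀ x, ‖C x‖ ≤ ‖A x‖) :
    EnergyBound U A ((1 + M) * D) := by
  intro ω hω0 hω a ha f
  have hg := hasGrowth_zero_of_isometric hiso
  rw [← hU.lintegral_enorm_laplaceTransform_sq hω ha]
  have h1 : ∀ l : ℝ, ‖A (laplaceTransform U (a + 2 * Real.pi * l * Complex.I) f)‖ ≤
      (1 + M) * ‖A (laplaceTransform U₀ (a + 2 * Real.pi * l * Complex.I) f)‖ := by
    intro l
    have hp : ω < (a + 2 * Real.pi * l * Complex.I : ℂ).re := by simpa using ha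
    rw [h.laplaceTransform_eq hU₀ hU hiso hω0 hω hp, map_add, add_mul, one_mul]
    refine (norm_add_le _ _).trans ?_
    gcongr
    exact (hM ω hω0 hω _ hp _).trans (by gcongr; exact hC _)
  refine (lintegral_enorm_sq_le_of_norm_le h1).trans ?_
  rw [hU₀.lintegral_enorm_laplaceTransform_sq hg (hω0.trans_lt ha), mul_assoc,
    ENNReal.ofReal_mul (by positivity), mul_pow]
  gcongr
  exact hD 0 le_rfl hg a (hω0.trans_lt ha) f

/-- From `R = R₀ + R₀ A C R` and `‖R₀ A‖ ≤ √(M₀/a)` the squared resolvent is at most twice the free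
one plus `2 (M₀/a) ‖A R f‖²`. Both terms integrate to order `1/a`, as they would for a bounded
group. -/
theorem EnergyBound.lintegral_dampedOrbit_id_sq_le (hD : EnergyBound U A D) (hD0 : 0 ≤ D)
    (hM : ResolventBound U₀ A M₀) (hM0 : 0 ≤ M₀) (h : IsPerturbation U₀ U (A.comp C))
    (hU₀ : IsC0Group U₀) (hU : IsC0Group U) (hiso : ∀ t f, ‖U₀ t f‖ = ‖f‖)
    (hA : ContinuousLinearMap.adjoint A = A) (hC : ∀ x, ‖C x‖ ≤ ‖A x‖)
    (hω0 : 0 ≤ ω) (hω : HasGrowth U ω) (ha : ω < a) (f : H) :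
    ∫⁻ t, ‖dampedOrbit U a (ContinuousLinearMap.id ℂ H) f t‖ₑ ^ 2 ≤
      ENNReal.ofReal ((1 + 2 * M₀ * D ^ 2) / a * ‖f‖ ^ 2) := by
  have ha0 : 0 < a := hω0.trans_lt ha
  have hg := hasGrowth_zero_of_isometric hiso
  rw [← hU.lintegral_enorm_laplaceTransform_sq hω ha]
  have h1 : ∀ l : ℝ, ‖ContinuousLinearMap.id ℂ H
      (laplaceTransform U (a + 2 * Real.pi * l * Complex.I) f)‖ₑ ^ 2 ≤
      2 * ‖ContinuousLinearMap.id ℂ H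
        (laplaceTransform U₀ (a + 2 * Real.pi * l * Complex.I) f)‖ₑ ^ 2 +
      ENNReal.ofReal (2 * (M₀ / a)) *
        ‖A (laplaceTransform U (a + 2 * Real.pi * l * Complex.I) f)‖ₑ ^ 2 := by
    intro l
    have hp : ω < (a + 2 * Real.pi * l * Complex.I : ℂ).re := by simpa using ha
    have h5 : (a + 2 * Real.pi * l * Complex.I : ℂ).re = a := by simp
    simp only [ContinuousLinearMap.id_apply]
    set p : ℂ := a + 2 * Real.pi * l * Complex.I
    have h2 := norm_laplaceTransform_comp_le hU₀ hiso hA hM (hω0.trans_lt hp)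
      (C (laplaceTransform U p f))
    have h3 : ‖laplaceTransform U p f‖ ^ 2 ≤ 2 * ‖laplaceTransform U₀ p f‖ ^ 2 +
        2 * (M₀ / a) * ‖A (laplaceTransform U p f)‖ ^ 2 := by
      have h4 : ‖laplaceTransform U p f‖ ≤ ‖laplaceTransform U₀ p f‖ +
          √(M₀ / a) * ‖A (laplaceTransform U p f)‖ := by
        conv_lhs => rw [h.laplaceTransform_eq' hU₀ hU hiso hω0 hω hp]
        refine (norm_add_le _ _).trans ?_
        gcongr
        rw [h5] at h2
        exact h2.trans (by gcongr; exact hC _)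
      have h6 : √(M₀ / a) ^ 2 = M₀ / a := Real.sq_sqrt (by positivity)
      refine (pow_le_pow_left₀ (norm_nonneg _) h4 2).trans ?_
      refine (add_sq_le (R := ℝ)).trans (le_of_eq ?_)
      rw [mul_pow, h6]
      ring
    simp only [← ofReal_norm]
    rw [← ENNReal.ofReal_pow (norm_nonneg _), ← ENNReal.ofReal_pow (norm_nonneg _),
      ← ENNReal.ofReal_pow (norm_nonneg _), ← ENNReal.ofReal_mul (by positivity),
      ← ENNReal.ofReal_ofNat, ← ENNReal.ofReal_mul (by positivity),
      ← ENNReal.ofReal_add (by positivity) (by positivity)]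
    exact ENNReal.ofReal_le_ofReal h3
  refine (lintegral_mono h1).trans ?_
  rw [lintegral_add_left', lintegral_const_mul' _ _ (by finiteness),
    lintegral_const_mul' _ _ (by finiteness),
    hU₀.lintegral_enorm_laplaceTransform_sq hg ha0, lintegral_dampedOrbit_id_sq hiso ha0,
    hU.lintegral_enorm_laplaceTransform_sq hω ha]
  · refine (add_le_add_right (mul_le_mul_right (hD ω hω0 hω a ha f) _) _).trans (le_of_eq ?_)
    rw [← ENNReal.ofReal_ofNat, ← ENNReal.ofReal_mul (by positivity)]
    rw [← ENNReal.ofReal_pow (by positivity), ← ENNReal.ofReal_mul (by positivity),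
      ← ENNReal.ofReal_add (by positivity) (by positivity)]
    congr 1
    field_simp
  · have h2 := continuous_fourier_of_integrable
      (hU₀.integrable_dampedOrbit hg ha0 (ContinuousLinearMap.id ℂ H) f)
    have h3 : Continuous fun l : ℝ => ContinuousLinearMap.id ℂ H
        (laplaceTransform U₀ (a + 2 * Real.pi * l * Complex.I) f) := by
      simpa only [← hU₀.fourier_dampedOrbit hg ha0] using h2
    exact (by fun_prop : Measurable fun x : ℝ≥0∞ => 2 * x ^ 2).comp_aemeasurable
      h3.enorm.aemeasurable

end Smooth

/-! ### Uniform boundedness of perturbed groups -/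

theorem ENNReal.lintegral_mul_le_of_lintegral_sq_le {α : Type*} [MeasurableSpace α]
    {μ : Measure α} {u v : α → ℝ≥0∞} {F G : ℝ≥0∞} (hu : AEMeasurable u μ)
    (hF : ∫⁻ x, u x ^ 2 ∂μ ≤ F ^ 2) (hG : ∫⁻ x, v x ^ 2 ∂μ ≤ G ^ 2) (hv : AEMeasurable v μ) :
    ∫⁻ x, u x * v x ∂μ ≤ F * G := by
  have h := ENNReal.lintegral_mul_le_Lp_mul_Lq μ Real.HolderConjugate.two_two hu hv
  simp only [ENNReal.rpow_ofNat, Pi.mul_apply] at h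
  refine h.trans ?_
  have hs : ∀ x : ℝ≥0∞, (x ^ 2) ^ (1 / 2 : ℝ) = x := fun x => by
    rw [← ENNReal.rpow_ofNat, ← ENNReal.rpow_mul]; simp
  gcongr
  · conv_rhs => rw [← hs F]
    gcongr
  · conv_rhs => rw [← hs G]
    gcongr

section UniformBound

variable {H : Type*} [NormedAddCommGroup H] [InnerProductSpace ℂ H]
  {U₀ U U' : ℝ → H →L[ℂ] H} {A B C : H →L[ℂ] H} {ω a M M₀ D D₀ N : ℝ}

theorem inner_apply_neg_of_isometric (hU₀ : IsC0Group U₀) (hiso : ∀ t f, ‖U₀ t f‖ = ‖f‖)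
    (t : ℝ) (f g : H) : inner ℂ (U₀ (-t) f) g = inner ℂ f (U₀ t g) := by
  rw [← inner_apply_of_isometric hiso t, hU₀.apply_apply_neg]

/-- Submultiplicativity along multiples of `t₀`; the remaining time is shorter than `t₀` and costs a
constant given by the old exponent. -/
theorem HasGrowth.of_norm_le (hU : IsC0Group U) (hω : HasGrowth U ω) {ω' t₀ : ℝ} (hω' : 0 ≤ ω')
    (hω0 : 0 ≤ ω) (ht₀ : 0 < t₀) (h : ‖U t₀‖ ≤ Real.exp (ω' * t₀)) : HasGrowth U ω' := by
  obtain ⟨K, hK0, hK⟩ := hω.exists_nonneg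
  have hn : ∀ n : ℕ, ‖U (n * t₀)‖ ≤ Real.exp (ω' * (n * t₀)) := by
    intro n
    induction n with
    | zero =>
      simp only [Nat.cast_zero, zero_mul, mul_zero, Real.exp_zero, hU.zero]
      exact ContinuousLinearMap.norm_id_le
    | succ n ih =>
      have h1 : ((n + 1 : ℕ) : ℝ) * t₀ = n * t₀ + t₀ := by push_cast; ring
      rw [h1, hU.add, mul_add, Real.exp_add]
      refine (ContinuousLinearMap.opNorm_comp_le _ _).trans ?_
      gcongr
  refine ⟨K * Real.exp (ω * t₀), fun t ht => ?_⟩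
  set n := ⌊t / t₀⌋₊
  have h1 : (n : ℝ) * t₀ ≤ t := (le_div_iff₀ ht₀).1 (Nat.floor_le (by positivity))
  have h2 : t - n * t₀ ≤ t₀ := by
    have := (div_lt_iff₀ ht₀).1 (Nat.lt_floor_add_one (t / t₀))
    change t < (n + 1) * t₀ at this
    linarith
  have h3 : U t = (U (t - n * t₀)).comp (U (n * t₀)) := by rw [← hU.add, sub_add_cancel]
  rw [h3]
  refine (ContinuousLinearMap.opNorm_comp_le _ _).trans ?_
  gcongr
  · refine (hK _ (sub_nonneg.2 h1)).trans ?_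
    gcongr
  · exact (hn n).trans (by gcongr)

/-- Fatou's lemma along the dampings `1/(n+1)`, all admissible once the growth exponent is `0`. -/
theorem EnergyBound.lintegral_le (hD : EnergyBound U A D) (hU : IsC0Group U) (hg : HasGrowth U 0)
    (f : H) : ∫⁻ t in Ioi 0, ‖A (U t f)‖ₑ ^ 2 ≤ ENNReal.ofReal (D * ‖f‖) ^ 2 := by
  have hlim : ∀ t ∈ Ioi (0 : ℝ), ‖A (U t f)‖ₑ ^ 2 =
      liminf (fun n : ℕ => ‖dampedOrbit U (1 / ((n : ℝ) + 1)) A f t‖ₑ ^ 2) atTop := by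
    intro t ht
    symm
    refine Tendsto.liminf_eq ?_
    simp only [dampedOrbit, indicator_of_mem ht]
    have h1 : Continuous fun x : ℝ => ‖(Real.exp (-x * t) : ℂ) • A (U t f)‖ₑ ^ 2 :=
      (ENNReal.continuous_pow 2).comp (Continuous.enorm (by fun_prop))
    have h2 := (h1.tendsto 0).comp (tendsto_one_div_add_atTop_nhds_zero_nat (𝕜 := ℝ))
    simpa [Function.comp_def] using h2
  rw [setLIntegral_congr_fun measurableSet_Ioi hlim]
  refine (lintegral_liminf_le' fun n => ?_).trans ?_
  · exact ((hU.aestronglyMeasurable_dampedOrbit _ A f).enorm.pow_const 2).restrict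
  · refine liminf_le_of_le (by isBoundedDefault) fun b hb => ?_
    obtain ⟨n, hn⟩ := hb.exists
    refine hn.trans ((lintegral_mono' Measure.restrict_le_self le_rfl).trans ?_)
    exact hD 0 le_rfl hg _ (by positivity) f

variable [CompleteSpace H]

/-- The integrated form of Duhamel's formula, tested against a vector. -/
theorem IsPerturbation.enorm_inner_sub_le (h : IsPerturbation U₀ U (A.comp C))
    (hU₀ : IsC0Group U₀) (hU : IsC0Group U) (hiso : ∀ t f, ‖U₀ t f‖ = ‖f‖)
    (hA : ContinuousLinearMap.adjoint A = A) (hC : ∀ x, ‖C x‖ ≤ ‖A x‖) {s t : ℝ} (hst : s ≤ t)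
    (f g : H) :
    ‖inner ℂ (U₀ (-t) (U t f) - U₀ (-s) (U s f)) g‖ₑ ≤
      ∫⁻ r in Ioo s t, ‖A (U r f)‖ₑ * ‖A (U₀ r g)‖ₑ := by
  have hd : ∀ r, HasDerivAt (fun r => inner ℂ (U₀ (-r) (U r f)) g)
      (inner ℂ (C (U r f)) (A (U₀ r g))) r := by
    intro r
    refine ((h f r).inner ℂ (hasDerivAt_const r g)).congr_deriv ?_
    rw [inner_zero_right, zero_add, inner_apply_neg_of_isometric hU₀ hiso,
      ContinuousLinearMap.comp_apply]
    conv_rhs => rw [← hA]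
    rw [ContinuousLinearMap.adjoint_inner_right]
  have hc : Continuous fun r => inner ℂ (C (U r f)) (A (U₀ r g)) :=
    (C.continuous.comp (hU.continuous f)).inner (A.continuous.comp (hU₀.continuous g))
  rw [inner_sub_left, ← intervalIntegral.integral_eq_sub_of_hasDerivAt (fun r _ => hd r)
    (hc.intervalIntegrable s t), intervalIntegral.integral_of_le hst,
    restrict_Ioo_eq_restrict_Ioc]
  refine (enorm_integral_le_lintegral_enorm _).trans (lintegral_mono fun r => ?_)
  rw [← ofReal_norm, ← ofReal_norm, ← ofReal_norm, ← ENNReal.ofReal_mul (norm_nonneg _)]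
  refine ENNReal.ofReal_le_ofReal ((norm_inner_le_norm _ _).trans ?_)
  gcongr
  exact hC _

/-- Test Duhamel's formula with the vector `U₀(-t) U(t) f`: one Duhamel factor is the forward
perturbed orbit, the other the backward free orbit started at time `t`. The constant depends on the
energy bounds only, not on `ω`. -/
theorem IsPerturbation.norm_le_of_energyBound (h : IsPerturbation U₀ U (A.comp C))
    (hU₀ : IsC0Group U₀) (hU : IsC0Group U) (hiso : ∀ t f, ‖U₀ t f‖ = ‖f‖)
    (hA : ContinuousLinearMap.adjoint A = A) (hC : ∀ x, ‖C x‖ ≤ ‖A x‖)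
    (hD : EnergyBound U A D) (hD0 : 0 ≤ D) (hD₀ : EnergyBound (fun t => U₀ (-t)) A D₀)
    (hD₀0 : 0 ≤ D₀) (hω0 : 0 ≤ ω) (hω : HasGrowth U ω) {t : ℝ} (ht : 0 ≤ t) :
    ‖U t‖ ≤ (1 + D * D₀) * Real.exp (ω * t) := by
  have hg' : HasGrowth (fun t => U₀ (-t)) 0 := hasGrowth_zero_of_isometric fun t => hiso (-t)
  have key : ∀ a, ω < a → ‖U t‖ ≤ (1 + D * D₀) * Real.exp (a * t) := by
    intro a ha
    have ha0 : 0 < a := hω0.trans_lt ha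
    refine ContinuousLinearMap.opNorm_le_bound _ (by positivity) fun f => ?_
    set g := U t f with hg
    have h1 := h.enorm_inner_sub_le hU₀ hU hiso hA hC ht f (U₀ (-t) g)
    -- The dampings at `r` and at `t - r` multiply to `e^{-at}`, which the prefactor restores.
    have h2 : ∀ r ∈ Ioo 0 t, ‖A (U r f)‖ₑ * ‖A (U₀ r (U₀ (-t) g))‖ₑ =
        ENNReal.ofReal (Real.exp (a * t)) * (‖dampedOrbit U a A f r‖ₑ *
          ‖dampedOrbit (fun t => U₀ (-t)) a A g (t - r)‖ₑ) := by
      intro r hr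
      have h3 : t - r ∈ Ioi (0 : ℝ) := sub_pos.2 hr.2
      have h8 : U₀ r (U₀ (-t) g) = U₀ (r - t) g := by rw [← hU₀.apply_add, sub_eq_add_neg]
      rw [dampedOrbit, dampedOrbit, indicator_of_mem (mem_Ioi.2 hr.1), indicator_of_mem h3,
        neg_sub, h8]
      simp only [← ofReal_norm]
      rw [← ENNReal.ofReal_mul (norm_nonneg _), ← ENNReal.ofReal_mul (norm_nonneg _),
        ← ENNReal.ofReal_mul (by positivity)]
      congr 1
      rw [norm_smul, norm_smul, Complex.norm_real, Complex.norm_real,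
        Real.norm_of_nonneg (Real.exp_pos _).le, Real.norm_of_nonneg (Real.exp_pos _).le]
      have h4 : Real.exp (a * t) * (Real.exp (-a * r) * Real.exp (-a * (t - r))) = 1 := by
        rw [← Real.exp_add, ← Real.exp_add, Real.exp_eq_one_iff]; ring
      calc _ = Real.exp (a * t) * (Real.exp (-a * r) * Real.exp (-a * (t - r))) *
            (‖A (U r f)‖ * ‖A (U₀ (r - t) g)‖) := by rw [h4, one_mul]
        _ = _ := by ring
    have h3 : ‖inner ℂ (U₀ (-t) (U t f) - U₀ (-0) (U 0 f)) (U₀ (-t) g)‖ₑ ≤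
        ENNReal.ofReal (Real.exp (a * t)) *
          (ENNReal.ofReal (D * ‖f‖) * ENNReal.ofReal (D₀ * ‖g‖)) := by
      rw [setLIntegral_congr_fun measurableSet_Ioo h2, lintegral_const_mul' _ _ (by finiteness)]
        at h1
      refine h1.trans ?_
      gcongr
      refine (lintegral_mono' Measure.restrict_le_self le_rfl).trans ?_
      refine ENNReal.lintegral_mul_le_of_lintegral_sq_le
        (hU.aestronglyMeasurable_dampedOrbit a A f).enorm (hD ω hω0 hω a ha f) ?_ ?_
      · rw [lintegral_sub_left_eq_self
          (fun r => ‖dampedOrbit (fun t => U₀ (-t)) a A g r‖ₑ ^ 2) t]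
        exact hD₀ 0 le_rfl hg' a ha0 g
      · exact ((hU₀.neg.aestronglyMeasurable_dampedOrbit a A g).comp_quasiMeasurePreserving
          (Measure.measurePreserving_sub_left volume t).quasiMeasurePreserving).enorm
    rw [← ENNReal.ofReal_mul (by positivity), ← ENNReal.ofReal_mul (by positivity), ← ofReal_norm,
      ENNReal.ofReal_le_ofReal_iff (by positivity), neg_zero, hU.apply_zero, hU₀.apply_zero,
      inner_sub_left, inner_apply_of_isometric fun t => hiso t, ← hg,
      inner_self_eq_norm_sq_to_K] at h3
    have h4 : ‖g‖ ^ 2 ≤ ‖f‖ * ‖g‖ + Real.exp (a * t) * (D * ‖f‖ * (D₀ * ‖g‖)) := by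
      have h5 : ‖inner ℂ f (U₀ (-t) g)‖ ≤ ‖f‖ * ‖g‖ := by
        refine (norm_inner_le_norm _ _).trans ?_
        rw [hiso]
      have h6 := norm_sub_norm_le ((‖g‖ : ℂ) ^ 2) (inner ℂ f (U₀ (-t) g))
      have h7 : ‖(‖g‖ : ℂ) ^ 2‖ = ‖g‖ ^ 2 := by simp
      rw [h7] at h6
      have h8 := h6.trans h3
      linarith
    have h5 : 1 ≤ Real.exp (a * t) := Real.one_le_exp (by positivity)
    rcases eq_or_lt_of_le (norm_nonneg g) with h6 | h6
    · rw [← h6]; positivity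
    · have h7 : ‖g‖ * ‖g‖ ≤ ((1 + D * D₀) * Real.exp (a * t) * ‖f‖) * ‖g‖ := by
        have : ‖f‖ * ‖g‖ ≤ Real.exp (a * t) * (‖f‖ * ‖g‖) :=
          le_mul_of_one_le_left (by positivity) h5
        nlinarith
      exact le_of_mul_le_mul_right h7 h6
  have hlim : Tendsto (fun a => (1 + D * D₀) * Real.exp (a * t)) (𝓝[>] ω)
      (𝓝 ((1 + D * D₀) * Real.exp (ω * t))) :=
    (Continuous.tendsto (by fun_prop) ω).mono_left nhdsWithin_le_nhds
  exact ge_of_tendsto hlim (by filter_upwards [self_mem_nhdsWithin] with a ha using key a ha)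

/-- A bounded perturbation by a product of smooth operators is uniformly bounded for positive
times. -/
theorem IsPerturbation.exists_norm_le (h : IsPerturbation U₀ U (A.comp C))
    (hU₀ : IsC0Group U₀) (hU : IsC0Group U) (hiso : ∀ t f, ‖U₀ t f‖ = ‖f‖)
    (hA : ContinuousLinearMap.adjoint A = A) (hC : ∀ x, ‖C x‖ ≤ ‖A x‖)
    (hM : ResolventBound U₀ A M₀) (hM0 : 0 ≤ M₀)
    (hD : EnergyBound U A D) (hD0 : 0 ≤ D) (hD₀ : EnergyBound (fun t => U₀ (-t)) A D₀)
    (hD₀0 : 0 ≤ D₀) (hω0 : 0 ≤ ω) (hω : HasGrowth U ω) {t : ℝ} (ht : 0 ≤ t) :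
    ‖U t‖ ≤ 1 + D * D₀ := by
  set N := 1 + D * D₀ with hN
  have hN1 : 1 ≤ N := by rw [hN]; linarith [mul_nonneg hD0 hD₀0]
  set K := 1 + 2 * M₀ * D ^ 2 with hK
  have hK1 : 1 ≤ K := by rw [hK]; linarith [show 0 ≤ 2 * M₀ * D ^ 2 by positivity]
  have hbd : ∀ ω, 0 ≤ ω → HasGrowth U ω → ∀ t, 0 ≤ t → ‖U t‖ ≤ N * Real.exp (ω * t) :=
    fun ω hω0 hω t ht => h.norm_le_of_energyBound hU₀ hU hiso hA hC hD hD0 hD₀ hD₀0 hω0 hω ht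
  -- Averaging `‖U(t) f‖ ≤ N e^{a(t-r)} ‖U(r) f‖` over `0 < r < t` and inserting the square integral
  -- of the orbit gains a factor of order `1/(ωt)` over the trivial bound.
  have hdatko : ∀ ω, 0 < ω → HasGrowth U ω → ∀ t, 0 < t → ∀ f,
      t * ‖U t f‖ ^ 2 ≤ N ^ 2 * K / ω * Real.exp (ω * t) ^ 2 * ‖f‖ ^ 2 := by
    intro ω hω0 hω t ht f
    have key : ∀ a, ω < a →
        t * ‖U t f‖ ^ 2 ≤ N ^ 2 * K / a * Real.exp (a * t) ^ 2 * ‖f‖ ^ 2 := by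
      intro a ha
      have ha0 : 0 < a := hω0.trans ha
      have h1 := hD.lintegral_dampedOrbit_id_sq_le hD0 hM hM0 h hU₀ hU hiso hA hC hω0.le hω ha f
      have h2 : ∀ r ∈ Ioo 0 t, ENNReal.ofReal (‖U t f‖ ^ 2) ≤
          ENNReal.ofReal (N ^ 2 * Real.exp (a * t) ^ 2) *
            ‖dampedOrbit U a (ContinuousLinearMap.id ℂ H) f r‖ₑ ^ 2 := by
        intro r hr
        rw [dampedOrbit, indicator_of_mem (mem_Ioi.2 hr.1), ← ofReal_norm,
          ← ENNReal.ofReal_pow (norm_nonneg _), ← ENNReal.ofReal_mul (by positivity)]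
        refine ENNReal.ofReal_le_ofReal ?_
        rw [← mul_pow, ← mul_pow]
        refine pow_le_pow_left₀ (norm_nonneg _) ?_ 2
        rw [norm_smul, Complex.norm_real, Real.norm_of_nonneg (Real.exp_pos _).le,
          ContinuousLinearMap.id_apply]
        have h3 : U t f = U (t - r) (U r f) := by rw [← hU.apply_add, sub_add_cancel]
        have h4 : Real.exp (a * (t - r)) = Real.exp (a * t) * Real.exp (-a * r) := by
          rw [← Real.exp_add]; ring_nf
        have h5 : ‖U (t - r)‖ ≤ N * Real.exp (a * (t - r)) := by
          refine (hbd ω hω0.le hω _ (sub_nonneg.2 hr.2.le)).trans ?_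
          gcongr
          exact sub_nonneg.2 hr.2.le
        rw [h3]
        refine ((U (t - r)).le_of_opNorm_le h5 _).trans (le_of_eq ?_)
        rw [h4]; ring
      have h3 := setLIntegral_mono' (μ := volume) measurableSet_Ioo h2
      rw [setLIntegral_const, Real.volume_Ioo, sub_zero, lintegral_const_mul' _ _ (by finiteness)]
        at h3
      have h4 : ENNReal.ofReal (‖U t f‖ ^ 2) * ENNReal.ofReal t ≤
          ENNReal.ofReal (N ^ 2 * Real.exp (a * t) ^ 2) * ENNReal.ofReal (K / a * ‖f‖ ^ 2) :=
        h3.trans (mul_le_mul_right ((lintegral_mono' Measure.restrict_le_self le_rfl).trans h1) _)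
      rw [← ENNReal.ofReal_mul (by positivity), ← ENNReal.ofReal_mul (by positivity),
        ENNReal.ofReal_le_ofReal_iff (by positivity)] at h4
      calc _ = ‖U t f‖ ^ 2 * t := mul_comm _ _
        _ ≤ _ := h4
        _ = _ := by ring
    have hlim : Tendsto (fun a => N ^ 2 * K / a * Real.exp (a * t) ^ 2 * ‖f‖ ^ 2) (𝓝[>] ω)
        (𝓝 (N ^ 2 * K / ω * Real.exp (ω * t) ^ 2 * ‖f‖ ^ 2)) := by
      refine Tendsto.mono_left ?_ nhdsWithin_le_nhds
      refine ((tendsto_const_nhds.div tendsto_id hω0.ne').mul ?_).mul_const _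
      exact Continuous.tendsto (by fun_prop) ω
    exact ge_of_tendsto hlim (by filter_upwards [self_mem_nhdsWithin] with a ha using key a ha)
  -- At time `4 N² K / ω` the gain in the averaged estimate is `1/2 ≤ e^{-1/2}`, which lowers the
  -- exponent by `1/2` divided by that time, namely `ω / (8 N² K)`. The factor `q` is independent of
  -- `ω`, so the step can be iterated.
  set q := 1 - 1 / (8 * (N ^ 2 * K)) with hq
  have hNK : 1 ≤ N ^ 2 * K := by nlinarith [one_le_pow₀ hN1 (n := 2)]
  have hq0 : 0 ≤ q := by
    rw [hq, sub_nonneg, div_le_one (by positivity)]; linarith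
  have hq1 : q < 1 := by
    rw [hq]; linarith [show 0 < 1 / (8 * (N ^ 2 * K)) by positivity]
  have hstep : ∀ ω, 0 ≤ ω → HasGrowth U ω → HasGrowth U (ω * q) := by
    intro ω hω0 hω
    rcases eq_or_lt_of_le hω0 with h0 | h0
    · rw [← h0, zero_mul, h0]; exact hω
    · have ht₀ : 0 < 4 * (N ^ 2 * K) / ω := by positivity
      refine hω.of_norm_le hU (by positivity) hω0 ht₀ ?_
      set t₀ := 4 * (N ^ 2 * K) / ω with ht₀'
      have h1 : ω * q * t₀ = ω * t₀ + -(1 / 2) := by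
        rw [hq, ht₀']; field_simp; ring
      refine ContinuousLinearMap.opNorm_le_bound _ (Real.exp_pos _).le fun f => ?_
      have h2 := hdatko ω h0 hω t₀ ht₀ f
      have h3 : N ^ 2 * K / ω = t₀ * (1 / 2) ^ 2 := by
        rw [ht₀']; ring
      rw [h3, mul_assoc, mul_assoc] at h2
      have h4 := le_of_mul_le_mul_left h2 ht₀
      rw [← mul_pow, ← mul_pow] at h4
      have h5 := le_of_sq_le_sq h4 (by positivity)
      have h6 : (1 / 2 : ℝ) ≤ Real.exp (-(1 / 2)) := by
        have := Real.add_one_le_exp (-(1 / 2) : ℝ)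
        linarith
      rw [h1, Real.exp_add]
      calc ‖U t₀ f‖ ≤ 1 / 2 * (Real.exp (ω * t₀) * ‖f‖) := h5
        _ ≤ Real.exp (-(1 / 2)) * (Real.exp (ω * t₀) * ‖f‖) := by gcongr
        _ = _ := by ring
  have hpow : ∀ n : ℕ, HasGrowth U (ω * q ^ n) := by
    intro n
    induction n with
    | zero => simpa using hω
    | succ n ih =>
      rw [pow_succ, ← mul_assoc]
      exact hstep _ (by positivity) ih
  have hlim : Tendsto (fun n : ℕ => N * Real.exp (ω * q ^ n * t)) atTop (𝓝 N) := by
    have h1 : Tendsto (fun n : ℕ => q ^ n) atTop (𝓝 0) :=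
      tendsto_pow_atTop_nhds_zero_of_lt_one hq0 hq1
    have h2 : Continuous fun x : ℝ => N * Real.exp (ω * x * t) := by fun_prop
    simpa [Function.comp_def] using (h2.tendsto 0).comp h1
  -- Every exponent `ω qⁿ` is admissible with the same `N`, so the exponential disappears in the
  -- limit.
  exact ge_of_tendsto' hlim fun n => hbd _ (by positivity) (hpow n) t ht

end UniformBound

/-! ### Wave operators -/

theorem tendsto_lintegral_Ioi_atTop {u : ℝ → ℝ≥0∞} (hu : ∫⁻ t in Ioi 0, u t ≠ ∞) :
    Tendsto (fun s => ∫⁻ t in Ioi s, u t) atTop (𝓝 0) := by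
  have h := tendsto_measure_iInter_atTop (μ := volume.withDensity u) (s := fun s : ℝ => Ioi s)
    (fun s => measurableSet_Ioi.nullMeasurableSet) (fun s t hst => Ioi_subset_Ioi hst)
    ⟨0, by rwa [withDensity_apply _ measurableSet_Ioi]⟩
  have h2 : ⋂ s : ℝ, Ioi s = ∅ := by
    ext x
    simpa using ⟨x, le_rfl⟩
  rw [h2, measure_empty] at h
  refine h.congr fun s => ?_
  rw [Function.comp_apply, withDensity_apply _ measurableSet_Ioi]

section Wave

variable {H : Type*} [NormedAddCommGroup H] [InnerProductSpace ℂ H]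
  {U₀ U U' : ℝ → H →L[ℂ] H} {A B C C' : H →L[ℂ] H} {ω a M M₀ D D₀ N : ℝ}

theorem enorm_le_of_enorm_inner_le {x : H} {c : ℝ≥0∞}
    (h : ∀ g : H, ‖inner ℂ x g‖ₑ ≤ c * ‖g‖ₑ) : ‖x‖ₑ ≤ c := by
  rcases eq_or_ne x 0 with h0 | h0
  · simp [h0]
  · have h1 := h x
    have h2 : ‖inner ℂ x x‖ₑ = ‖x‖ₑ * ‖x‖ₑ := by
      rw [inner_self_eq_norm_sq_to_K, ← ofReal_norm, ← ofReal_norm,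
        ← ENNReal.ofReal_mul (norm_nonneg _), ← pow_two]
      simp
    rw [h2] at h1
    exact (ENNReal.mul_le_mul_iff_left (by simpa using h0) (by finiteness)).1 h1

/-- Uniformity in the test vector turns a bound on inner products into one on norms; the tail of a
convergent integral then gives the Cauchy property. -/
theorem exists_tendsto_of_inner_bound [CompleteSpace H] {x : ℝ → H} {u : ℝ → ℝ≥0∞}
    (hu : ∫⁻ t in Ioi 0, u t ^ 2 ≠ ∞)
    (h : ∀ s t, 0 ≤ s → s ≤ t → ∀ g,
      ‖inner ℂ (x t - x s) g‖ₑ ≤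
        ((∫⁻ r in Ioi s, u r ^ 2) ^ (1 / 2 : ℝ) * ENNReal.ofReal D) * ‖g‖ₑ) :
    ∃ y, Tendsto x atTop (𝓝 y) := by
  have h0 : Tendsto (fun s => (∫⁻ r in Ioi s, u r ^ 2) ^ (1 / 2 : ℝ) * ENNReal.ofReal D) atTop
      (𝓝 0) := by
    have h1 := (ENNReal.continuous_rpow_const (y := 1 / 2)).tendsto 0
    rw [ENNReal.zero_rpow_of_pos (by norm_num)] at h1
    have h2 := ENNReal.Tendsto.mul_const (b := ENNReal.ofReal D)
      (h1.comp (tendsto_lintegral_Ioi_atTop hu)) (Or.inr (by finiteness))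
    rwa [zero_mul] at h2
  refine cauchySeq_tendsto_of_complete (EMetric.cauchySeq_iff.2 fun ε hε => ?_)
  obtain ⟨n, hn, hn0⟩ := ((h0.eventually (gt_mem_nhds hε)).and (eventually_ge_atTop 0)).exists
  refine ⟨n, ?_⟩
  have key : ∀ s t, n ≤ s → s ≤ t → edist (x t) (x s) < ε := by
    intro s t hs hst
    rw [edist_eq_enorm_sub]
    refine (enorm_le_of_enorm_inner_le (h s t (hn0.trans hs) hst)).trans_lt (lt_of_le_of_lt ?_ hn)
    gcongr
  intro s hs t ht
  rcases le_total s t with hst | hst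
  · rw [edist_comm]; exact key s t hs hst
  · exact key t s ht hst

/-- A uniformly bounded group with a smooth operator, for positive times. -/
structure IsSmoothGroup (U : ℝ → H →L[ℂ] H) (A : H →L[ℂ] H) : Prop extends IsC0Group U where
  bounded : ∃ N : ℝ, ∀ t, 0 ≤ t → ‖U t‖ ≤ N
  smooth : ∃ D : ℝ, 0 ≤ D ∧
    ∀ f, ∫⁻ t in Ioi 0, ‖A (U t f)‖ₑ ^ 2 ≤ ENNReal.ofReal (D * ‖f‖) ^ 2

theorem IsSmoothGroup.tail_le {U : ℝ → H →L[ℂ] H}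
    (hD : ∀ f, ∫⁻ t in Ioi 0, ‖A (U t f)‖ₑ ^ 2 ≤ ENNReal.ofReal (D * ‖f‖) ^ 2) (hD0 : 0 ≤ D)
    {s : ℝ} (hs : 0 ≤ s) (f : H) :
    (∫⁻ r in Ioi s, ‖A (U r f)‖ₑ ^ 2) ^ (1 / 2 : ℝ) ≤ ENNReal.ofReal D * ‖f‖ₑ := by
  have h1 := (lintegral_mono_set (Ioi_subset_Ioi hs)).trans (hD f)
  have hsq : ∀ x : ℝ≥0∞, (x ^ 2) ^ (1 / 2 : ℝ) = x := fun x => by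
    rw [← ENNReal.rpow_ofNat, ← ENNReal.rpow_mul]; simp
  rw [← ofReal_norm, ← ENNReal.ofReal_mul hD0]
  conv_rhs => rw [← hsq (ENNReal.ofReal (D * ‖f‖))]
  gcongr

/-- The approximating products are inverse to each other and uniformly bounded, so the limits
compose. Invariance of the filter under translation gives the intertwining relation, for both signs
at once. -/
theorem IsC0Group.wave_operators_inverse {l : Filter ℝ} [l.NeBot] (hl : ∀ s, Tendsto (s + ·) l l)
    (hU₀ : IsC0Group U₀) (hU : IsC0Group U) (hiso : ∀ t f, ‖U₀ t f‖ = ‖f‖)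
    (hN : ∀ t, ‖U t‖ ≤ N) {W W' : H →L[ℂ] H}
    (hW : ∀ f, Tendsto (fun t => U t (U₀ (-t) f)) l (𝓝 (W f)))
    (hW' : ∀ f, Tendsto (fun t => U₀ t (U (-t) f)) l (𝓝 (W' f))) :
    (∀ f, W' (W f) = f) ∧ (∀ f, W (W' f) = f) ∧ ∀ s f, U s (W f) = W (U₀ s f) := by
  -- Uniformly bounded operators may be evaluated along a convergent family of vectors in place of
  -- its limit.
  have hcongr : ∀ {S : ℝ → H →L[ℂ] H} {c : ℝ} {x : ℝ → H} {y z : H},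
      (∀ t v, ‖S t v‖ ≤ c * ‖v‖) → Tendsto x l (𝓝 y) → Tendsto (fun t => S t y) l (𝓝 z) →
      Tendsto (fun t => S t (x t)) l (𝓝 z) := by
    intro S c x y z hS hx hz
    have h1 : Tendsto (fun t => S t (x t - y)) l (𝓝 0) := by
      refine squeeze_zero_norm (fun t => hS t _) ?_
      have := (tendsto_iff_norm_sub_tendsto_zero.1 hx).const_mul c
      rwa [mul_zero] at this
    have h2 := h1.add hz
    simpa using h2
  refine ⟨fun f => ?_, fun f => ?_, fun s f => ?_⟩
  · have h1 := hcongr (S := fun t => (U₀ t).comp (U (-t))) (c := N) (fun t v => ?_) (hW f)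
      (hW' (W f))
    · refine tendsto_nhds_unique h1 ?_
      simp only [ContinuousLinearMap.comp_apply, hU.apply_neg_apply, hU₀.apply_apply_neg]
      exact tendsto_const_nhds
    · rw [ContinuousLinearMap.comp_apply, hiso]
      exact (U (-t)).le_of_opNorm_le (hN _) v
  · have h1 := hcongr (S := fun t => (U t).comp (U₀ (-t))) (c := N) (fun t v => ?_) (hW' f)
      (hW (W' f))
    · refine tendsto_nhds_unique h1 ?_
      simp only [ContinuousLinearMap.comp_apply, hU₀.apply_neg_apply, hU.apply_apply_neg]
      exact tendsto_const_nhds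
    · rw [ContinuousLinearMap.comp_apply, ← hiso (-t) v]
      exact (U t).le_of_opNorm_le (hN _) _
  · have h1 := ((U s).continuous.tendsto _).comp (hW f)
    refine tendsto_nhds_unique h1 (((hW (U₀ s f)).comp (hl s)).congr fun t => ?_)
    simp only [Function.comp_apply]
    rw [neg_add_rev, ← hU₀.apply_add, ← hU.apply_add, neg_add_cancel_right]

variable [CompleteSpace H]

theorem IsPerturbation.isSmoothGroup (h : IsPerturbation U₀ U (A.comp C))
    (hU₀ : IsC0Group U₀) (hU : IsC0Group U) (hiso : ∀ t f, ‖U₀ t f‖ = ‖f‖)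
    (hA : ContinuousLinearMap.adjoint A = A) (hC : ∀ x, ‖C x‖ ≤ ‖A x‖)
    (hM₀0 : 0 ≤ M₀) (hM₀ : ResolventBound U₀ A M₀)
    (hM₀' : ResolventBound (fun t => U₀ (-t)) A M₀) (hM0 : 0 ≤ M) (hM : ResolventBound U A M)
    (hω0 : 0 ≤ ω) (hω : HasGrowth U ω) : IsSmoothGroup U A := by
  have hD₀ := hM₀.energyBound_of_isometric hM₀0 hU₀ hiso hA
  have hD₀' := hM₀'.energyBound_of_isometric hM₀0 hU₀.neg (fun t => hiso (-t)) hA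
  have hD := hD₀.of_isPerturbation hM hM0 h hU₀ hU hiso hC
  have hN := fun t ht => h.exists_norm_le hU₀ hU hiso hA hC hM₀ hM₀0 hD (by positivity) hD₀'
    (by positivity) hω0 hω (t := t) ht
  refine ⟨hU, ⟨_, hN⟩, (1 + M) * √(2 * M₀), by positivity, hD.lintegral_le hU
    ⟨1 + (1 + M) * √(2 * M₀) * √(2 * M₀), fun t ht => ?_⟩⟩
  rw [zero_mul, Real.exp_zero, mul_one]
  exact hN t ht

theorem IsSmoothGroup.of_isometric (hU₀ : IsC0Group U₀) (hiso : ∀ t f, ‖U₀ t f‖ = ‖f‖)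
    (hA : ContinuousLinearMap.adjoint A = A) (hM₀0 : 0 ≤ M₀) (hM₀ : ResolventBound U₀ A M₀) :
    IsSmoothGroup U₀ A := by
  refine ⟨hU₀, ⟨1, fun t _ => ContinuousLinearMap.opNorm_le_bound _ zero_le_one fun f => ?_⟩, _, ?_,
    (hM₀.energyBound_of_isometric hM₀0 hU₀ hiso hA).lintegral_le hU₀
      (hasGrowth_zero_of_isometric hiso)⟩
  · rw [hiso, one_mul]
  · positivity

/-- The sandwiched resolvent of the adjoint group at `p` is the adjoint of the original one at the
conjugate point, since `A` is self-adjoint. -/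
theorem ResolventBound.adjoint (hM : ResolventBound U A M) (hM0 : 0 ≤ M) (hU : IsC0Group U)
    (hU' : IsC0Group U') (had : ∀ t, 0 ≤ t → U' t = ContinuousLinearMap.adjoint (U t))
    (hA : ContinuousLinearMap.adjoint A = A) : ResolventBound U' A M := by
  intro ω hω0 hω p hp h
  have hω' : HasGrowth U ω := by
    obtain ⟨K, hK⟩ := hω
    refine ⟨K, fun t ht => ?_⟩
    rw [← LinearIsometryEquiv.norm_map ContinuousLinearMap.adjoint, ← had t ht]
    exact hK t ht
  have hp' : ω < (star p).re := by simpa using hp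
  have h1 := hU.adjoint_laplaceTransform hω' hp' hU' had
  rw [star_star] at h1
  have h2 : A.comp ((laplaceTransform U' p).comp A) =
      ContinuousLinearMap.adjoint (A.comp ((laplaceTransform U (star p)).comp A)) := by
    rw [ContinuousLinearMap.adjoint_comp, ContinuousLinearMap.adjoint_comp, hA, h1]
    rfl
  change ‖(A.comp ((laplaceTransform U' p).comp A)) h‖ ≤ _
  rw [h2]
  refine ContinuousLinearMap.le_of_opNorm_le _ ?_ h
  rw [LinearIsometryEquiv.norm_map]
  exact ContinuousLinearMap.opNorm_le_bound _ hM0 (hM ω hω0 hω' _ hp')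

theorem IsPerturbation.enorm_inner_sub_le_tail (h : IsPerturbation U₀ U (A.comp C))
    (hU₀ : IsC0Group U₀) (hU : IsC0Group U) (hiso : ∀ t f, ‖U₀ t f‖ = ‖f‖)
    (hA : ContinuousLinearMap.adjoint A = A) (hC : ∀ x, ‖C x‖ ≤ ‖A x‖) {s t : ℝ} (hst : s ≤ t)
    (f g : H) :
    ‖inner ℂ (U₀ (-t) (U t f) - U₀ (-s) (U s f)) g‖ₑ ≤
      (∫⁻ r in Ioi s, ‖A (U r f)‖ₑ ^ 2) ^ (1 / 2 : ℝ) *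
        (∫⁻ r in Ioi s, ‖A (U₀ r g)‖ₑ ^ 2) ^ (1 / 2 : ℝ) := by
  refine (h.enorm_inner_sub_le hU₀ hU hiso hA hC hst f g).trans ?_
  refine (lintegral_mono_set Ioo_subset_Ioi_self).trans ?_
  have hs : ∀ x : ℝ≥0∞, (x ^ (1 / 2 : ℝ)) ^ 2 = x := fun x => by
    rw [← ENNReal.rpow_ofNat, ← ENNReal.rpow_mul]; simp
  refine ENNReal.lintegral_mul_le_of_lintegral_sq_le ?_ (hs _).ge (hs _).ge ?_
  · exact (A.continuous.comp (hU.continuous f)).enorm.aemeasurable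
  · exact (A.continuous.comp (hU₀.continuous g)).enorm.aemeasurable

/-- Existence of the wave operators for positive times. -/
theorem IsPerturbation.exists_tendsto (h : IsPerturbation U₀ U (A.comp C))
    (h' : IsPerturbation U₀ U' (A.comp C')) (hU₀ : IsSmoothGroup U₀ A) (hU : IsSmoothGroup U A)
    (hU' : IsSmoothGroup U' A) (hiso : ∀ t f, ‖U₀ t f‖ = ‖f‖)
    (hA : ContinuousLinearMap.adjoint A = A) (hC : ∀ x, ‖C x‖ ≤ ‖A x‖)
    (hC' : ∀ x, ‖C' x‖ ≤ ‖A x‖) (hdual : ∀ t f g, inner ℂ (U t f) (U' t g) = inner ℂ f g) :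
    ∃ W W' : H →L[ℂ] H, (∀ f, Tendsto (fun t => U (-t) (U₀ t f)) atTop (𝓝 (W f))) ∧
      ∀ f, Tendsto (fun t => U₀ (-t) (U t f)) atTop (𝓝 (W' f)) := by
  obtain ⟨D₀, hD₀0, hD₀⟩ := hU₀.smooth
  obtain ⟨D, hD0, hD⟩ := hU.smooth
  obtain ⟨D', hD'0, hD'⟩ := hU'.smooth
  have h1 : ∀ f, ∃ y, Tendsto (fun t => U₀ (-t) (U t f)) atTop (𝓝 y) := by
    intro f
    refine exists_tendsto_of_inner_bound (u := fun r => ‖A (U r f)‖ₑ) (D := D₀)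
      (ne_top_of_le_ne_top (by finiteness) (hD f)) fun s t hs hst g => ?_
    refine (h.enorm_inner_sub_le_tail hU₀.toIsC0Group hU.toIsC0Group hiso hA hC hst f g).trans ?_
    rw [mul_assoc]
    gcongr
    exact IsSmoothGroup.tail_le hD₀ hD₀0 hs g
  -- The adjoint of `U(-t) U₀(t)` is a Duhamel product for the dual group, so the convergent tail
  -- now belongs to the free orbit and the uniform factor to the dual group.
  have hadj : ∀ t f g, inner ℂ (U (-t) (U₀ t f)) g = inner ℂ f (U₀ (-t) (U' t g)) := by
    intro t f g
    rw [← hdual t, hU.apply_apply_neg, ← inner_apply_of_isometric hiso (-t), hU₀.apply_neg_apply]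
  have h2 : ∀ f, ∃ y, Tendsto (fun t => U (-t) (U₀ t f)) atTop (𝓝 y) := by
    intro f
    refine exists_tendsto_of_inner_bound (u := fun r => ‖A (U₀ r f)‖ₑ) (D := D')
      (ne_top_of_le_ne_top (by finiteness) (hD₀ f)) fun s t hs hst g => ?_
    rw [inner_sub_left, hadj, hadj, ← inner_sub_right, ← inner_conj_symm, RCLike.enorm_conj]
    refine (h'.enorm_inner_sub_le_tail hU₀.toIsC0Group hU'.toIsC0Group hiso hA hC' hst g f).trans ?_
    rw [mul_comm, mul_assoc]
    gcongr
    exact IsSmoothGroup.tail_le hD' hD'0 hs g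
  choose w hw using h2
  choose w' hw' using h1
  exact ⟨continuousLinearMapOfTendsto (fun t => (U (-t)).comp (U₀ t)) (tendsto_pi_nhds.2 hw),
    continuousLinearMapOfTendsto (fun t => (U₀ (-t)).comp (U t)) (tendsto_pi_nhds.2 hw'), hw, hw'⟩

/-- Kato's theorem on smooth perturbations: the perturbed group is uniformly bounded and the wave
operators exist. -/
theorem IsPerturbation.exists_wave_operators (h : IsPerturbation U₀ U (A.comp C))
    (hU₀ : IsC0Group U₀) (hU : IsC0Group U) (hiso : ∀ t f, ‖U₀ t f‖ = ‖f‖)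
    (hA : ContinuousLinearMap.adjoint A = A) (hC : ∀ x, ‖C x‖ ≤ ‖A x‖)
    (hC' : ∀ x, ‖C' x‖ ≤ ‖A x‖)
    (hdual : ∀ f g, inner ℂ (A (C f)) g + inner ℂ f (A (C' g)) = 0)
    {K : ℝ} (hω0 : 0 ≤ ω) (hω : ∀ t, ‖U t‖ ≤ K * Real.exp (ω * |t|))
    (hM₀0 : 0 ≤ M₀) (hM₀ : ResolventBound U₀ A M₀)
    (hM₀' : ResolventBound (fun t => U₀ (-t)) A M₀) (hM0 : 0 ≤ M) (hM : ResolventBound U A M)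
    (hM' : ResolventBound (fun t => U (-t)) A M) :
    (∃ N, ∀ t, ‖U t‖ ≤ N) ∧ ∃ Wp Wm Wp' Wm' : H →L[ℂ] H,
      (∀ f, Tendsto (fun t : ℝ => U t (U₀ (-t) f)) atTop (𝓝 (Wp f))) ∧
      (∀ f, Tendsto (fun t : ℝ => U t (U₀ (-t) f)) atBot (𝓝 (Wm f))) ∧
      (∀ f, Tendsto (fun t : ℝ => U₀ t (U (-t) f)) atTop (𝓝 (Wp' f))) ∧
      (∀ f, Tendsto (fun t : ℝ => U₀ t (U (-t) f)) atBot (𝓝 (Wm' f))) := by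
  -- This group has `U'(t) = U(-t)*`; its resolvent bounds are inherited by taking adjoints and need
  -- no analysis of their own.
  obtain ⟨U', hU', h', -⟩ := exists_perturbation hU₀ hiso (A.comp C')
  have hadj : ∀ t, U' (-t) = ContinuousLinearMap.adjoint (U t) := fun t =>
    h.adjoint_eq h' hU hU' hiso hdual t
  have hadj' : ∀ t, U' t = ContinuousLinearMap.adjoint (U (-t)) := fun t => by
    rw [← hadj, neg_neg]
  have hM'U : ResolventBound U' A M := hM'.adjoint hM0 hU.neg hU' (fun t _ => hadj' t) hA
  have hMU' : ResolventBound (fun t => U' (-t)) A M :=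
    hM.adjoint hM0 hU hU'.neg (fun t _ => hadj t) hA
  have hg : HasGrowth U ω := ⟨K, fun t ht => by simpa [abs_of_nonneg ht] using hω t⟩
  have hg' : HasGrowth (fun t => U (-t)) ω :=
    ⟨K, fun t ht => by simpa [abs_of_nonneg ht] using hω (-t)⟩
  have hgU' : HasGrowth U' ω := by
    obtain ⟨L, hL⟩ := hg'
    refine ⟨L, fun t ht => ?_⟩
    rw [hadj', LinearIsometryEquiv.norm_map]
    exact hL t ht
  have hgU'' : HasGrowth (fun t => U' (-t)) ω := by
    obtain ⟨L, hL⟩ := hg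
    refine ⟨L, fun t ht => ?_⟩
    beta_reduce
    rw [hadj, LinearIsometryEquiv.norm_map]
    exact hL t ht
  have hneg : ∀ C : H →L[ℂ] H, -(A.comp C) = A.comp (-C) := fun C => by
    rw [ContinuousLinearMap.comp_neg]
  have hn := h.neg
  have hn' := h'.neg
  rw [hneg] at hn hn'
  have hCn : ∀ x, ‖(-C) x‖ ≤ ‖A x‖ := fun x => by
    rw [_root_.neg_apply, norm_neg]; exact hC x
  have hCn' : ∀ x, ‖(-C') x‖ ≤ ‖A x‖ := fun x => by
    rw [_root_.neg_apply, norm_neg]; exact hC' x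
  have hison : ∀ t f, ‖U₀ (-t) f‖ = ‖f‖ := fun t => hiso (-t)
  have hM₀'' : ResolventBound (fun t => U₀ (- -t)) A M₀ := by simpa only [neg_neg] using hM₀
  have s₀ := IsSmoothGroup.of_isometric hU₀ hiso hA hM₀0 hM₀
  have s₀' := IsSmoothGroup.of_isometric hU₀.neg hison hA hM₀0 hM₀'
  have s₁ := h.isSmoothGroup hU₀ hU hiso hA hC hM₀0 hM₀ hM₀' hM0 hM hω0 hg
  have s₁' := hn.isSmoothGroup hU₀.neg hU.neg hison hA hCn hM₀0 hM₀' hM₀'' hM0 hM' hω0 hg'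
  have s₂ := h'.isSmoothGroup hU₀ hU' hiso hA hC' hM₀0 hM₀ hM₀' hM0 hM'U hω0 hgU'
  have s₂' := hn'.isSmoothGroup hU₀.neg hU'.neg hison hA hCn' hM₀0 hM₀' hM₀'' hM0 hMU' hω0 hgU''
  have hdual' : ∀ t f g, inner ℂ (U t f) (U' t g) = inner ℂ f g :=
    h.inner_apply_apply h' hU hU' hiso hdual
  -- Forward time yields `U(-t) U₀(t)`, which is the limit at `-∞` of `U(t) U₀(-t)`; the
  -- time-reversed groups supply the limit at `+∞`.
  obtain ⟨Wm, Wm', hWm, hWm'⟩ := h.exists_tendsto h' s₀ s₁ s₂ hiso hA hC hC' hdual'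
  obtain ⟨Wp, Wp', hWp, hWp'⟩ := hn.exists_tendsto hn' s₀' s₁' s₂' hison hA hCn hCn'
    (fun t => hdual' (-t))
  simp only [neg_neg] at hWp hWp'
  refine ⟨?_, Wp, Wm, Wp', Wm', hWp, fun f => ?_, hWp', fun f => ?_⟩
  · obtain ⟨N₁, hN₁⟩ := s₁.bounded
    obtain ⟨N₂, hN₂⟩ := s₁'.bounded
    refine ⟨max N₁ N₂, fun t => ?_⟩
    rcases le_total 0 t with ht | ht
    · exact (hN₁ t ht).trans (le_max_left _ _)
    · have := hN₂ (-t) (by linarith)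
      rw [neg_neg] at this
      exact this.trans (le_max_right _ _)
  · refine ((hWm f).comp tendsto_neg_atBot_atTop).congr fun t => ?_
    simp only [Function.comp_apply, neg_neg]
  · refine ((hWm' f).comp tendsto_neg_atBot_atTop).congr fun t => ?_
    simp only [Function.comp_apply, neg_neg]

end Wave

/-! ### The sine transform -/

/-- The sine transform of an integrable function on the half-line. -/
noncomputable def sineIntegral (u : ℝ → ℂ) (ξ : ℝ) : ℂ :=
  2 * ∫ s in Ioi (0 : ℝ), (Real.sin (2 * Real.pi * ξ * s) : ℂ) * u s

/-- The odd extension of a function on the half-line. -/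
noncomputable def oddExtension (u : ℝ → ℂ) (x : ℝ) : ℂ :=
  indicator (Ioi 0) u x - indicator (Ioi 0) u (-x)

theorem integrableOn_sin_mul {u : ℝ → ℂ} (hu : IntegrableOn u (Ioi 0)) (ξ : ℝ) :
    IntegrableOn (fun s : ℝ => (Real.sin (2 * Real.pi * ξ * s) : ℂ) * u s) (Ioi 0) := by
  refine Integrable.bdd_mul (c := 1) hu (Continuous.aestronglyMeasurable (by fun_prop))
    (Eventually.of_forall fun s => ?_)
  rw [Complex.norm_real, Real.norm_eq_abs]
  exact Real.abs_sin_le_one _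

theorem sineIntegral_congr {u v : ℝ → ℂ} (h : u =ᵐ[volume.restrict (Ioi (0 : ℝ))] v) :
    sineIntegral u = sineIntegral v := by
  ext ξ
  rw [sineIntegral, sineIntegral]
  congr 1
  refine integral_congr_ae ?_
  filter_upwards [h] with s hs
  rw [hs]

theorem sineIntegral_add {u v : ℝ → ℂ} (hu : IntegrableOn u (Ioi 0)) (hv : IntegrableOn v (Ioi 0))
    (ξ : ℝ) : sineIntegral (fun s => u s + v s) ξ = sineIntegral u ξ + sineIntegral v ξ := by
  simp only [sineIntegral, mul_add]
  rw [integral_add (integrableOn_sin_mul hu ξ) (integrableOn_sin_mul hv ξ), mul_add]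

theorem sineIntegral_const_mul (c : ℂ) (u : ℝ → ℂ) (ξ : ℝ) :
    sineIntegral (fun s => c * u s) ξ = c * sineIntegral u ξ := by
  simp only [sineIntegral, mul_left_comm _ c]
  rw [integral_const_mul, mul_left_comm]

theorem sineIntegral_neg (u : ℝ → ℂ) (ξ : ℝ) : sineIntegral u (-ξ) = -sineIntegral u ξ := by
  simp only [sineIntegral, mul_neg, neg_mul, Real.sin_neg, Complex.ofReal_neg]
  rw [integral_neg, mul_neg]

theorem integrable_oddExtension {u : ℝ → ℂ} (hu : IntegrableOn u (Ioi 0)) :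
    Integrable (oddExtension u) := by
  have h := (integrable_indicator_iff measurableSet_Ioi).2 hu
  exact h.sub h.comp_neg

theorem memLp_oddExtension {u : ℝ → ℂ} (hu : MemLp u 2 (volume.restrict (Ioi 0))) :
    MemLp (oddExtension u) 2 volume := by
  have h := (memLp_indicator_iff_restrict measurableSet_Ioi).2 hu
  exact h.sub (h.comp_measurePreserving (Measure.measurePreserving_neg volume))

/-- The two half-lines contribute conjugate exponentials of opposite sign, and their difference is
`-2i` times a sine. -/
theorem fourier_oddExtension {u : ℝ → ℂ} (hu : IntegrableOn u (Ioi 0)) (ξ : ℝ) :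
    𝓕 (oddExtension u) ξ = -Complex.I * sineIntegral u ξ := by
  have h := (integrable_indicator_iff measurableSet_Ioi).2 hu
  have hc : ∀ c : ℝ, IntegrableOn (fun v : ℝ => Complex.exp ((c * v : ℝ) * Complex.I) * u v)
      (Ioi 0) := by
    intro c
    refine Integrable.bdd_mul (c := 1) hu (Continuous.aestronglyMeasurable (by fun_prop))
      (Eventually.of_forall fun s => ?_)
    rw [Complex.norm_exp_ofReal_mul_I]
  have h1 : ∀ c : ℝ, ∫ v : ℝ, Complex.exp ((c * v : ℝ) * Complex.I) * indicator (Ioi 0) u v =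
      ∫ v in Ioi (0 : ℝ), Complex.exp ((c * v : ℝ) * Complex.I) * u v := by
    intro c
    rw [← integral_indicator measurableSet_Ioi]
    congr 1
    ext v
    by_cases hv : v ∈ Ioi (0 : ℝ)
    · rw [indicator_of_mem hv, indicator_of_mem hv]
    · rw [indicator_of_notMem hv, indicator_of_notMem hv, mul_zero]
  have hi : ∀ c : ℝ, Integrable fun v : ℝ =>
      Complex.exp ((c * v : ℝ) * Complex.I) * indicator (Ioi 0) u v := by
    intro c
    refine Integrable.bdd_mul (c := 1) h (Continuous.aestronglyMeasurable (by fun_prop))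
      (Eventually.of_forall fun s => ?_)
    rw [Complex.norm_exp_ofReal_mul_I]
  have h2 : ∀ v : ℝ, Complex.exp ((-2 * Real.pi * v * ξ : ℝ) * Complex.I) • oddExtension u v =
      Complex.exp ((-2 * Real.pi * ξ * v : ℝ) * Complex.I) * indicator (Ioi 0) u v -
      Complex.exp ((2 * Real.pi * ξ * (-v) : ℝ) * Complex.I) * indicator (Ioi 0) u (-v) := by
    intro v
    rw [oddExtension, smul_eq_mul, mul_sub,
      show -2 * Real.pi * v * ξ = -2 * Real.pi * ξ * v by ring,
      show -2 * Real.pi * ξ * v = 2 * Real.pi * ξ * (-v) by ring]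
  rw [Real.fourier_real_eq_integral_exp_smul]
  simp_rw [h2]
  rw [integral_sub (hi _) (hi _).comp_neg,
    integral_neg_eq_self fun v : ℝ => Complex.exp ((2 * Real.pi * ξ * v : ℝ) * Complex.I) *
      indicator (Ioi 0) u v, h1, h1, ← integral_sub (hc _) (hc _), sineIntegral,
    ← integral_const_mul, ← integral_const_mul]
  refine integral_congr_ae (Eventually.of_forall fun v => ?_)
  beta_reduce
  rw [← sub_mul, ← mul_assoc, ← mul_assoc]
  congr 1
  rw [Complex.ofReal_sin, show (-2 * Real.pi * ξ * v : ℝ) = -(2 * Real.pi * ξ * v) by ring,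
    Complex.ofReal_neg, Complex.exp_mul_I, Complex.exp_mul_I, Complex.cos_neg, Complex.sin_neg]
  ring

theorem continuous_sineIntegral {u : ℝ → ℂ} (hu : IntegrableOn u (Ioi 0)) :
    Continuous (sineIntegral u) := by
  have h := (continuous_fourier_of_integrable (integrable_oddExtension hu)).const_smul Complex.I
  refine h.congr fun ξ => ?_
  rw [Pi.smul_apply, fourier_oddExtension hu, smul_eq_mul, ← mul_assoc]
  simp

theorem lintegral_eq_two_mul_of_even {v : ℝ → ℝ≥0∞} (hv : ∀ x, v (-x) = v x) :
    ∫⁻ x, v x = 2 * ∫⁻ x in Ioi 0, v x := by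
  rw [← lintegral_add_compl v measurableSet_Ioi (A := Ioi (0 : ℝ)), compl_Ioi, two_mul]
  congr 1
  rw [← restrict_Iio_eq_restrict_Iic]
  have h := (Measure.measurePreserving_neg (volume : Measure ℝ)).setLIntegral_comp_preimage_emb
    (MeasurableEquiv.neg ℝ).measurableEmbedding v (Ioi 0)
  have h2 : Neg.neg ⁻¹' Ioi (0 : ℝ) = Iio 0 := by ext x; simp
  rw [h2] at h
  rw [← h]
  simp only [hv]

/-- Plancherel for the odd extension; on both sides the integrand is even, and the factors `2`
cancel. -/
theorem lintegral_enorm_sineIntegral_sq {u : ℝ → ℂ} (hu : IntegrableOn u (Ioi 0))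
    (hu2 : MemLp u 2 (volume.restrict (Ioi 0))) :
    ∫⁻ ξ in Ioi 0, ‖sineIntegral u ξ‖ₑ ^ 2 = ∫⁻ s in Ioi 0, ‖u s‖ₑ ^ 2 := by
  have h := lintegral_enorm_fourier_sq (integrable_oddExtension hu) (memLp_oddExtension hu2)
  have h1 : ∀ ξ, ‖𝓕 (oddExtension u) ξ‖ₑ ^ 2 = ‖sineIntegral u ξ‖ₑ ^ 2 := by
    intro ξ
    rw [fourier_oddExtension hu, ← ofReal_norm, ← ofReal_norm, norm_mul]
    simp
  simp_rw [h1] at h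
  rw [lintegral_eq_two_mul_of_even (fun ξ => by rw [sineIntegral_neg, enorm_neg]),
    lintegral_eq_two_mul_of_even (fun x => by
      rw [oddExtension, oddExtension, neg_neg, ← enorm_neg, neg_sub])] at h
  rw [(ENNReal.mul_right_inj (by norm_num) (by norm_num)).1 h]
  refine setLIntegral_congr_fun measurableSet_Ioi fun x hx => ?_
  have hx0 : (0 : ℝ) < x := hx
  rw [oddExtension, indicator_of_mem hx, indicator_of_notMem (by simp [hx0.le]), sub_zero]

theorem memLp_sineIntegral {u : ℝ → ℂ} (hu : IntegrableOn u (Ioi 0))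
    (hu2 : MemLp u 2 (volume.restrict (Ioi 0))) :
    MemLp (sineIntegral u) 2 (volume.restrict (Ioi 0)) := by
  refine ⟨(continuous_sineIntegral hu).aestronglyMeasurable, ?_⟩
  have h := hu2.2
  rw [eLpNorm_lt_top_iff_lintegral_rpow_enorm_lt_top (by norm_num) (by norm_num)] at h ⊢
  simpa [lintegral_enorm_sineIntegral_sq hu hu2] using h

theorem norm_toLp_sineIntegral {u : ℝ → ℂ} (hu : IntegrableOn u (Ioi 0))
    (hu2 : MemLp u 2 (volume.restrict (Ioi 0))) :
    ‖(memLp_sineIntegral hu hu2).toLp _‖ = ‖hu2.toLp _‖ := by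
  rw [Lp.norm_toLp, Lp.norm_toLp, eLpNorm_eq_lintegral_rpow_enorm_toReal (by norm_num) (by norm_num),
    eLpNorm_eq_lintegral_rpow_enorm_toReal (by norm_num) (by norm_num)]
  simp [lintegral_enorm_sineIntegral_sq hu hu2]

/-- The square integrable functions on the half-line that are also integrable. -/
def integrableL2 : Submodule ℂ HalfLineL2 where
  carrier := {f | IntegrableOn f (Ioi 0) volume}
  add_mem' {f g} hf hg := (Integrable.add hf hg).congr (Lp.coeFn_add f g).symm
  zero_mem' := (integrable_zero _ _ _).congr (Lp.coeFn_zero ℂ 2 _).symm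
  smul_mem' c f hf := (Integrable.smul c hf).congr (Lp.coeFn_smul c f).symm

theorem denseRange_integrableL2 : DenseRange integrableL2.subtype := by
  have h : Dense (integrableL2 : Set HalfLineL2) := by
    refine (Lp.simpleFunc.dense (E := ℂ) (μ := volume.restrict (Ioi (0 : ℝ))) (p := 2)
      (by norm_num)).mono fun f hf => ?_
    have h1 := Lp.simpleFunc.memLp ⟨f, hf⟩
    rw [SimpleFunc.memLp_iff_integrable (by norm_num) (by norm_num)] at h1
    exact h1.congr (Lp.simpleFunc.toSimpleFunc_eq_toFun ⟨f, hf⟩)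
  simpa [DenseRange] using h

/-- The sine transform on `integrableL2`. -/
noncomputable def sineTransformCore : integrableL2 →ₗ[ℂ] HalfLineL2 where
  toFun f := (memLp_sineIntegral f.2 (Lp.memLp f.1)).toLp _
  map_add' f g := by
    rw [← MemLp.toLp_add]
    refine MemLp.toLp_congr _ _ (Eventually.of_forall fun ξ => ?_)
    refine (congrFun (sineIntegral_congr (Lp.coeFn_add f.1 g.1)) ξ).trans ?_
    exact sineIntegral_add f.2 g.2 ξ
  map_smul' c f := by
    rw [RingHom.id_apply, ← MemLp.toLp_const_smul]
    refine MemLp.toLp_congr _ _ (Eventually.of_forall fun ξ => ?_)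
    refine (congrFun (sineIntegral_congr (Lp.coeFn_smul c f.1)) ξ).trans ?_
    exact sineIntegral_const_mul c f.1 ξ

theorem norm_sineTransformCore (f : integrableL2) :
    ‖sineTransformCore f‖ = ‖integrableL2.subtype f‖ := by
  refine (norm_toLp_sineIntegral f.2 (Lp.memLp f.1)).trans ?_
  rw [Lp.toLp_coeFn]; rfl

/-- The sine transform on `L₂(0, ∞)`. -/
noncomputable def sineTransform : HalfLineL2 →L[ℂ] HalfLineL2 :=
  sineTransformCore.extendOfNorm integrableL2.subtype

theorem sineTransform_coe (f : integrableL2) : sineTransform f = sineTransformCore f :=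
  LinearMap.extendOfNorm_eq denseRange_integrableL2
    ⟨1, fun f => by rw [norm_sineTransformCore, one_mul]⟩ f

theorem coeFn_sineTransform {f : HalfLineL2} (hf : IntegrableOn f (Ioi 0)) :
    sineTransform f =ᵐ[volume.restrict (Ioi (0 : ℝ))] sineIntegral f := by
  have h := sineTransform_coe ⟨f, hf⟩
  change sineTransform f = _ at h
  rw [h]
  exact MemLp.coeFn_toLp (memLp_sineIntegral hf (Lp.memLp f))

theorem norm_sineTransform (f : HalfLineL2) : ‖sineTransform f‖ = ‖f‖ := by
  refine denseRange_integrableL2.induction_on f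
    (isClosed_eq (by fun_prop) (by fun_prop)) fun f => ?_
  rw [← norm_sineTransformCore, ← sineTransform_coe]; rfl

/-- The kernel is real and symmetric, so Fubini applies to integrable functions and density does the
rest. -/
theorem inner_sineTransform_left (f g : HalfLineL2) :
    inner ℂ (sineTransform f) g = inner ℂ f (sineTransform g) := by
  refine denseRange_integrableL2.induction_on₂
    (p := fun f g => inner ℂ (sineTransform f) g = inner ℂ f (sineTransform g))
    (isClosed_eq (by fun_prop) (by fun_prop)) (fun f g => ?_) f g
  have hf : IntegrableOn f.1 (Ioi 0) := f.2
  have hg : IntegrableOn g.1 (Ioi 0) := g.2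
  rw [L2.inner_def, L2.inner_def]
  have h1 : ∫ x in Ioi (0 : ℝ), inner ℂ (sineTransform f.1 x) (g.1 x) =
      ∫ x in Ioi (0 : ℝ), ∫ s in Ioi (0 : ℝ),
        2 * (Real.sin (2 * Real.pi * x * s) : ℂ) * (star (f.1 s) * g.1 x) := by
    refine integral_congr_ae ?_
    filter_upwards [coeFn_sineTransform hf] with x hx
    rw [hx, sineIntegral, RCLike.inner_apply, map_mul, ← integral_conj, mul_comm,
      ← integral_const_mul, ← integral_mul_const]
    refine integral_congr_ae (Eventually.of_forall fun s => ?_)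
    beta_reduce
    rw [map_mul, Complex.conj_ofReal, Complex.conj_ofNat, starRingEnd_apply]
    ring
  have h2 : ∫ x in Ioi (0 : ℝ), inner ℂ (f.1 x) (sineTransform g.1 x) =
      ∫ s in Ioi (0 : ℝ), ∫ x in Ioi (0 : ℝ),
        2 * (Real.sin (2 * Real.pi * x * s) : ℂ) * (star (f.1 s) * g.1 x) := by
    refine integral_congr_ae ?_
    filter_upwards [coeFn_sineTransform hg] with s hs
    rw [hs, sineIntegral, RCLike.inner_apply, mul_assoc, ← integral_mul_const,
      ← integral_const_mul]
    refine integral_congr_ae (Eventually.of_forall fun x => ?_)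
    beta_reduce
    rw [show 2 * Real.pi * s * x = 2 * Real.pi * x * s by ring]
    simp
    ring
  refine h1.trans (Eq.trans ?_ h2.symm)
  refine integral_integral_swap ?_
  have h3 : Integrable (fun z : ℝ × ℝ => star (f.1 z.2) * g.1 z.1)
      ((volume.restrict (Ioi (0 : ℝ))).prod (volume.restrict (Ioi (0 : ℝ)))) := by
    have hf' : IntegrableOn (fun s => star (f.1 s)) (Ioi 0) :=
      LinearIsometryEquiv.integrable_comp_iff (starₗᵢ ℂ : ℂ ≃ₗᵢ⋆[ℂ] ℂ) |>.2 hf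
    refine (hg.mul_prod hf').congr (Eventually.of_forall fun z => mul_comm _ _)
  refine Integrable.bdd_mul (c := 2) h3 (Continuous.aestronglyMeasurable (by fun_prop))
    (Eventually.of_forall fun z => ?_)
  rw [norm_mul, Complex.norm_real, Real.norm_eq_abs, Complex.norm_ofNat]
  linarith [Real.abs_sin_le_one (2 * Real.pi * z.1 * z.2)]

/-- The sine transform is an involution. -/
theorem sineTransform_sineTransform (f : HalfLineL2) : sineTransform (sineTransform f) = f := by
  refine ext_inner_right ℂ fun g => ?_
  -- A symmetric isometry is its own inverse.
  rw [inner_sineTransform_left]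
  exact LinearIsometry.inner_map_map ⟨sineTransform.toLinearMap, norm_sineTransform⟩ f g

/-! ### Groups of multiplication operators -/

section L2Convergence

variable {α ι : Type*} [MeasurableSpace α] {μ : Measure α}

theorem norm_sq_eq_integral (f : Lp ℂ 2 μ) : ‖f‖ ^ 2 = ∫ x, ‖f x‖ ^ 2 ∂μ := by
  have h : ((‖f‖ ^ 2 : ℝ) : ℂ) = ((∫ x, ‖f x‖ ^ 2 ∂μ : ℝ) : ℂ) := by
    rw [← integral_complex_ofReal, Complex.ofReal_pow]
    refine (inner_self_eq_norm_sq_to_K (𝕜 := ℂ) f).symm.trans ?_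
    rw [L2.inner_def]
    refine integral_congr_ae (Eventually.of_forall fun x => ?_)
    beta_reduce
    rw [inner_self_eq_norm_sq_to_K, Complex.ofReal_pow]
    rfl
  exact_mod_cast h

/-- Dominated convergence in `L₂`. -/
theorem tendsto_L2_of_dominated {l : Filter ι} [l.IsCountablyGenerated] {f : ι → Lp ℂ 2 μ}
    {f' : ι → α → ℂ} {F : Lp ℂ 2 μ} {b : Lp ℂ 2 μ} {c : ℝ} (hf : ∀ i, f i =ᵐ[μ] f' i)
    (hle : ∀ i, ∀ᵐ x ∂μ, ‖f' i x - F x‖ ≤ c * ‖b x‖)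
    (hlim : ∀ᵐ x ∂μ, Tendsto (fun i => f' i x) l (𝓝 (F x))) : Tendsto f l (𝓝 F) := by
  have h1 : ∀ i, ‖f i - F‖ ^ 2 = ∫ x, ‖f' i x - F x‖ ^ 2 ∂μ := by
    intro i
    rw [norm_sq_eq_integral]
    refine integral_congr_ae ?_
    filter_upwards [hf i, Lp.coeFn_sub (f i) F] with x h2 h3
    rw [h3, Pi.sub_apply, h2]
  have hF := Lp.aestronglyMeasurable F
  have h2 : Tendsto (fun i => ‖f i - F‖ ^ 2) l (𝓝 0) := by
    simp_rw [h1]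
    rw [show (0 : ℝ) = ∫ _, (0 : ℝ) ∂μ by simp]
    refine tendsto_integral_filter_of_dominated_convergence (fun x => (c * ‖b x‖) ^ 2) ?_ ?_ ?_ ?_
    · refine Eventually.of_forall fun i => ?_
      exact ((((Lp.aestronglyMeasurable (f i)).congr (hf i)).sub hF).norm.pow 2)
    · refine Eventually.of_forall fun i => ?_
      filter_upwards [hle i] with x hx
      rw [Real.norm_of_nonneg (by positivity)]
      exact pow_le_pow_left₀ (norm_nonneg _) hx 2
    · simp_rw [mul_pow]
      exact ((memLp_two_iff_integrable_sq_norm (Lp.aestronglyMeasurable b)).1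
        (Lp.memLp b)).const_mul _
    · filter_upwards [hlim] with x hx
      have := (tendsto_iff_norm_sub_tendsto_zero.1 hx).pow 2
      simpa using this
  rw [tendsto_iff_norm_sub_tendsto_zero]
  have h3 := (Real.continuous_sqrt.tendsto 0).comp h2
  simpa [Function.comp_def, Real.sqrt_sq (norm_nonneg _)] using h3

theorem exists_seq_tendsto_ae_of_tendsto_L2 {f : ℕ → Lp ℂ 2 μ} {F : Lp ℂ 2 μ}
    (h : Tendsto f atTop (𝓝 F)) :
    ∃ n : ℕ → ℕ, StrictMono n ∧ ∀ᵐ x ∂μ, Tendsto (fun i => f (n i) x) atTop (𝓝 (F x)) :=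
  (tendstoInMeasure_of_tendsto_Lp h).exists_seq_tendsto_ae

end L2Convergence

section MulGroup

variable {α : Type*} [MeasurableSpace α] {μ : Measure α} {φ : α → ℝ}

theorem memLp_exp_mul_I (hφ : Measurable φ) (t : ℝ) :
    MemLp (fun x => Complex.exp ((t * φ x : ℝ) * Complex.I)) ∞ μ := by
  refine memLp_top_of_bound (Measurable.aestronglyMeasurable (by fun_prop)) 1
    (Eventually.of_forall fun x => ?_)
  rw [Complex.norm_exp_ofReal_mul_I]

/-- The unitary group of multiplication by `e^{itφ}`. -/
noncomputable def mulGroup (μ : Measure α) (φ : α → ℝ) (hφ : Measurable φ) (t : ℝ) :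
    Lp ℂ 2 μ →L[ℂ] Lp ℂ 2 μ :=
  mulOp _ (memLp_exp_mul_I hφ t)

theorem norm_mulGroup (hφ : Measurable φ) (t : ℝ) (f : Lp ℂ 2 μ) :
    ‖mulGroup μ φ hφ t f‖ = ‖f‖ := by
  have h : ‖mulGroup μ φ hφ t f‖ ^ 2 = ‖f‖ ^ 2 := by
    rw [norm_sq_eq_integral, norm_sq_eq_integral]
    refine integral_congr_ae ?_
    filter_upwards [coeFn_mulOp (memLp_exp_mul_I hφ t) f] with x hx
    rw [mulGroup, hx, norm_mul, Complex.norm_exp_ofReal_mul_I, one_mul]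
  exact (sq_eq_sq₀ (norm_nonneg _) (norm_nonneg _)).1 h

theorem isC0Group_mulGroup (hφ : Measurable φ) : IsC0Group (mulGroup μ φ hφ) where
  zero := by
    ext1 f
    refine Lp.ext ?_
    filter_upwards [coeFn_mulOp (memLp_exp_mul_I hφ 0) f] with x hx
    rw [mulGroup, hx]
    simp
  add s t := by
    refine mulOp_comp _ _ _ (Eventually.of_forall fun x => ?_)
    rw [← Complex.exp_add]
    congr 1
    push_cast; ring
  continuous f := by
    refine continuous_iff_continuousAt.2 fun t => ?_
    refine tendsto_L2_of_dominated (b := f) (c := 2)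
      (fun s => coeFn_mulOp (memLp_exp_mul_I hφ s) f) (fun s => ?_) ?_
    · filter_upwards [coeFn_mulOp (memLp_exp_mul_I hφ t) f] with x hx
      rw [mulGroup, hx]
      refine (norm_sub_le _ _).trans (le_of_eq ?_)
      rw [norm_mul, norm_mul, Complex.norm_exp_ofReal_mul_I, Complex.norm_exp_ofReal_mul_I]
      ring
    · filter_upwards [coeFn_mulOp (memLp_exp_mul_I hφ t) f] with x hx
      rw [mulGroup, hx]
      exact Continuous.tendsto (by fun_prop) t

theorem tendsto_slope_exp_mul_I (c : ℝ) (z : ℂ) :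
    Tendsto (fun t : ℝ => (t : ℂ)⁻¹ * (Complex.exp ((t * c : ℝ) * Complex.I) * z - z)) (𝓝[≠] 0)
      (𝓝 (Complex.I * c * z)) := by
  have h1 : HasDerivAt (fun t : ℝ => Complex.exp ((t * c : ℝ) * Complex.I) * z)
      (Complex.I * c * z) 0 := by
    have h2 : HasDerivAt (fun t : ℝ => Complex.exp ((t : ℂ) * (c * Complex.I))) (c * Complex.I) 0 := by
      simpa using ((hasDerivAt_id ((0 : ℝ) : ℂ)).mul_const (c * Complex.I)).cexp.comp_ofReal
    refine ((h2.mul_const z).congr_deriv (by ring)).congr_of_eventuallyEq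
      (Eventually.of_forall fun t => ?_)
    beta_reduce
    push_cast
    rw [mul_assoc (t : ℂ)]
  rw [hasDerivAt_iff_tendsto_slope_zero] at h1
  refine h1.congr fun t => ?_
  simp [← Complex.ofReal_inv]

/-- The generator of the group of multiplication by `e^{itφ}` is multiplication by `iφ`. -/
theorem hasGenerator_mulGroup_iff (hφ : Measurable φ) (f g : Lp ℂ 2 μ) :
    HasGenerator (mulGroup μ φ hφ) f g ↔ ∀ᵐ x ∂μ, g x = Complex.I * φ x * f x := by
  have hq : ∀ t : ℝ, ((t : ℂ)⁻¹ • (mulGroup μ φ hφ t f - f) : Lp ℂ 2 μ) =ᵐ[μ] fun x =>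
      (t : ℂ)⁻¹ * (Complex.exp ((t * φ x : ℝ) * Complex.I) * f x - f x) := by
    intro t
    filter_upwards [Lp.coeFn_smul (t : ℂ)⁻¹ (mulGroup μ φ hφ t f - f),
      Lp.coeFn_sub (mulGroup μ φ hφ t f) f, coeFn_mulOp (memLp_exp_mul_I hφ t) f] with x h1 h2 h3
    rw [h1, Pi.smul_apply, h2, Pi.sub_apply, mulGroup, h3, smul_eq_mul]
  constructor
  · intro h
    have hs : Tendsto (fun n : ℕ => 1 / ((n : ℝ) + 1)) atTop (𝓝[≠] 0) :=
      tendsto_nhdsWithin_iff.2 ⟨tendsto_one_div_add_atTop_nhds_zero_nat,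
        Eventually.of_forall fun n => by
          have : 1 / ((n : ℝ) + 1) ≠ 0 := by positivity
          exact this⟩
    -- Along a subsequence the quotients converge almost everywhere, and their pointwise limit is
    -- the derivative of the exponential.
    obtain ⟨n, hn, hlim⟩ := exists_seq_tendsto_ae_of_tendsto_L2 (h.comp hs)
    filter_upwards [hlim, ae_all_iff.2 fun i : ℕ => hq (1 / ((i : ℝ) + 1))] with x h1 h2
    refine tendsto_nhds_unique h1 ?_
    refine ((tendsto_slope_exp_mul_I (φ x) (f x)).comp (hs.comp hn.tendsto_atTop)).congr fun i => ?_
    exact (h2 (n i)).symm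
  · intro h
    -- Since `|e^{itφ} - 1| ≤ |tφ|`, the quotient is dominated by `|g|`, and the limit contributes
    -- another `|g|`.
    refine tendsto_L2_of_dominated (b := g) (c := 2) hq (fun t => ?_) ?_
    · filter_upwards [h] with x hx
      have h1 : ‖Complex.exp ((t * φ x : ℝ) * Complex.I) * f x - f x‖ ≤ |t| * ‖g x‖ := by
        have h2 := Real.norm_exp_I_mul_ofReal_sub_one_le (x := t * φ x)
        have h3 : Complex.exp ((t * φ x : ℝ) * Complex.I) * f x - f x =
            (Complex.exp (Complex.I * (t * φ x : ℝ)) - 1) * f x := by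
          rw [mul_comm Complex.I]; ring
        rw [h3, norm_mul, hx, norm_mul, norm_mul, Complex.norm_I, one_mul, Complex.norm_real,
          ← mul_assoc, ← Real.norm_eq_abs t, ← norm_mul t (φ x)]
        exact mul_le_mul_of_nonneg_right h2 (norm_nonneg _)
      refine (norm_sub_le _ _).trans ?_
      rw [norm_mul, norm_inv, Complex.norm_real, Real.norm_eq_abs]
      rcases eq_or_ne t 0 with ht | ht
      · rw [ht, abs_zero, inv_zero, zero_mul]
        linarith [norm_nonneg (g x)]
      · have h4 : |t|⁻¹ * ‖Complex.exp ((t * φ x : ℝ) * Complex.I) * f x - f x‖ ≤ ‖g x‖ :=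
          (inv_mul_le_iff₀ (abs_pos.2 ht)).2 h1
        linarith
    · filter_upwards [h] with x hx
      rw [hx]
      exact tendsto_slope_exp_mul_I (φ x) (f x)

end MulGroup

theorem HasGenerator.map {H K : Type*} [NormedAddCommGroup H] [InnerProductSpace ℂ H]
    [NormedAddCommGroup K] [InnerProductSpace ℂ K] {U : ℝ → H →L[ℂ] H} {u : ℝ → K →L[ℂ] K}
    {f g : H} (h : HasGenerator U f g) (Z : H →L[ℂ] K) (hZ : ∀ t x, Z (U t x) = u t (Z x)) :
    HasGenerator u (Z f) (Z g) := by
  refine ((Z.continuous.tendsto g).comp h).congr fun t => ?_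
  simp only [Function.comp_apply, map_smul, map_sub, hZ]

/-! ### The sine transform diagonalizes the free operator -/

/-- The symbol `4π²ξ²` of `-d²/dx²`. -/
noncomputable def freeSymbol (ξ : ℝ) : ℝ := 4 * Real.pi ^ 2 * ξ ^ 2

theorem measurable_freeSymbol : Measurable freeSymbol := by
  unfold freeSymbol
  fun_prop

theorem freeSymbol_nonneg (ξ : ℝ) : 0 ≤ freeSymbol ξ := by
  unfold freeSymbol
  positivity

theorem sq_le_freeSymbol (ξ : ℝ) : ξ ^ 2 ≤ freeSymbol ξ := by
  have h := Real.pi_gt_three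
  have : 1 ≤ 4 * Real.pi ^ 2 := by nlinarith
  exact le_mul_of_one_le_left (sq_nonneg ξ) this

theorem integrableOn_mul_of_sq_le {w : HalfLineL2} {r : ℝ → ℝ} (hr : Continuous r)
    (h : ∀ ξ, r ξ ^ 2 ≤ (1 + ξ ^ 2)⁻¹) : IntegrableOn (fun ξ => (r ξ : ℂ) * w ξ) (Ioi 0) := by
  have hr2 : MemLp (fun ξ => (r ξ : ℂ)) 2 (volume.restrict (Ioi (0 : ℝ))) := by
    refine (memLp_two_iff_integrable_sq_norm
      (Continuous.aestronglyMeasurable (by fun_prop))).2 ?_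
    refine Integrable.mono' integrable_inv_one_add_sq.integrableOn
      (Continuous.aestronglyMeasurable (by fun_prop)) (Eventually.of_forall fun ξ => ?_)
    rw [Complex.norm_real, Real.norm_of_nonneg (by positivity), Real.norm_eq_abs, sq_abs]
    exact h ξ
  exact hr2.integrable_mul (Lp.memLp w)

/-- The sum `a + b` is `(1 + 4π²ξ²) a`, and both `1` and `ξ` divided by this factor are square
integrable; Cauchy-Schwarz concludes. -/
theorem integrableOn_of_freeSymbol {a b : HalfLineL2}
    (hab : ∀ᵐ ξ ∂(volume.restrict (Ioi (0 : ℝ))), b ξ = freeSymbol ξ * a ξ) :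
    IntegrableOn a (Ioi 0) ∧ IntegrableOn (fun ξ : ℝ => (ξ : ℂ) * a ξ) (Ioi 0) := by
  have hcont : Continuous freeSymbol := by unfold freeSymbol; fun_prop
  have hpos : ∀ ξ, 0 < 1 + freeSymbol ξ := fun ξ => by linarith [freeSymbol_nonneg ξ]
  have hab' : ∀ᵐ ξ ∂(volume.restrict (Ioi (0 : ℝ))), (a + b) ξ = (1 + freeSymbol ξ : ℝ) * a ξ := by
    filter_upwards [hab, Lp.coeFn_add a b] with ξ h1 h2
    rw [h2, Pi.add_apply, h1]
    push_cast; ring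
  constructor
  · refine (integrableOn_mul_of_sq_le (w := a + b) (r := fun ξ => (1 + freeSymbol ξ)⁻¹)
      ((continuous_const.add hcont).inv₀ fun ξ => (hpos ξ).ne') fun ξ => ?_).congr ?_
    · rw [inv_pow]
      have := sq_le_freeSymbol ξ
      gcongr
      nlinarith [sq_nonneg ξ]
    · filter_upwards [hab'] with ξ hξ
      rw [hξ, ← mul_assoc, ← Complex.ofReal_mul, inv_mul_cancel₀ (hpos ξ).ne', Complex.ofReal_one,
        one_mul]
  · refine (integrableOn_mul_of_sq_le (w := a + b) (r := fun ξ => ξ * (1 + freeSymbol ξ)⁻¹)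
      (continuous_id.mul ((continuous_const.add hcont).inv₀ fun ξ => (hpos ξ).ne'))
      fun ξ => ?_).congr ?_
    · have h1 := sq_le_freeSymbol ξ
      rw [mul_pow, inv_pow, ← div_eq_mul_inv, div_le_iff₀ (by have := hpos ξ; positivity),
        ← div_eq_inv_mul, le_div_iff₀ (by positivity)]
      have h2 : (1 + ξ ^ 2) ^ 2 ≤ (1 + freeSymbol ξ) ^ 2 := by gcongr
      nlinarith [sq_nonneg ξ]
    · filter_upwards [hab'] with ξ hξ
      rw [hξ, ← mul_assoc, ← Complex.ofReal_mul, mul_assoc, inv_mul_cancel₀ (hpos ξ).ne', mul_one]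

theorem hasDerivAt_sineIntegral {a : ℝ → ℂ} (ha : IntegrableOn a (Ioi 0))
    (ha' : IntegrableOn (fun ξ : ℝ => (ξ : ℂ) * a ξ) (Ioi 0)) (x : ℝ) :
    HasDerivAt (sineIntegral a)
      (2 * ∫ ξ in Ioi (0 : ℝ), ((2 * Real.pi * ξ * Real.cos (2 * Real.pi * x * ξ) : ℝ) : ℂ) * a ξ)
      x := by
  refine HasDerivAt.const_mul 2 ?_
  refine (hasDerivAt_integral_of_dominated_loc_of_deriv_le (μ := volume.restrict (Ioi (0 : ℝ)))
    (F := fun x ξ => (Real.sin (2 * Real.pi * x * ξ) : ℂ) * a ξ)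
    (F' := fun x ξ => ((2 * Real.pi * ξ * Real.cos (2 * Real.pi * x * ξ) : ℝ) : ℂ) * a ξ)
    (bound := fun ξ => 2 * Real.pi * ‖(ξ : ℂ) * a ξ‖) (s := univ) univ_mem ?_ ?_ ?_ ?_ ?_ ?_).2
  · exact Eventually.of_forall fun x => (integrableOn_sin_mul ha x).aestronglyMeasurable
  · exact integrableOn_sin_mul ha x
  · exact (Continuous.aestronglyMeasurable (by fun_prop)).mul ha.aestronglyMeasurable
  · refine Eventually.of_forall fun ξ x _ => ?_
    rw [norm_mul, norm_mul, Complex.norm_real, Complex.norm_real, norm_mul, norm_mul,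
      Real.norm_of_nonneg (show 0 ≤ 2 * Real.pi by positivity)]
    have := Real.abs_cos_le_one (2 * Real.pi * x * ξ)
    calc _ ≤ 2 * Real.pi * ‖ξ‖ * 1 * ‖a ξ‖ := by gcongr; exact this
      _ = _ := by ring
  · exact ha'.norm.const_mul _
  · refine Eventually.of_forall fun ξ x _ => ?_
    have h1 : HasDerivAt (fun x : ℝ => Real.sin (2 * Real.pi * x * ξ))
        (2 * Real.pi * ξ * Real.cos (2 * Real.pi * x * ξ)) x := by
      have h2 : HasDerivAt (fun x : ℝ => 2 * Real.pi * x * ξ) (2 * Real.pi * ξ) x := by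
        simpa using ((hasDerivAt_id x).const_mul (2 * Real.pi)).mul_const ξ
      exact h2.sin.congr_deriv (mul_comm _ _)
    exact (h1.ofReal_comp).mul_const _

/-- The primitive is the inner product with an indicator function, whose sine transform is explicit;
symmetry and involutivity move the product to the frequency side. -/
theorem integral_eq_inner_sineTransform {g : HalfLineL2} {x : ℝ} (hx : 0 ≤ x) :
    ∫ s in (0 : ℝ)..x, g s = ∫ ξ in Ioi (0 : ℝ),
      ((2 * ((1 - Real.cos (2 * Real.pi * x * ξ)) / (2 * Real.pi * ξ)) : ℝ) : ℂ) *
        sineTransform g ξ := by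
  have hfin : (volume.restrict (Ioi (0 : ℝ))) (Ioc 0 x) ≠ ∞ :=
    ((Measure.restrict_apply_le _ _).trans_lt measure_Ioc_lt_top).ne
  set u : HalfLineL2 := indicatorConstLp 2 measurableSet_Ioc hfin (1 : ℂ) with hu
  have hux : u =ᵐ[volume.restrict (Ioi (0 : ℝ))] indicator (Ioc 0 x) fun _ => (1 : ℂ) :=
    indicatorConstLp_coeFn
  have hui : IntegrableOn u (Ioi 0) :=
    (((integrable_indicator_iff measurableSet_Ioc).2
      (integrableOn_const (by simp))).integrableOn (s := Ioi 0)).congr hux.symm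
  have h1 : inner ℂ u g = ∫ s in (0 : ℝ)..x, g s := by
    rw [hu, L2.inner_indicatorConstLp_one, Measure.restrict_restrict measurableSet_Ioc,
      inter_eq_left.2 Ioc_subset_Ioi_self, intervalIntegral.integral_of_le hx]
  rw [← h1, ← sineTransform_sineTransform g, ← inner_sineTransform_left, sineTransform_sineTransform,
    L2.inner_def]
  refine integral_congr_ae ?_
  filter_upwards [coeFn_sineTransform hui, ae_restrict_mem measurableSet_Ioi] with ξ h2 hξ
  have hξ0 : 0 < ξ := hξ
  have h3 : sineIntegral u ξ =
      ((2 * ((1 - Real.cos (2 * Real.pi * x * ξ)) / (2 * Real.pi * ξ)) : ℝ) : ℂ) := by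
    rw [sineIntegral_congr hux, sineIntegral]
    have h4 : ∀ s, (Real.sin (2 * Real.pi * ξ * s) : ℂ) * indicator (Ioc 0 x) (fun _ => (1 : ℂ)) s =
        indicator (Ioc 0 x) (fun s => ((Real.sin (2 * Real.pi * ξ * s) : ℝ) : ℂ)) s := by
      intro s
      by_cases hs : s ∈ Ioc 0 x
      · rw [indicator_of_mem hs, indicator_of_mem hs, mul_one]
      · rw [indicator_of_notMem hs, indicator_of_notMem hs, mul_zero]
    simp_rw [h4]
    rw [integral_indicator measurableSet_Ioc, Measure.restrict_restrict measurableSet_Ioc,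
      inter_eq_left.2 Ioc_subset_Ioi_self, ← intervalIntegral.integral_of_le hx,
      intervalIntegral.integral_ofReal,
      intervalIntegral.integral_comp_mul_left (fun s => Real.sin s) (by positivity), integral_sin]
    rw [show 2 * Real.pi * x * ξ = 2 * Real.pi * ξ * x by ring, mul_zero, Real.cos_zero, smul_eq_mul]
    push_cast
    field_simp
  rw [h2, h3, RCLike.inner_apply, mul_comm]
  congr 1
  exact Complex.conj_ofReal _

/-- The representative of `f` is the absolutely convergent sine integral of its transform; it
vanishes at `0` and can be differentiated once under the integral. The second derivative is
recovered in integrated form, because `ξ² a` need not be integrable. -/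
theorem mem_schrodingerGraph_zero_of_sineTransform {f g : HalfLineL2}
    (h : ∀ᵐ ξ ∂(volume.restrict (Ioi (0 : ℝ))),
      sineTransform g ξ = freeSymbol ξ * sineTransform f ξ) : (f, g) ∈ schrodingerGraph 0 := by
  obtain ⟨ha, ha'⟩ := integrableOn_of_freeSymbol h
  set a := sineTransform f with haf
  have hfy : f =ᵐ[volume.restrict (Ioi (0 : ℝ))] sineIntegral a := by
    have h1 := coeFn_sineTransform ha
    rwa [haf, sineTransform_sineTransform, ← haf] at h1
  have hcos : ∀ x : ℝ, IntegrableOn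
      (fun ξ : ℝ => ((2 * Real.pi * ξ * Real.cos (2 * Real.pi * x * ξ) : ℝ) : ℂ) * a ξ) (Ioi 0) := by
    intro x
    have h1 : IntegrableOn (fun ξ : ℝ => ((2 * Real.pi * Real.cos (2 * Real.pi * x * ξ) : ℝ) : ℂ) *
        ((ξ : ℂ) * a ξ)) (Ioi 0) := by
      refine Integrable.bdd_mul (c := 2 * Real.pi) ha'
        (Continuous.aestronglyMeasurable (by fun_prop)) (Eventually.of_forall fun ξ => ?_)
      rw [Complex.norm_real, norm_mul, Real.norm_of_nonneg (show 0 ≤ 2 * Real.pi by positivity)]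
      exact mul_le_of_le_one_right (by positivity) (Real.abs_cos_le_one _)
    refine h1.congr (Eventually.of_forall fun ξ => ?_)
    push_cast; ring
  refine ⟨sineIntegral a, fun x => 2 * ∫ ξ in Ioi (0 : ℝ),
    ((2 * Real.pi * ξ * Real.cos (2 * Real.pi * x * ξ) : ℝ) : ℂ) * a ξ, fun x => -g x,
    ⟨fun x _ => (hasDerivAt_sineIntegral ha ha' x).hasDerivWithinAt, fun x hx => ?_,
      fun x hx => ?_⟩, ?_, hfy, ?_⟩
  · rw [intervalIntegrable_iff_integrableOn_Ioc_of_le hx]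
    have h1 : MemLp g 2 (volume.restrict (Ioc 0 x)) :=
      (Lp.memLp g).mono_measure (Measure.restrict_mono Ioc_subset_Ioi_self le_rfl)
    exact (h1.integrable (by norm_num)).neg
  · rw [intervalIntegral.integral_neg, integral_eq_inner_sineTransform hx, ← sub_eq_add_neg,
      eq_sub_iff_add_eq, ← eq_sub_iff_add_eq', ← mul_sub, ← integral_sub (hcos 0) (hcos x),
      ← integral_const_mul]
    refine integral_congr_ae ?_
    filter_upwards [h, ae_restrict_mem measurableSet_Ioi] with ξ h1 hξ
    have hξ0 : (ξ : ℂ) ≠ 0 := by exact_mod_cast (show (0 : ℝ) < ξ from hξ).ne'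
    have hpi : (Real.pi : ℂ) ≠ 0 := by exact_mod_cast Real.pi_ne_zero
    rw [h1, freeSymbol, mul_zero, zero_mul, Real.cos_zero]
    push_cast
    field_simp
    ring
  · simp [sineIntegral]
  · refine Eventually.of_forall fun x => ?_
    simp

/-- The Green function bound at `k = i` with zero data; for `V = 0` the amplitude is identically
`1`, so the Jost function has no zero. -/
theorem eq_zero_of_mem_schrodingerGraph_zero {f : HalfLineL2}
    (h : (f, -f) ∈ schrodingerGraph 0) : f = 0 := by
  obtain ⟨M, -, hM⟩ := exists_resolvent_bound (V := 0) (MemLp.zero) (by simp)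
    (fun k m C _ _ _ hm => by
      rw [hm 0 le_rfl]
      simp)
  have h1 := hM Complex.I (by simp) f 0 (by simpa using h) (by
    refine (integrable_zero ℝ ℝ _).congr ?_
    filter_upwards [Lp.coeFn_zero ℂ 2 (volume.restrict (Ioi (0 : ℝ)))] with s hs
    rw [hs]; simp)
  have h2 : ∫ s in Ioi (0 : ℝ), √s * ‖(0 : HalfLineL2) s‖ = 0 := by
    refine (integral_congr_ae ?_).trans (integral_zero ℝ ℝ)
    filter_upwards [Lp.coeFn_zero ℂ 2 (volume.restrict (Ioi (0 : ℝ)))] with s hs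
    rw [hs]; simp
  refine Lp.ext ?_
  filter_upwards [h1, Lp.coeFn_zero ℂ 2 (volume.restrict (Ioi (0 : ℝ)))] with x hx hx0
  rw [h2, mul_zero, mul_zero] at hx
  rw [hx0]
  exact norm_le_zero_iff.1 hx

/-- The free operator is multiplication by `4π²ξ²` after the sine transform. -/
theorem mem_schrodingerGraph_zero_iff {f g : HalfLineL2} :
    (f, g) ∈ schrodingerGraph 0 ↔ ∀ᵐ ξ ∂(volume.restrict (Ioi (0 : ℝ))),
      sineTransform g ξ = freeSymbol ξ * sineTransform f ξ := by
  refine ⟨fun h => ?_, mem_schrodingerGraph_zero_of_sineTransform⟩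
  have hpos : ∀ ξ, 0 < 1 + freeSymbol ξ := fun ξ => by linarith [freeSymbol_nonneg ξ]
  have hm : MemLp (fun ξ => (((1 + freeSymbol ξ)⁻¹ : ℝ) : ℂ)) ∞ (volume.restrict (Ioi (0 : ℝ))) := by
    have := measurable_freeSymbol
    refine memLp_top_of_bound (Measurable.aestronglyMeasurable (by fun_prop)) 1
      (Eventually.of_forall fun ξ => ?_)
    rw [Complex.norm_real, Real.norm_of_nonneg (inv_pos.2 (hpos ξ)).le]
    exact inv_le_one_of_one_le₀ (by linarith [freeSymbol_nonneg ξ])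
  -- The resolvent at `-1`, built by the multiplier, gives a graph element with the same `f + g`.
  -- The difference of the two elements solves the homogeneous equation at `k = i` and vanishes.
  set f₁ : HalfLineL2 := sineTransform (mulOp _ hm (sineTransform (f + g))) with hf₁
  have h1 : (f₁, f + g - f₁) ∈ schrodingerGraph 0 := by
    refine mem_schrodingerGraph_zero_of_sineTransform ?_
    rw [map_sub, hf₁, sineTransform_sineTransform]
    filter_upwards [coeFn_mulOp hm (sineTransform (f + g)),
      Lp.coeFn_sub (sineTransform (f + g)) (mulOp _ hm (sineTransform (f + g)))] with ξ h1 h2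
    have h3 : (1 + freeSymbol ξ : ℂ) ≠ 0 := by exact_mod_cast (hpos ξ).ne'
    rw [h2, Pi.sub_apply, h1]
    push_cast
    field_simp
    ring
  have h2 : f - f₁ = 0 := by
    refine eq_zero_of_mem_schrodingerGraph_zero ?_
    have h3 := (schrodingerGraph 0).sub_mem h h1
    convert h3 using 1
    ext1
    · rfl
    · simp only [Prod.snd_sub]
      abel
  rw [sub_eq_zero] at h2
  have h3 : g = f + g - f₁ := by rw [← h2]; abel
  rw [h3]
  have h4 : sineTransform f = mulOp _ hm (sineTransform (f + g)) := by
    rw [h2, hf₁, sineTransform_sineTransform, ← hf₁, ← h2]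
  rw [map_sub, ← h2, h4]
  filter_upwards [coeFn_mulOp hm (sineTransform (f + g)),
    Lp.coeFn_sub (sineTransform (f + g)) (mulOp _ hm (sineTransform (f + g)))] with ξ h5 h6
  have h7 : (1 + freeSymbol ξ : ℂ) ≠ 0 := by exact_mod_cast (hpos ξ).ne'
  rw [h6, Pi.sub_apply, h5]
  push_cast
  field_simp
  ring

/-! ### Operators similar to multiplication operators are spectral -/

section Spectral

variable {α : Type*} [MeasurableSpace α] {μ : Measure α}

theorem memLp_indicator_one {S : Set α} (hS : MeasurableSet S) :
    MemLp (S.indicator fun _ => (1 : ℂ)) ∞ μ :=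
  memLp_top_of_bound ((measurable_const.indicator hS).aestronglyMeasurable) 1
    (Eventually.of_forall fun x => by
      refine (norm_indicator_le_norm_self _ _).trans ?_
      simp)

theorem coeFn_mulOp_indicator {S : Set α} (hS : MeasurableSet S) (f : Lp ℂ 2 μ) :
    mulOp _ (memLp_indicator_one hS) f =ᵐ[μ] S.indicator f := by
  filter_upwards [coeFn_mulOp (memLp_indicator_one hS) f] with x hx
  rw [hx]
  by_cases h : x ∈ S
  · rw [indicator_of_mem h, indicator_of_mem h, one_mul]
  · rw [indicator_of_notMem h, indicator_of_notMem h, zero_mul]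

/-- Finite partial sums are multiplications by indicators of finite unions, so dominated convergence
applies along the net of finite sets. -/
theorem hasSum_mulOp_indicator {S : ℕ → Set α} (hS : ∀ n, MeasurableSet (S n))
    (hd : Pairwise (Function.onFun Disjoint S)) (f : Lp ℂ 2 μ) :
    HasSum (fun n => mulOp _ (memLp_indicator_one (μ := μ) (hS n)) f)
      (mulOp _ (memLp_indicator_one (MeasurableSet.iUnion hS)) f) := by
  rw [HasSum, SummationFilter.unconditional_filter]
  refine tendsto_L2_of_dominated (b := f) (c := 1)
    (f' := fun s => (⋃ i ∈ s, S i).indicator f) (fun s => ?_) (fun s => ?_) ?_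
  · have h1 : ∀ s : Finset ℕ, ((∑ n ∈ s, mulOp _ (memLp_indicator_one (μ := μ) (hS n)) f : Lp ℂ 2 μ))
        =ᵐ[μ] fun x => ∑ n ∈ s, (S n).indicator f x := by
      intro s
      induction s using Finset.induction_on with
      | empty => simp only [Finset.sum_empty]; exact Lp.coeFn_zero ℂ 2 μ
      | insert a s ha ih =>
        rw [Finset.sum_insert ha]
        filter_upwards [ih, Lp.coeFn_add (mulOp _ (memLp_indicator_one (μ := μ) (hS a)) f)
          (∑ n ∈ s, mulOp _ (memLp_indicator_one (μ := μ) (hS n)) f),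
          coeFn_mulOp_indicator (hS a) f] with x h2 h3 h4
        rw [h3, Pi.add_apply, h2, h4, Finset.sum_insert ha]
    filter_upwards [h1 s] with x hx
    rw [hx, Finset.indicator_biUnion_apply s S fun i _ j _ hij => hd hij]
  · filter_upwards [coeFn_mulOp_indicator (MeasurableSet.iUnion hS) f] with x hx
    rw [hx, one_mul]
    by_cases h : x ∈ ⋃ i ∈ s, S i
    · have h2 : x ∈ ⋃ i, S i := by
        simp only [mem_iUnion] at h ⊢
        obtain ⟨i, -, hi⟩ := h
        exact ⟨i, hi⟩
      rw [indicator_of_mem h, indicator_of_mem h2, sub_self, norm_zero]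
      exact norm_nonneg _
    · rw [indicator_of_notMem h, zero_sub, norm_neg]
      exact norm_indicator_le_norm_self _ _
  · filter_upwards [coeFn_mulOp_indicator (MeasurableSet.iUnion hS) f] with x hx
    rw [hx]
    exact (tendsto_indicator_biUnion_finset S f x).mono_right (pure_le_nhds _)

/-- The relation is pointwise and survives almost everywhere convergence; successive subsequences
serve the two components. -/
theorem isClosed_ae_eq_mul (φ : α → ℂ) :
    IsClosed {ab : Lp ℂ 2 μ × Lp ℂ 2 μ | ∀ᵐ x ∂μ, ab.2 x = φ x * ab.1 x} := by
  refine IsSeqClosed.isClosed fun u ab hu hlim => ?_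
  obtain ⟨n, hn, h1⟩ := exists_seq_tendsto_ae_of_tendsto_L2 ((continuous_fst.tendsto _).comp hlim)
  obtain ⟨m, hm, h2⟩ := exists_seq_tendsto_ae_of_tendsto_L2
    (((continuous_snd.tendsto _).comp hlim).comp hn.tendsto_atTop)
  filter_upwards [h1, h2, ae_all_iff.2 hu] with x h3 h4 h5
  refine tendsto_nhds_unique h4 ?_
  refine ((h3.comp hm.tendsto_atTop).const_mul (φ x)).congr fun i => ?_
  exact (h5 _).symm

variable {X : Type*} [NormedAddCommGroup X] [NormedSpace ℂ X]

theorem LinearPMap.exists_of_mem_graph {T : X →ₗ.[ℂ] X} {f g : X} (h : (f, g) ∈ T.graph) :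
    ∃ h : f ∈ T.domain, T ⟨f, h⟩ = g := by
  obtain ⟨y, hy, hy'⟩ := (LinearPMap.mem_graph_iff T).1 h
  obtain ⟨y, hyd⟩ := y
  subst hy
  exact ⟨hyd, hy'⟩

/-- The spectral projection of an operator similar to multiplication by `φ`. -/
noncomputable def spectralProjection (φ : α → ℂ) (hφ : Measurable φ) (Z : X →L[ℂ] Lp ℂ 2 μ)
    (Z' : Lp ℂ 2 μ →L[ℂ] X) (δ : Set ℂ) : X →L[ℂ] X :=
  open Classical in
  if h : MeasurableSet δ then Z'.comp ((mulOp _ (memLp_indicator_one (hφ h))).comp Z) else 0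

variable {φ : α → ℂ} {hφ : Measurable φ} {Z : X →L[ℂ] Lp ℂ 2 μ} {Z' : Lp ℂ 2 μ →L[ℂ] X} {δ : Set ℂ}

theorem spectralProjection_apply (hδ : MeasurableSet δ) (x : X) :
    spectralProjection φ hφ Z Z' δ x = Z' (mulOp _ (memLp_indicator_one (hφ hδ)) (Z x)) := by
  rw [spectralProjection, dif_pos hδ]; rfl

theorem coeFn_spectralProjection (hZZ' : ∀ a, Z (Z' a) = a) (hδ : MeasurableSet δ) (x : X) :
    Z (spectralProjection φ hφ Z Z' δ x) =ᵐ[μ] (φ ⁻¹' δ).indicator (Z x) := by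
  rw [spectralProjection_apply hδ, hZZ']
  exact coeFn_mulOp_indicator (hφ hδ) _

theorem isSpectralMeasure_spectralProjection (hZ'Z : ∀ x, Z' (Z x) = x)
    (hZZ' : ∀ a, Z (Z' a) = a) : IsSpectralMeasure (spectralProjection φ hφ Z Z') where
  univ := by
    have hinj : Function.Injective Z := Function.LeftInverse.injective hZ'Z
    ext1 x
    refine hinj (Lp.ext ?_)
    filter_upwards [coeFn_spectralProjection (hφ := hφ) hZZ' MeasurableSet.univ x] with y hy
    rw [hy, preimage_univ, indicator_univ]; rfl
  inter A B hA hB := by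
    have hinj : Function.Injective Z := Function.LeftInverse.injective hZ'Z
    ext1 x
    refine hinj (Lp.ext ?_)
    filter_upwards [coeFn_spectralProjection (hφ := hφ) hZZ' (hA.inter hB) x,
      coeFn_spectralProjection (hφ := hφ) hZZ' hA (spectralProjection φ hφ Z Z' B x),
      coeFn_spectralProjection (hφ := hφ) hZZ' hB x] with y h1 h2 h3
    rw [h1, ContinuousLinearMap.comp_apply, h2, preimage_inter, ← indicator_indicator]
    by_cases h : y ∈ φ ⁻¹' A
    · rw [indicator_of_mem h, indicator_of_mem h, h3]
    · rw [indicator_of_notMem h, indicator_of_notMem h]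
  bounded := by
    refine ⟨‖Z'‖ * (1 * ‖Z‖), fun A hA => ?_⟩
    rw [spectralProjection, dif_pos hA]
    refine (ContinuousLinearMap.opNorm_comp_le _ _).trans ?_
    gcongr
    refine (ContinuousLinearMap.opNorm_comp_le _ _).trans ?_
    gcongr
    refine norm_mulOp_le _ zero_le_one (Eventually.of_forall fun x => ?_)
    refine (norm_indicator_le_norm_self _ _).trans ?_
    simp
  iUnion A hA hd x := by
    have h1 := (hasSum_mulOp_indicator (μ := μ) (fun n => hφ (hA n))
      (fun i j hij => (hd hij).preimage φ) (Z x)).mapL Z'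
    simp only [spectralProjection_apply (hA _), spectralProjection_apply (MeasurableSet.iUnion hA)]
    simpa only [preimage_iUnion] using h1

theorem spectralProjection_of_mem_range (hZ'Z : ∀ x, Z' (Z x) = x) (hZZ' : ∀ a, Z (Z' a) = a)
    (hδ : MeasurableSet δ) {x : X}
    (hx : x ∈ LinearMap.range (spectralProjection φ hφ Z Z' δ : X →ₗ[ℂ] X)) :
    spectralProjection φ hφ Z Z' δ x = x := by
  obtain ⟨y, rfl⟩ := hx
  have h := (isSpectralMeasure_spectralProjection (hφ := hφ) hZ'Z hZZ').inter δ δ hδ hδ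
  rw [inter_self] at h
  exact (congrArg (fun S : X →L[ℂ] X => S y) h).symm

/-- At positive distance from `δ` the function `(φ - z)⁻¹` is bounded on the preimage of `δ`;
multiplication by it inverts `T - z` on the range of the projection. -/
theorem spectrumOf_partIn_subset (hZ'Z : ∀ x, Z' (Z x) = x) (hZZ' : ∀ a, Z (Z' a) = a)
    {T : X →ₗ.[ℂ] X} (hT : ∀ f g, (f, g) ∈ T.graph ↔ ∀ᵐ x ∂μ, Z g x = φ x * Z f x)
    (hδ : MeasurableSet δ) :
    spectrumOf (partIn T (LinearMap.range (spectralProjection φ hφ Z Z' δ : X →ₗ[ℂ] X))) ⊆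
      closure δ := by
  intro z hz
  by_contra hzδ
  refine hz ?_
  rw [Metric.mem_closure_iff] at hzδ
  push Not at hzδ
  obtain ⟨ε, hε, hzε⟩ := hzδ
  have hinj : Function.Injective Z := Function.LeftInverse.injective hZ'Z
  set m : α → ℂ := (φ ⁻¹' δ).indicator fun x => (φ x - z)⁻¹ with hm
  have hmL : MemLp m ∞ μ := by
    refine memLp_top_of_bound (((hφ.sub_const z).inv.indicator (hφ hδ)).aestronglyMeasurable) ε⁻¹
      (Eventually.of_forall fun x => ?_)
    by_cases h : x ∈ φ ⁻¹' δ
    · rw [hm, indicator_of_mem h, norm_inv]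
      have := hzε _ h
      rw [dist_comm, dist_eq_norm] at this
      gcongr
    · rw [hm, indicator_of_notMem h, norm_zero]
      positivity
  have hne : ∀ x, x ∈ φ ⁻¹' δ → φ x - z ≠ 0 := by
    intro x hx h0
    have := hzε _ hx
    rw [dist_comm, dist_eq_norm, h0, norm_zero] at this
    linarith
  set E := spectralProjection φ hφ Z Z' δ with hE
  set M := LinearMap.range (E : X →ₗ[ℂ] X) with hM
  set R₀ : X →L[ℂ] X := Z'.comp ((mulOp m hmL).comp Z) with hR₀
  have hZR : ∀ x, Z (R₀ x) =ᵐ[μ] fun y => m y * Z x y := by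
    intro x
    have : Z (R₀ x) = mulOp m hmL (Z x) := hZZ' _
    rw [this]
    exact coeFn_mulOp hmL _
  have hmem : ∀ x ∈ M, ∀ᵐ y ∂μ, Z x y = (φ ⁻¹' δ).indicator (Z x) y := by
    intro x hx
    have h1 := coeFn_spectralProjection (hφ := hφ) hZZ' hδ x
    rwa [spectralProjection_of_mem_range hZ'Z hZZ' hδ hx] at h1
  have hRM : ∀ x, R₀ x ∈ M := by
    intro x
    refine ⟨R₀ x, hinj (Lp.ext ?_)⟩
    filter_upwards [coeFn_spectralProjection (hφ := hφ) hZZ' hδ (R₀ x), hZR x] with y h1 h2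
    refine h1.trans ?_
    by_cases h : y ∈ φ ⁻¹' δ
    · rw [indicator_of_mem h]
    · rw [indicator_of_notMem h, h2, hm, indicator_of_notMem h, zero_mul]
  -- Off the preimage of `δ` both components vanish, since `x` lies in the range of the projection;
  -- on it, this is division by `φ - z`.
  have hgraph : ∀ x ∈ M, (R₀ x, x + z • R₀ x) ∈ T.graph := by
    intro x hx
    rw [hT, map_add, map_smul]
    filter_upwards [Lp.coeFn_add (Z x) (z • Z (R₀ x)), Lp.coeFn_smul z (Z (R₀ x)), hZR x,
      hmem x hx] with y h1 h2 h3 h4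
    rw [h1, Pi.add_apply, h2, Pi.smul_apply, h3, smul_eq_mul]
    by_cases h : y ∈ φ ⁻¹' δ
    · have := hne y h
      rw [hm, indicator_of_mem h]
      field_simp
      ring
    · rw [h4, indicator_of_notMem h]
      ring
  refine ⟨(R₀.comp M.subtypeL).codRestrict M fun x => hRM x, fun x => ?_, fun x => ?_⟩
  · obtain ⟨h1, h2⟩ := LinearPMap.exists_of_mem_graph (hgraph x.1 x.2)
    refine ⟨⟨h1, ?_⟩, ?_⟩
    · have h3 : x.1 + z • R₀ x.1 ∈ M := M.add_mem x.2 (M.smul_mem z (hRM x.1))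
      rw [← h2] at h3
      exact h3
    · refine Subtype.ext ?_
      change T ⟨R₀ x.1, h1⟩ - z • R₀ x.1 = x.1
      rw [h2, add_sub_cancel_right]
  · refine Subtype.ext ?_
    obtain ⟨⟨x, hx⟩, hxd, hxT⟩ := x
    change R₀ (T ⟨x, hxd⟩ - z • x) = x
    have h1 := (hT _ _).1 (T.mem_graph ⟨x, hxd⟩)
    refine hinj (Lp.ext ?_)
    filter_upwards [hZR (T ⟨x, hxd⟩ - z • x), h1, hmem x hx, Lp.coeFn_sub (Z (T ⟨x, hxd⟩)) (z • Z x),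
      Lp.coeFn_smul z (Z x)] with y h2 h3 h4 h5 h6
    rw [h2, map_sub, map_smul, h5, Pi.sub_apply, h3, h6, Pi.smul_apply, smul_eq_mul, ← sub_mul]
    by_cases h : y ∈ φ ⁻¹' δ
    · rw [hm, indicator_of_mem h, ← mul_assoc, inv_mul_cancel₀ (hne y h), one_mul]
    · rw [h4, indicator_of_notMem h, mul_zero, mul_zero]

/-- An operator that is similar to a multiplication operator is spectral in the sense of
Dunford. -/
theorem isDunfordSpectral_of_similar (hφ : Measurable φ) (hZ'Z : ∀ x, Z' (Z x) = x)
    (hZZ' : ∀ a, Z (Z' a) = a) {T : X →ₗ.[ℂ] X}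
    (hT : ∀ f g, (f, g) ∈ T.graph ↔ ∀ᵐ x ∂μ, Z g x = φ x * Z f x) : IsDunfordSpectral T := by
  refine ⟨?_, spectralProjection φ hφ Z Z', isSpectralMeasure_spectralProjection hZ'Z hZZ',
    fun δ hδ x => ?_, fun δ hδ hb x => ?_, fun δ hδ => spectrumOf_partIn_subset hZ'Z hZZ' hT hδ⟩
  · have h1 : (T.graph : Set (X × X)) = (fun fg : X × X => (Z fg.1, Z fg.2)) ⁻¹'
        {ab : Lp ℂ 2 μ × Lp ℂ 2 μ | ∀ᵐ x ∂μ, ab.2 x = φ x * ab.1 x} := by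
      ext ⟨f, g⟩
      exact hT f g
    rw [LinearPMap.IsClosed, h1]
    exact (isClosed_ae_eq_mul φ).preimage (by fun_prop)
  · refine LinearPMap.exists_of_mem_graph ((hT _ _).2 ?_)
    filter_upwards [(hT _ _).1 (T.mem_graph x), coeFn_spectralProjection (hφ := hφ) hZZ' hδ (x : X),
      coeFn_spectralProjection (hφ := hφ) hZZ' hδ (T x)] with y h1 h2 h3
    rw [h2, h3]
    by_cases h : y ∈ φ ⁻¹' δ
    · rw [indicator_of_mem h, indicator_of_mem h, h1]
    · rw [indicator_of_notMem h, indicator_of_notMem h, mul_zero]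
  · obtain ⟨C, hC⟩ := hb.exists_norm_le
    have hm : MemLp ((φ ⁻¹' δ).indicator φ) ∞ μ := by
      refine memLp_top_of_bound ((hφ.indicator (hφ hδ)).aestronglyMeasurable) |C|
        (Eventually.of_forall fun y => ?_)
      by_cases h : y ∈ φ ⁻¹' δ
      · rw [indicator_of_mem h]
        exact (hC _ h).trans (le_abs_self C)
      · rw [indicator_of_notMem h, norm_zero]
        exact abs_nonneg C
    have h1 : (spectralProjection φ hφ Z Z' δ x, Z' (mulOp _ hm (Z x))) ∈ T.graph := by
      rw [hT, hZZ']
      filter_upwards [coeFn_mulOp hm (Z x), coeFn_spectralProjection (hφ := hφ) hZZ' hδ x]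
        with y h1 h2
      rw [h1, h2]
      by_cases h : y ∈ φ ⁻¹' δ
      · rw [indicator_of_mem h, indicator_of_mem h]
      · rw [indicator_of_notMem h, indicator_of_notMem h, zero_mul, mul_zero]
    exact (LinearPMap.exists_of_mem_graph h1).1

end Spectral

/-! ### The propagators of the free and of the perturbed operator -/

section Propagator

variable {V W : ℝ → ℂ} {U : ℝ → HalfLineL2 →L[ℂ] HalfLineL2}

theorem exists_sq_eq_of_im_ne_zero {z : ℂ} (hz : z.im ≠ 0) : ∃ k : ℂ, 0 < k.im ∧ k ^ 2 = z := by
  obtain ⟨k, hk⟩ := IsAlgClosed.exists_pow_nat_eq z (n := 2) two_pos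
  have h0 : k.im ≠ 0 := by
    intro h
    refine hz ?_
    rw [← hk, pow_two, Complex.mul_im, h]
    ring
  rcases lt_or_gt_of_ne h0 with h | h
  · exact ⟨-k, by simpa using h, by rw [neg_sq, hk]⟩
  · exact ⟨k, h, hk⟩

theorem isPropagator_of_hasGenerator_iff (hU : IsC0Group U)
    (h : ∀ f g, HasGenerator U f (Complex.I • g) ↔ (f, g) ∈ schrodingerGraph V) :
    IsPropagator (schrodingerOp V) U where
  zero := hU.zero
  add := hU.add
  continuous := hU.continuous
  generator f g := by
    have hg : g = Complex.I • (-Complex.I • g) := by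
      rw [smul_smul, mul_neg, Complex.I_mul_I, neg_neg, one_smul]
    constructor
    · intro h1
      have h2 : HasGenerator U f (Complex.I • (-Complex.I • g)) := by
        rw [← hg]
        exact h1
      rw [h, ← schrodingerOp_graph] at h2
      obtain ⟨hf, hfg⟩ := LinearPMap.exists_of_mem_graph h2
      exact ⟨hf, by rw [hfg]; exact hg⟩
    · rintro ⟨hf, rfl⟩
      refine (h _ _).2 ?_
      rw [← schrodingerOp_graph]
      exact (schrodingerOp V).mem_graph ⟨f, hf⟩

/-- For a generator `cL` with `c = ±i`, the transform of `A h` solves `(L - k²) y = c A h` with `k²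
= -cp`. This number is not real when `Re p > 0`, so a root in the upper half plane exists. -/
theorem resolventBound_of_sandwich_bound (hVb : MemLp V ∞ (volume.restrict (Ioi (0 : ℝ)))) {M : ℝ}
    (hM : ∀ k : ℂ, 0 < k.im → ∀ f h : HalfLineL2,
      (f, mulOp _ (memLp_sqrt_norm hVb) h + k ^ 2 • f) ∈ schrodingerGraph W →
      ‖mulOp _ (memLp_sqrt_norm hVb) f‖ ≤ M * ‖h‖)
    (hU : IsC0Group U) {c : ℂ} (hc : c = Complex.I ∨ c = -Complex.I)
    (h : ∀ f g, HasGenerator U f (c • g) → (f, g) ∈ schrodingerGraph W) :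
    ResolventBound U (mulOp _ (memLp_sqrt_norm hVb)) M := by
  intro ω hω0 hω p hp h'
  have hp0 : 0 < p.re := hω0.trans_lt hp
  have hcc : c * c = -1 := by rcases hc with rfl | rfl <;> simp
  have hcn : ‖c‖ = 1 := by rcases hc with rfl | rfl <;> simp
  have him : (-(c * p)).im ≠ 0 := by rcases hc with rfl | rfl <;> simpa using hp0.ne'
  obtain ⟨k, hk, hkc⟩ := exists_sq_eq_of_im_ne_zero him
  set A := mulOp _ (memLp_sqrt_norm hVb)
  have h1 := hU.hasGenerator_laplaceTransform hω hp (A h')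
  set y := laplaceTransform U p (A h')
  have h2 : p • y - A h' = c • (A (c • h') + k ^ 2 • y) := by
    rw [map_smul, hkc, smul_add, smul_smul, smul_smul, hcc, mul_neg, ← mul_assoc, hcc]
    module
  rw [h2] at h1
  have h3 := hM k hk y (c • h') (h _ _ h1)
  rwa [norm_smul, hcn, one_mul] at h3

theorem mem_schrodingerGraph_iff_zero (hVb : MemLp V ∞ (volume.restrict (Ioi (0 : ℝ))))
    {f g : HalfLineL2} :
    (f, g) ∈ schrodingerGraph V ↔ (f, g - mulOp V hVb f) ∈ schrodingerGraph 0 := by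
  constructor
  · rintro ⟨y, p, q, hy, hy0, hf, hg⟩
    refine ⟨y, p, q, hy, hy0, hf, ?_⟩
    filter_upwards [hf, hg, coeFn_mulOp hVb f, Lp.coeFn_sub g (mulOp V hVb f)] with x h1 h2 h3 h4
    rw [h4, Pi.sub_apply, h2, h3, h1]
    simp
  · rintro ⟨y, p, q, hy, hy0, hf, hg⟩
    refine ⟨y, p, q, hy, hy0, hf, ?_⟩
    filter_upwards [hf, hg, coeFn_mulOp hVb f, Lp.coeFn_sub g (mulOp V hVb f)] with x h1 h2 h3 h4
    rw [h4, Pi.sub_apply, h3, h1] at h2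
    rw [← sub_eq_iff_eq_add, h2]
    simp

/-- The free propagator, as a multiplication operator after the sine transform. -/
noncomputable def freePropagator (t : ℝ) : HalfLineL2 →L[ℂ] HalfLineL2 :=
  sineTransform.comp ((mulGroup _ freeSymbol measurable_freeSymbol t).comp sineTransform)

theorem norm_freePropagator (t : ℝ) (f : HalfLineL2) : ‖freePropagator t f‖ = ‖f‖ := by
  simp only [freePropagator, ContinuousLinearMap.comp_apply, norm_sineTransform, norm_mulGroup]

theorem sineTransform_freePropagator (t : ℝ) (f : HalfLineL2) :
    sineTransform (freePropagator t f) =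
      mulGroup _ freeSymbol measurable_freeSymbol t (sineTransform f) := by
  simp only [freePropagator, ContinuousLinearMap.comp_apply, sineTransform_sineTransform]

theorem isC0Group_freePropagator : IsC0Group freePropagator := by
  have hm := isC0Group_mulGroup (μ := volume.restrict (Ioi (0 : ℝ))) measurable_freeSymbol
  refine ⟨?_, fun s t => ?_, fun f => ?_⟩
  · ext1 f
    rw [freePropagator, hm.zero]
    exact sineTransform_sineTransform f
  · ext1 f
    simp only [freePropagator, ContinuousLinearMap.comp_apply, sineTransform_sineTransform,
      hm.apply_add]
  · exact sineTransform.continuous.comp (hm.continuous _)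

/-- The sine transform intertwines the group with multiplication by `e^{itφ}`, whose generator and
that of `L_0` are the same multiplier. -/
theorem hasGenerator_freePropagator_iff (f g : HalfLineL2) :
    HasGenerator freePropagator f (Complex.I • g) ↔ (f, g) ∈ schrodingerGraph 0 := by
  have h1 : HasGenerator freePropagator f (Complex.I • g) ↔
      HasGenerator (mulGroup _ freeSymbol measurable_freeSymbol) (sineTransform f)
        (sineTransform (Complex.I • g)) := by
    refine ⟨fun h => h.map _ sineTransform_freePropagator, fun h => ?_⟩
    have := h.map (u := freePropagator) sineTransform fun t x => by
      simp only [freePropagator, ContinuousLinearMap.comp_apply, sineTransform_sineTransform]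
    rwa [sineTransform_sineTransform, sineTransform_sineTransform] at this
  rw [h1, hasGenerator_mulGroup_iff, mem_schrodingerGraph_zero_iff, map_smul]
  have h2 := Lp.coeFn_smul Complex.I (sineTransform g)
  constructor
  · intro h
    filter_upwards [h, h2] with x h3 h4
    rw [h4, Pi.smul_apply, smul_eq_mul, mul_assoc] at h3
    exact mul_left_cancel₀ Complex.I_ne_zero h3
  · intro h
    filter_upwards [h, h2] with x h3 h4
    rw [h4, Pi.smul_apply, smul_eq_mul, mul_assoc, h3]

end Propagator

/-! ### Factorization of the potential -/

section Factor

variable {α : Type*} [MeasurableSpace α] {μ : Measure α} {V : α → ℂ}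

theorem norm_div_sqrt_norm (z : ℂ) : ‖Complex.I * (z / (√‖z‖ : ℝ))‖ = √‖z‖ := by
  rw [norm_mul, Complex.norm_I, one_mul, norm_div, Complex.norm_real,
    Real.norm_of_nonneg (Real.sqrt_nonneg _), Real.div_sqrt]

theorem sqrt_norm_mul_div_sqrt_norm (z : ℂ) :
    ((√‖z‖ : ℝ) : ℂ) * (Complex.I * (z / (√‖z‖ : ℝ))) = Complex.I * z := by
  -- At zeros of the potential the quotient is `0` by convention, which is the right value.
  by_cases hz : z = 0
  · simp [hz]
  · have : ((√‖z‖ : ℝ) : ℂ) ≠ 0 := by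
      exact_mod_cast (Real.sqrt_pos.2 (norm_pos_iff.2 hz)).ne'
    field_simp

theorem memLp_div_sqrt_norm (hV : MemLp V ∞ μ)
    (hV' : MemLp (fun x => ((√‖V x‖ : ℝ) : ℂ)) ∞ μ) :
    MemLp (fun x => Complex.I * (V x / (√‖V x‖ : ℝ))) ∞ μ := by
  refine hV'.of_le ?_ (Eventually.of_forall fun x => ?_)
  · exact (aemeasurable_const.mul
      (hV.1.aemeasurable.div hV'.1.aemeasurable)).aestronglyMeasurable
  · rw [norm_div_sqrt_norm, Complex.norm_real, Real.norm_of_nonneg (Real.sqrt_nonneg _)]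

theorem memLp_star (hV : MemLp V ∞ μ) : MemLp (fun x => star (V x)) ∞ μ :=
  hV.of_le (continuous_star.comp_aestronglyMeasurable hV.1)
    (Eventually.of_forall fun x => by rw [norm_star])

theorem norm_mulOp_le_norm_mulOp {a b : α → ℂ} (ha : MemLp a ∞ μ) (hb : MemLp b ∞ μ)
    (h : ∀ x, ‖a x‖ ≤ ‖b x‖) (f : Lp ℂ 2 μ) : ‖mulOp a ha f‖ ≤ ‖mulOp b hb f‖ := by
  refine Lp.norm_le_norm_of_ae_le ?_
  filter_upwards [coeFn_mulOp ha f, coeFn_mulOp hb f] with x h1 h2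
  rw [h1, h2, norm_mul, norm_mul]
  exact mul_le_mul_of_nonneg_right (h x) (norm_nonneg _)

end Factor

/-! ### The perturbed propagator and its wave operators -/

theorem corollary3 (V : ℝ → ℂ)
    (hV_bdd : MemLp V ∞ (volume.restrict (Ioi (0 : ℝ))))
    (hV_int : IntegrableOn (fun x : ℝ => x * ‖V x‖) (Ioi (0 : ℝ)) volume)
    (h_eig : ∀ z : ℂ, ¬ IsEigenvalue (schrodingerOp V) z)
    (h_sing : ∀ z : ℂ, ¬ IsSpectralSingularity V z) :
    -- the propagators `U₀ t = e^{itL_0}` and `U t = e^{itL_V}`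
    ∃ U₀ U : ℝ → HalfLineL2 →L[ℂ] HalfLineL2,
      IsPropagator (schrodingerOp 0) U₀ ∧ IsPropagator (schrodingerOp V) U ∧
      -- the wave operators `W_±` and the inverse wave operators `W̃_±`
      (∃ Wp Wm Wp' Wm' : HalfLineL2 →L[ℂ] HalfLineL2,
        (∀ f, Tendsto (fun t : ℝ => U t (U₀ (-t) f)) atTop (𝓝 (Wp f))) ∧
        (∀ f, Tendsto (fun t : ℝ => U t (U₀ (-t) f)) atBot (𝓝 (Wm f))) ∧
        (∀ f, Tendsto (fun t : ℝ => U₀ t (U (-t) f)) atTop (𝓝 (Wp' f))) ∧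
        (∀ f, Tendsto (fun t : ℝ => U₀ t (U (-t) f)) atBot (𝓝 (Wm' f))) ∧
        (∀ t : ℝ, U t = Wp.comp ((U₀ t).comp Wp')) ∧
        (∀ t : ℝ, U t = Wm.comp ((U₀ t).comp Wm'))) ∧
      (∃ C : ℝ, ∀ t : ℝ, ‖U t‖ ≤ C) ∧
      IsDunfordSpectral (schrodingerOp V) := by
  have hw := memLp_sqrt_norm hV_bdd
  have hc := memLp_div_sqrt_norm hV_bdd hw
  have hVs := memLp_star hV_bdd
  have hc' : MemLp (fun x => Complex.I * (star (V x) / (√‖V x‖ : ℝ))) ∞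
      (volume.restrict (Ioi (0 : ℝ))) := by
    simpa only [norm_star] using memLp_div_sqrt_norm hVs (by simpa only [norm_star] using hw)
  have hU₀ := isC0Group_freePropagator
  have hIV : MemLp (fun x => Complex.I * V x) ∞ (volume.restrict (Ioi (0 : ℝ))) :=
    hV_bdd.const_mul Complex.I
  have hIVs : MemLp (fun x => Complex.I * star (V x)) ∞ (volume.restrict (Ioi (0 : ℝ))) :=
    hVs.const_mul Complex.I
  -- The factorization `iV = A C`, and likewise for the conjugate potential, whose perturbation is
  -- minus the adjoint of the original one.
  have hAC := mulOp_comp hw hc hIV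
    (Eventually.of_forall fun x => (sqrt_norm_mul_div_sqrt_norm (V x)).symm)
  have hAC' := mulOp_comp hw hc' hIVs (Eventually.of_forall fun x => by
    have := sqrt_norm_mul_div_sqrt_norm (star (V x))
    rw [norm_star] at this
    exact this.symm)
  obtain ⟨U, hU, hpert, K, ω, hω0, hω⟩ := exists_perturbation hU₀ norm_freePropagator
    ((mulOp _ hw).comp (mulOp _ hc))
  have hgen₀ := hasGenerator_freePropagator_iff
  have hgen : ∀ f g, HasGenerator U f (Complex.I • g) ↔ (f, g) ∈ schrodingerGraph V := by
    intro f g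
    -- A bounded perturbation does not change the domain, so identifying the generator of `U`
    -- reduces to the free case.
    rw [mem_schrodingerGraph_iff_zero hV_bdd, ← hgen₀,
      hpert.hasGenerator_iff hU₀ hU norm_freePropagator, ← hAC]
    have : mulOp _ hIV f = Complex.I • mulOp V hV_bdd f := by
      refine Lp.ext ?_
      filter_upwards [coeFn_mulOp hIV f, coeFn_mulOp hV_bdd f,
        Lp.coeFn_smul Complex.I (mulOp V hV_bdd f)] with x h1 h2 h3
      rw [h1, h3, Pi.smul_apply, h2, smul_eq_mul, mul_assoc]
    rw [this, ← smul_add, sub_add_cancel]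
  obtain ⟨C, hC0, hC⟩ := exists_resolvent_bound hV_bdd hV_int
    (jost_ne_zero hV_bdd hV_int h_eig h_sing)
  obtain ⟨M, hM0, hM⟩ := exists_sandwich_bound hV_bdd hV_int hC0 hC
  -- The free resolvent is sandwiched between the same factors `√|V|`, which is why the sandwich
  -- bound admits two potentials.
  obtain ⟨C₀, hC₀0, hC₀⟩ := exists_resolvent_bound (V := 0) MemLp.zero (by simp)
    fun k m C _ _ _ hm => by
      rw [hm 0 le_rfl]
      simp
  obtain ⟨M₀, hM₀0, hM₀⟩ := exists_sandwich_bound hV_bdd hV_int hC₀0 hC₀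
  have hA : ContinuousLinearMap.adjoint (mulOp _ hw) = mulOp _ hw :=
    adjoint_mulOp hw hw (Eventually.of_forall fun x => by simp)
  have hdual : ∀ f g, inner ℂ (mulOp _ hw (mulOp _ hc f)) g +
      inner ℂ f (mulOp _ hw (mulOp _ hc' g)) = 0 := by
    intro f g
    rw [← ContinuousLinearMap.comp_apply, ← ContinuousLinearMap.comp_apply, ← hAC, ← hAC',
      ← ContinuousLinearMap.adjoint_inner_right,
      adjoint_mulOp hIV (c := fun x => -(Complex.I * star (V x))) hIVs.neg
        (Eventually.of_forall fun x => by simp),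
      ← inner_add_right]
    convert inner_zero_right f
    refine Lp.ext ?_
    filter_upwards [Lp.coeFn_add (mulOp _ hIVs.neg g) (mulOp _ hIVs g),
      coeFn_mulOp hIVs.neg g, coeFn_mulOp hIVs g,
      Lp.coeFn_zero ℂ 2 (volume.restrict (Ioi (0 : ℝ)))] with x h1 h2 h3 h4
    refine h1.trans ?_
    rw [Pi.add_apply, h2, h3, h4]
    simp
  have hle : ∀ x, ‖mulOp _ hc x‖ ≤ ‖mulOp _ hw x‖ :=
    norm_mulOp_le_norm_mulOp hc hw fun x => by
      rw [norm_div_sqrt_norm, Complex.norm_real, Real.norm_of_nonneg (Real.sqrt_nonneg _)]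
  have hle' : ∀ x, ‖mulOp _ hc' x‖ ≤ ‖mulOp _ hw x‖ :=
    norm_mulOp_le_norm_mulOp hc' hw fun x => by
      have := norm_div_sqrt_norm (star (V x))
      rw [norm_star] at this
      rw [this, Complex.norm_real, Real.norm_of_nonneg (Real.sqrt_nonneg _)]
  obtain ⟨⟨N, hN⟩, Wp, Wm, Wp', Wm', hWp, hWm, hWp', hWm'⟩ :=
    hpert.exists_wave_operators hU₀ hU norm_freePropagator hA hle hle' hdual hω0 hω hM₀0
      (resolventBound_of_sandwich_bound hV_bdd hM₀ hU₀ (.inl rfl) fun f g => (hgen₀ f g).1)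
      (resolventBound_of_sandwich_bound hV_bdd hM₀ hU₀.neg (.inr rfl) fun f g h =>
        (hgen₀ f g).1 (hasGenerator_neg_iff.1 (by rwa [neg_smul] at h)))
      hM0
      (resolventBound_of_sandwich_bound hV_bdd hM hU (.inl rfl) fun f g => (hgen f g).1)
      (resolventBound_of_sandwich_bound hV_bdd hM hU.neg (.inr rfl) fun f g h =>
        (hgen f g).1 (hasGenerator_neg_iff.1 (by rwa [neg_smul] at h)))
  obtain ⟨hp₁, hp₂, hp₃⟩ := IsC0Group.wave_operators_inverse
    (fun s => tendsto_atTop_add_const_left atTop s tendsto_id) hU₀ hU norm_freePropagator hN hWp hWp'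
  obtain ⟨-, hm₂, hm₃⟩ := IsC0Group.wave_operators_inverse
    (fun s => tendsto_atBot_add_const_left atBot s tendsto_id) hU₀ hU norm_freePropagator hN hWm hWm'
  refine ⟨freePropagator, U, isPropagator_of_hasGenerator_iff hU₀ hgen₀,
    isPropagator_of_hasGenerator_iff hU hgen,
    ⟨Wp, Wm, Wp', Wm', hWp, hWm, hWp', hWm', fun t => ?_, fun t => ?_⟩, ⟨N, hN⟩, ?_⟩
  · ext1 f
    rw [ContinuousLinearMap.comp_apply, ContinuousLinearMap.comp_apply, ← hp₃, hp₂]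
  · ext1 f
    rw [ContinuousLinearMap.comp_apply, ContinuousLinearMap.comp_apply, ← hm₃, hm₂]
  -- The similarity is the inverse wave operator followed by the sine transform; the multiplier is
  -- the symbol of the free operator.
  · refine isDunfordSpectral_of_similar (μ := volume.restrict (Ioi (0 : ℝ)))
      (φ := fun ξ => (freeSymbol ξ : ℂ)) (Z := sineTransform.comp Wp')
      (Z' := Wp.comp sineTransform) (Complex.measurable_ofReal.comp measurable_freeSymbol)
      (fun x => ?_) (fun a => ?_) fun f g => ?_
    · simp only [ContinuousLinearMap.comp_apply, sineTransform_sineTransform, hp₂]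
    · simp only [ContinuousLinearMap.comp_apply, hp₁, sineTransform_sineTransform]
    · simp only [ContinuousLinearMap.comp_apply]
      rw [schrodingerOp_graph, ← hgen, ← mem_schrodingerGraph_zero_iff, ← hgen₀, ← map_smul]
      refine ⟨fun h => h.map Wp' fun t x => ?_, fun h => ?_⟩
      -- Intertwining for the inverse wave operator follows from that for `Wp`, since the two are
      -- mutually inverse.
      · rw [← hp₁ (freePropagator t (Wp' x)), ← hp₃, hp₂]
      · have := h.map (u := U) Wp fun t x => (hp₃ t x).symm
        rwa [hp₂, hp₂] at this
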